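/- Let $M$ be a smooth, paracompact (Hausdorff) manifold and let $G$ be a connected Lie group acting smoothly and properly on $M$, with action $\Phi_g(m)=g\cdot m$ and Lie algebra $\mathfrak g$. For $m\in M$ let $\mathcal V(m)=\{\xi_M(m)\mid \xi\in\mathfrak g\}\subseteq T_mM$ be the span of the fundamental vector fields. For a tangent distribution $\Delta$, its smooth annihilator $\Delta^\circ$ consists at $m$ of the values $\alpha(m)$ of the smooth one-forms $\alpha$, defined near $m$, that vanish on all smooth local sections of $\Delta$; the smooth annihilator of a codistribution is defined in the same way. Put $$\mathcal V^\circ_G(m)=\{\alpha(m)\mid \alpha \text{ a } G\text{-invariant smooth section of } \mathcal V^\circ \text{ on a } G\text{-invariant open neighbourhood of } m\}.$$ Let $P$ be a stratum of $M$, i.e. a connected component of an orbit type set $M_{(H)}=\{m\in M\mid G_m \text{ is conjugate to } H\}$, and let $\iota_P:P\hookrightarrow M$ be the inclusion. Then $P$ is $G$-invariant and, with the subspace topology, has the structure of a smooth embedded submanifold of $M$. Let $\mathcal V_P\subseteq TP$ be the vertical distribution of the induced action of $G$ on $P$, and $(\mathcal V_P)^\circ\subseteq T^*P$ its smooth annihilator.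 Then: 1. $\iota_P^*(\mathcal V^\circ_G)=(\mathcal V_P)^\circ$, that is, $\iota_P^*(\mathcal V^\circ_G(p))=(\mathcal V_P)^\circ(p)$ for all $p\in P$. 2. $\mathcal V^\circ_G|_P$ is a smooth vector subbundle of $T^*M|_P$, $(\mathcal V_P)^\circ$ is a smooth vector subbundle of $T^*P$, and $\iota_P^*:\mathcal V^\circ_G|_P\to(\mathcal V_P)^\circ$ is an isomorphism of smooth vector bundles over $P$. 3. For every $G$-invariant Riemannian metric $\rho$ on $M$, with $TP^\perp\subseteq TM|_P$ the $\rho$-orthogonal complement of $TP$, the smooth annihilator of $\mathcal V^\circ_G|_P$ in $TM|_P$ is $$(\mathcal V^\circ_G|_P)^\circ=\mathcal V|_P\oplus TP^\perp.$$ -/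

import Mathlib

open Manifold Bundle Topology
open scoped ContDiff

noncomputable section

/-! ### Smooth vector fields and one-forms along a map

Local sections of `TM` and `T*M`, and of their pullbacks along a map `f : N → M` (for the
inclusion of a submanifold, these are the sections of `TM|_N` and `T*M|_N`; for the identity they
are ordinary vector fields and one-forms). -/

section Sections

variable {E : Type*} [NormedAddCommGroup E] [NormedSpace ℝ E] {H : Type*} [TopologicalSpace H]
  (I : ModelWithCorners ℝ E H) {M : Type*} [TopologicalSpace M] [ChartedSpace H M]
  {E' : Type*} [NormedAddCommGroup E'] [NormedSpace ℝ E'] {H' : Type*} [TopologicalSpace H']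
  (J : ModelWithCorners ℝ E' H') {N : Type*} [TopologicalSpace N] [ChartedSpace H' N]

/-- The fibre `T*_m M` of the cotangent bundle. -/
abbrev CotangentSpace (m : M) : Type _ := TangentSpace I m →L[ℝ] Bundle.Trivial M ℝ m

variable [IsManifold I ∞ M]

/-- `X` is a smooth section over `U ⊆ N` of the pullback of `TM` along `f`. -/
def SmoothFieldOn (f : N → M) (X : ∀ q, TangentSpace I (f q)) (U : Set N) : Prop :=
  ContMDiffOn J (I.prod 𝓘(ℝ, E)) ∞
    (fun q => TotalSpace.mk' E (E := fun m : M => TangentSpace I m) (f q) (X q)) U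

/-- `α` is a smooth section over `U ⊆ N` of the pullback of `T*M` along `f`. -/
def SmoothFormOn (f : N → M) (α : ∀ q, CotangentSpace I (f q)) (U : Set N) : Prop :=
  ContMDiffOn J (I.prod 𝓘(ℝ, E →L[ℝ] ℝ)) ∞
    (fun q => TotalSpace.mk' (E →L[ℝ] ℝ) (E := fun m : M => CotangentSpace I m) (f q) (α q)) U

/-- The smooth annihilator `Δ°` of a tangent distribution `Δ` on `M`: the values of those smooth
local one-forms that vanish on every smooth local section of `Δ`. -/
def smoothAnnihilator (Δ : ∀ m : M, Submodule ℝ (TangentSpace I m)) (m : M) :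
    Submodule ℝ (CotangentSpace I m) where
  carrier := {a | ∃ U : Set M, IsOpen U ∧ m ∈ U ∧ ∃ α : ∀ x : M, CotangentSpace I x,
    SmoothFormOn I I (fun x : M => x) α U ∧
    (∀ (W : Set M) (X : ∀ x : M, TangentSpace I x), IsOpen W →
      SmoothFieldOn I I (fun x : M => x) X W → (∀ x ∈ W, X x ∈ Δ x) →
      ∀ x ∈ U ∩ W, α x (X x) = 0) ∧
    α m = a}
  zero_mem' := by
    refine ⟨Set.univ, isOpen_univ, trivial, fun _ => 0, ?_, fun _ _ _ _ _ _ _ => rfl, rfl⟩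
    exact (contMDiff_zeroSection ℝ (fun m : M => CotangentSpace I m)).contMDiffOn
  add_mem' := by
    rintro a b ⟨U, hU, hmU, α, hα, hα', rfl⟩ ⟨V, hV, hmV, β, hβ, hβ', rfl⟩
    refine ⟨U ∩ V, hU.inter hV, ⟨hmU, hmV⟩, fun x => α x + β x, ?_, ?_, rfl⟩
    · exact ContMDiffOn.add_section (hα.mono Set.inter_subset_left)
        (hβ.mono Set.inter_subset_right)
    · intro W X hW hX hXΔ x hx
      have h1 := hα' W X hW hX hXΔ x ⟨hx.1.1, hx.2⟩
      have h2 := hβ' W X hW hX hXΔ x ⟨hx.1.2, hx.2⟩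
      change α x (X x) + β x (X x) = 0
      rw [h1, h2, add_zero]
  smul_mem' := by
    rintro c a ⟨U, hU, hmU, α, hα, hα', rfl⟩
    refine ⟨U, hU, hmU, fun x => c • α x, ?_, ?_, rfl⟩
    · exact ContMDiffOn.const_smul_section hα
    · intro W X hW hX hXΔ x hx
      have h1 := hα' W X hW hX hXΔ x hx
      change c • α x (X x) = 0
      rw [h1, smul_zero]

/-- The smooth annihilator `C°`, inside the pullback of `TM` along `f : N → M`, of a family `C` of
subspaces of the pullback of `T*M`: the values of those smooth local sections of the pullback of
`TM` on which every smooth local section of `C` vanishes. -/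
def smoothCoannihilator (f : N → M) (C : ∀ q, Submodule ℝ (CotangentSpace I (f q))) (q : N) :
    Set (TangentSpace I (f q)) :=
  {v | ∃ U : Set N, IsOpen U ∧ q ∈ U ∧ ∃ X : ∀ x : N, TangentSpace I (f x),
    SmoothFieldOn I J f X U ∧
    (∀ (W : Set N) (α : ∀ x : N, CotangentSpace I (f x)), IsOpen W →
      SmoothFormOn I J f α W → (∀ x ∈ W, α x ∈ C x) → ∀ x ∈ U ∩ W, α x (X x) = 0) ∧
    X q = v}

/-- The family `C` of subspaces of the pullback of `T*M` along `f : N → M` is a smooth vector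
subbundle: for some `r`, it has smooth local frames of length `r` near every point of `N`. -/
def IsSmoothSubbundle (f : N → M) (C : ∀ q, Submodule ℝ (CotangentSpace I (f q))) : Prop :=
  ∃ r : ℕ, ∀ q : N, ∃ U : Set N, IsOpen U ∧ q ∈ U ∧
    ∃ σ : Fin r → ∀ x : N, CotangentSpace I (f x),
      (∀ i, SmoothFormOn I J f (σ i) U) ∧
      ∀ x ∈ U, LinearIndependent ℝ (fun i => σ i x) ∧
        Submodule.span ℝ (Set.range fun i => σ i x) = C x

/-- Pullback of covectors at `q` along `f : N → M`, that is `a ↦ a ∘ T_q f`. -/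
def pullbackCovector (f : N → M) (q : N) : CotangentSpace I (f q) →ₗ[ℝ] CotangentSpace J q where
  toFun a := a.comp (mfderiv J I f q)
  map_add' _ _ := rfl
  map_smul' _ _ := rfl

/-- Pullback of covectors along `f : N → M` restricts to an isomorphism of smooth vector bundles
over `N` from the subbundle `C` of the pullback of `T*M` to the subbundle `D` of `T*N`:
both are smooth subbundles, the map is a linear bijection on every fibre, and both it and its
inverse take smooth local sections to smooth local sections. -/
def IsPullbackBundleIso [IsManifold J ∞ N] (f : N → M)
    (C : ∀ q, Submodule ℝ (CotangentSpace I (f q)))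
    (D : ∀ q : N, Submodule ℝ (CotangentSpace J q)) : Prop :=
  IsSmoothSubbundle I J f C ∧ IsSmoothSubbundle J J (fun q : N => q) D ∧
  (∀ q, Set.BijOn (pullbackCovector I J f q) (C q) (D q)) ∧
  ∀ (U : Set N) (σ : ∀ q, CotangentSpace I (f q)), IsOpen U → (∀ q ∈ U, σ q ∈ C q) →
    (SmoothFormOn I J f σ U ↔
      SmoothFormOn J J (fun q : N => q) (fun q => pullbackCovector I J f q (σ q)) U)

/-- The orthogonal complement `(T_q N)^⊥ ⊆ T_{f q} M` of the image of `T_q N` under `T_q f`, with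
respect to the Riemannian metric `ρ` on `M`. -/
def normalSpace (ρ : ContMDiffRiemannianMetric I ∞ E (fun m : M => TangentSpace I m))
    (f : N → M) (q : N) : Submodule ℝ (TangentSpace I (f q)) where
  carrier := {v | ∀ w : TangentSpace J q, ρ.inner (f q) (mfderiv J I f q w) v = 0}
  zero_mem' := fun _ => map_zero _
  add_mem' := by
    intro a b ha hb w
    rw [map_add, ha w, hb w, add_zero]
  smul_mem' := by
    intro c a ha w
    rw [map_smul, ha w, smul_zero]

end Sections

/-! ### Group actions -/

section Actions

variable {EG : Type*} [NormedAddCommGroup EG] [NormedSpace ℝ EG] {HG : Type*} [TopologicalSpace HG]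
  (IG : ModelWithCorners ℝ EG HG) (G : Type*) [TopologicalSpace G] [ChartedSpace HG G] [Group G]
  {E : Type*} [NormedAddCommGroup E] [NormedSpace ℝ E] {H : Type*} [TopologicalSpace H]
  (I : ModelWithCorners ℝ E H) {M : Type*} [TopologicalSpace M] [ChartedSpace H M] [MulAction G M]

/-- The value at `m` of the fundamental vector field `ξ_M`, as a linear function of `ξ`: the
derivative at the identity of the orbit map `g ↦ g • m`. (Its values live in the tangent space at
`1 • m = m`.) -/
def fundamentalField (m : M) : GroupLieAlgebra IG G →L[ℝ] TangentSpace I m :=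
  mfderiv IG I (fun g : G => g • m) 1

/-- The vertical distribution `𝒱(m) = {ξ_M(m) | ξ ∈ 𝔤}`. -/
def verticalSpace (m : M) : Submodule ℝ (TangentSpace I m) :=
  LinearMap.range (fundamentalField IG G I m).toLinearMap

/-- `𝒱°_G(m) = {α(m) | α ∈ Γ(𝒱°)^G}`: the values at `m` of the `G`-invariant smooth local sections
of the smooth annihilator `𝒱°`, defined on `G`-invariant open sets. -/
def invariantVerticalAnnihilator [IsManifold I ∞ M] (m : M) :
    Submodule ℝ (CotangentSpace I m) where
  carrier := {a | ∃ U : Set M, IsOpen U ∧ m ∈ U ∧ (∀ (g : G), ∀ x ∈ U, g • x ∈ U) ∧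
    ∃ α : ∀ x : M, CotangentSpace I x,
      SmoothFormOn I I (fun x : M => x) α U ∧
      (∀ x ∈ U, α x ∈ smoothAnnihilator I (fun y : M => verticalSpace IG G I y) x) ∧
      (∀ (g : G), ∀ x ∈ U, pullbackCovector I I (fun y : M => g • y) x (α (g • x)) = α x) ∧
      α m = a}
  zero_mem' := by
    refine ⟨Set.univ, isOpen_univ, trivial, fun _ _ _ => trivial, fun _ => 0, ?_,
      fun _ _ => Submodule.zero_mem _, fun _ _ _ => map_zero _, rfl⟩
    exact (contMDiff_zeroSection ℝ (fun m : M => CotangentSpace I m)).contMDiffOn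
  add_mem' := by
    rintro a b ⟨U, hU, hmU, hUG, α, hα, hα', hαG, rfl⟩ ⟨V, hV, hmV, hVG, β, hβ, hβ', hβG, rfl⟩
    refine ⟨U ∩ V, hU.inter hV, ⟨hmU, hmV⟩, fun g x hx => ⟨hUG g x hx.1, hVG g x hx.2⟩,
      fun x => α x + β x, ?_, fun x hx => Submodule.add_mem _ (hα' x hx.1) (hβ' x hx.2), ?_, rfl⟩
    · exact ContMDiffOn.add_section (hα.mono Set.inter_subset_left)
        (hβ.mono Set.inter_subset_right)
    · intro g x hx
      rw [map_add, hαG g x hx.1, hβG g x hx.2]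
  smul_mem' := by
    rintro c a ⟨U, hU, hmU, hUG, α, hα, hα', hαG, rfl⟩
    refine ⟨U, hU, hmU, hUG, fun x => c • α x, ContMDiffOn.const_smul_section hα,
      fun x hx => Submodule.smul_mem _ c (hα' x hx), ?_, rfl⟩
    intro g x hx
    rw [map_smul, hαG g x hx]

/-- The Riemannian metric `ρ` is `G`-invariant: every `g ∈ G` acts by isometries. -/
def IsInvariantMetric [IsManifold I ∞ M]
    (ρ : ContMDiffRiemannianMetric I ∞ E (fun m : M => TangentSpace I m)) : Prop :=
  ∀ (g : G) (m : M) (v w : TangentSpace I m),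
    ρ.inner (g • m) (mfderiv I I (fun y : M => g • y) m v) (mfderiv I I (fun y : M => g • y) m w)
      = ρ.inner m v w

end Actions

/-! ### Orbit types -/

section OrbitType

variable {G : Type*} [Group G] (M : Type*) [MulAction G M]

/-- The orbit type set `M_(K)` of the points whose isotropy group is conjugate to `K`. -/
def orbitTypeSet (K : Subgroup G) : Set M :=
  {m | ∃ g : G, MulAction.stabilizer G m = K.map (MulAut.conj g).toMonoidHom}

variable {M}

theorem smul_mem_orbitTypeSet (K : Subgroup G) (g : G) {m : M} (hm : m ∈ orbitTypeSet M K) :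
    g • m ∈ orbitTypeSet M K := by
  obtain ⟨h, hh⟩ := hm
  refine ⟨g * h, ?_⟩
  rw [MulAction.stabilizer_smul_eq_stabilizer_map_conj, hh, Subgroup.map_map]
  congr 1
  ext x
  simp

/-- The connected component of the orbit type set `M_(K)` through `m`. As `G` is connected, this is
a `G`-invariant subset of `M`, and so carries the induced action of `G`. -/
def orbitTypeStratum [TopologicalSpace G] [ConnectedSpace G] [TopologicalSpace M]
    [ContinuousSMul G M] (K : Subgroup G) (m : M) : SubMulAction G M where
  carrier := connectedComponentIn (orbitTypeSet M K) m
  smul_mem' := by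
    intro g x hx
    have hxF : x ∈ orbitTypeSet M K := connectedComponentIn_subset _ _ hx
    rw [connectedComponentIn_eq hx]
    have hc : IsPreconnected (Set.range fun h : G => h • x) :=
      isPreconnected_range (continuous_id.smul continuous_const)
    refine hc.subset_connectedComponentIn ⟨1, one_smul G x⟩ ?_ ⟨g, rfl⟩
    rintro _ ⟨h, rfl⟩
    exact smul_mem_orbitTypeSet K h hxF

end OrbitType

end

/-!
Isotropy groups of a proper action are compact. Averaging over the isotropy group of `p` gives a
chart at `p` in which that group acts linearly, and from it a slice: in slice coordinates the
stratum through `p` consists of the vectors fixed by the isotropy group modulo the tangent space of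
the orbit. Hence the stratum is an embedded submanifold whose tangent space at `p` is this space of
fixed vectors.

A covector at `p` is the value of an invariant section of `𝒱°` exactly if it is *basic*: it
vanishes on the orbit and is invariant under the isotropy group. Indeed, an invariant linear
functional in slice coordinates is locally the restriction of a `G`-invariant smooth function, whose
differential is the required section. An invariant covector factors through averaging, so a basic
covector is determined by its restriction to the tangent space of the stratum, and any covector
there that vanishes on the orbit extends to a basic one. Orbits in a stratum have constant
dimension, so the differentials of invariant functions give local frames, which makes the pullback
an isomorphism of vector bundles.

For an invariant metric, the vector representing a basic covector is fixed by the isotropy group,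
hence tangent to the stratum, so basic covectors vanish on the normal space. Conversely, a vector
tangent to the stratum but not to the orbit is detected by some basic covector.
-/

section Calculus

variable {E : Type*} [NormedAddCommGroup E] [NormedSpace ℝ E]
  {F : Type*} [NormedAddCommGroup F] [NormedSpace ℝ F]
  {M : Type*} [TopologicalSpace M] [ChartedSpace E M]
  {N : Type*} [TopologicalSpace N] [ChartedSpace F N]

theorem exists_openPartialHomeomorph_of_contDiffOn [CompleteSpace E] {f : E → F} {W : Set E}
    {p : E} (hW : IsOpen W) (hp : p ∈ W) (hf : ContDiffOn ℝ ∞ f W) (L : E ≃L[ℝ] F)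
    (hL : HasFDerivAt f (L : E →L[ℝ] F) p) :
    ∃ e : OpenPartialHomeomorph E F, p ∈ e.source ∧ e.source ⊆ W ∧ (∀ x, e x = f x) ∧
      ContDiffOn ℝ ∞ e.symm e.target := by
  have hfp : ContDiffAt ℝ ∞ f p := hf.contDiffAt (hW.mem_nhds hp)
  let e₀ := hfp.toOpenPartialHomeomorph f hL (by simp)
  have hcont : ContinuousOn (fderiv ℝ f) W := hf.continuousOn_fderiv_of_isOpen hW (by simp)
  have hO : IsOpen (W ∩ fderiv ℝ f ⁻¹' (Set.range ((↑) : (E ≃L[ℝ] F) → E →L[ℝ] F))) :=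
    hcont.isOpen_inter_preimage hW ContinuousLinearEquiv.isOpen
  refine ⟨e₀.restrOpen _ hO, ?_, ?_, fun x => rfl, ?_⟩
  · refine ⟨hfp.mem_toOpenPartialHomeomorph_source hL (by simp), hp, L, hL.fderiv.symm⟩
  · exact fun x hx => hx.2.1
  · intro y hy
    obtain ⟨-, hyW, L', hL'⟩ := (e₀.restrOpen _ hO).map_target hy
    have hfy := hf.contDiffAt (hW.mem_nhds hyW)
    refine ((e₀.restrOpen _ hO).contDiffAt_symm (f₀' := L') hy ?_ hfy).contDiffWithinAt
    rw [hL']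
    exact (hfy.differentiableAt (by simp)).hasFDerivAt

theorem exists_openPartialHomeomorph_of_contMDiffOn [CompleteSpace E] [IsManifold 𝓘(ℝ, E) ∞ M]
    {f : M → F} {W : Set M} {p : M}
    (hW : IsOpen W) (hp : p ∈ W) (hf : ContMDiffOn 𝓘(ℝ, E) 𝓘(ℝ, F) ∞ f W) (L : E ≃L[ℝ] F)
    (hL : HasMFDerivAt 𝓘(ℝ, E) 𝓘(ℝ, F) f p (L : E →L[ℝ] F)) :
    ∃ e : OpenPartialHomeomorph M F, p ∈ e.source ∧ e.source ⊆ W ∧ (∀ x ∈ e.source, e x = f x) ∧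
      ContMDiffOn 𝓘(ℝ, E) 𝓘(ℝ, F) ∞ e e.source ∧
      ContMDiffOn 𝓘(ℝ, F) 𝓘(ℝ, E) ∞ e.symm e.target := by
  let c := chartAt E p
  have hpc : p ∈ c.source := mem_chart_source E p
  have hO : IsOpen (c.target ∩ c.symm ⁻¹' W) := c.isOpen_inter_preimage_symm hW
  have hfc : ContDiffOn ℝ ∞ (f ∘ c.symm) (c.target ∩ c.symm ⁻¹' W) := by
    rw [← contMDiffOn_iff_contDiffOn]
    exact hf.comp ((contMDiffOn_chart_symm (I := 𝓘(ℝ, E)) (x := p)).mono Set.inter_subset_left)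
      Set.inter_subset_right
  have hd : HasFDerivAt (f ∘ c.symm) (L : E →L[ℝ] F) (c p) := by
    have hwritten := hL.2
    simp only [writtenInExtChartAt, extChartAt, mfld_simps] at hwritten
    exact hasFDerivWithinAt_univ.1 hwritten
  obtain ⟨e, he, heW, hef, hes⟩ := exists_openPartialHomeomorph_of_contDiffOn hO
    (show c p ∈ _ from ⟨c.map_source hpc, by
      rw [Set.mem_preimage, c.left_inv hpc]; exact hp⟩) hfc L hd
  have heq : ∀ x ∈ (c.trans e).source, (c.trans e) x = f x := fun x hx => by
    rw [OpenPartialHomeomorph.trans_source] at hx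
    rw [OpenPartialHomeomorph.coe_trans, Function.comp_apply, hef, Function.comp_apply,
      c.left_inv hx.1]
  have hsub : (c.trans e).source ⊆ W := fun x hx => by
    rw [OpenPartialHomeomorph.trans_source] at hx
    have := (heW hx.2).2
    rwa [Set.mem_preimage, c.left_inv hx.1] at this
  refine ⟨c.trans e, ?_, hsub, heq, ?_, ?_⟩
  · rw [OpenPartialHomeomorph.trans_source]
    exact ⟨hpc, he⟩
  · exact (hf.mono hsub).congr heq
  · rw [OpenPartialHomeomorph.coe_trans_symm, OpenPartialHomeomorph.trans_target]
    exact (contMDiffOn_chart_symm (I := 𝓘(ℝ, E)) (x := p)).comp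
      ((contMDiffOn_iff_contDiffOn.2 hes).mono Set.inter_subset_left) Set.inter_subset_right

theorem hasMFDerivAt_comp_of_eq {F' : Type*} [NormedAddCommGroup F'] [NormedSpace ℝ F']
    {N' : Type*} [TopologicalSpace N'] [ChartedSpace F' N'] {f : M → N} {g : N → N'}
    {x : M} {y : N} {g' : F →L[ℝ] F'} {f' : E →L[ℝ] F}
    (hg : HasMFDerivAt 𝓘(ℝ, F) 𝓘(ℝ, F') g y g') (hf : HasMFDerivAt 𝓘(ℝ, E) 𝓘(ℝ, F) f x f')
    (h : f x = y) :
    HasMFDerivAt 𝓘(ℝ, E) 𝓘(ℝ, F') (g ∘ f) x (g'.comp f') := by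
  subst h
  exact hg.comp x hf

theorem exists_hasMFDerivAt_equiv {e : OpenPartialHomeomorph M N}
    (he : e.MDifferentiable 𝓘(ℝ, E) 𝓘(ℝ, F)) {x : M} (hx : x ∈ e.source) :
    ∃ D : E ≃L[ℝ] F, HasMFDerivAt 𝓘(ℝ, E) 𝓘(ℝ, F) e x (D : E →L[ℝ] F) ∧
      HasMFDerivAt 𝓘(ℝ, F) 𝓘(ℝ, E) e.symm (e x) (D.symm : F →L[ℝ] E) :=
  ⟨he.mfderiv hx, (he.mdifferentiableAt hx).hasMFDerivAt,
    (he.mdifferentiableAt_symm (e.map_source hx)).hasMFDerivAt⟩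

theorem hasMFDerivAt_symm_id {N : Type*} [TopologicalSpace N] [ChartedSpace E N]
    {e : OpenPartialHomeomorph M N} (he : e.MDifferentiable 𝓘(ℝ, E) 𝓘(ℝ, E)) {x : M}
    (hx : x ∈ e.source)
    (hid : HasMFDerivAt 𝓘(ℝ, E) 𝓘(ℝ, E) e x (ContinuousLinearMap.id ℝ E)) :
    HasMFDerivAt 𝓘(ℝ, E) 𝓘(ℝ, E) e.symm (e x) (ContinuousLinearMap.id ℝ E) := by
  obtain ⟨D, hD, hDsymm⟩ := exists_hasMFDerivAt_equiv he hx
  have hDid : (D : E →L[ℝ] E) = ContinuousLinearMap.id ℝ E := hasMFDerivAt_unique hD hid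
  refine hDsymm.congr_mfderiv (ContinuousLinearMap.ext fun v => ?_)
  exact D.symm_apply_eq.2 (DFunLike.congr_fun hDid v).symm

theorem hasMFDerivAt_chartAt_self [IsManifold 𝓘(ℝ, E) ∞ M] (p : M) :
    HasMFDerivAt 𝓘(ℝ, E) 𝓘(ℝ, E) (chartAt E p) p (ContinuousLinearMap.id ℝ E) := by
  have hext := (mdifferentiableAt_extChartAt (I := 𝓘(ℝ, E)) (mem_chart_source E p)).hasMFDerivAt
  rw [mfderiv_extChartAt_self] at hext
  exact hext.congr_of_eventuallyEq (Filter.Eventually.of_forall fun x => by simp [extChartAt])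

theorem hasMFDerivAt_chartAt_symm_self [IsManifold 𝓘(ℝ, E) ∞ M] (p : M) :
    HasMFDerivAt 𝓘(ℝ, E) 𝓘(ℝ, E) (chartAt E p).symm (chartAt E p p)
      (ContinuousLinearMap.id ℝ E) :=
  hasMFDerivAt_symm_id (mdifferentiable_chart p) (mem_chart_source E p)
    (hasMFDerivAt_chartAt_self p)

theorem exists_openPartialHomeomorph_of_hasMFDerivAt_equiv [CompleteSpace E]
    [IsManifold 𝓘(ℝ, E) ∞ M] [IsManifold 𝓘(ℝ, F) ∞ N] {f : M → N} {W : Set M} {p : M}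
    (hW : IsOpen W) (hp : p ∈ W) (hf : ContMDiffOn 𝓘(ℝ, E) 𝓘(ℝ, F) ∞ f W) (L : E ≃L[ℝ] F)
    (hL : HasMFDerivAt 𝓘(ℝ, E) 𝓘(ℝ, F) f p (L : E →L[ℝ] F)) :
    ∃ e : OpenPartialHomeomorph M N, p ∈ e.source ∧ e.source ⊆ W ∧ (∀ x ∈ e.source, e x = f x) ∧
      ContMDiffOn 𝓘(ℝ, E) 𝓘(ℝ, F) ∞ e e.source ∧
      ContMDiffOn 𝓘(ℝ, F) 𝓘(ℝ, E) ∞ e.symm e.target := by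
  let c := chartAt F (f p)
  have hc : ContMDiffOn 𝓘(ℝ, F) 𝓘(ℝ, F) ∞ c c.source := contMDiffOn_chart
  obtain ⟨e, hpe, heW, hef, -, he'⟩ := exists_openPartialHomeomorph_of_contMDiffOn
    (hf.continuousOn.isOpen_inter_preimage hW c.open_source) ⟨hp, mem_chart_source F (f p)⟩
    (hc.comp (hf.mono Set.inter_subset_left) Set.inter_subset_right) L
    (hasMFDerivAt_comp_of_eq (hasMFDerivAt_chartAt_self (f p)) hL rfl)
  have hsrc : (e.trans c.symm).source ⊆ e.source := Set.inter_subset_left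
  have heq : ∀ x ∈ (e.trans c.symm).source, (e.trans c.symm) x = f x := fun x hx => by
    rw [OpenPartialHomeomorph.coe_trans, Function.comp_apply, hef x (hsrc hx)]
    exact c.left_inv (heW (hsrc hx)).2
  refine ⟨e.trans c.symm, ⟨hpe, ?_⟩, fun x hx => (heW (hsrc hx)).1, heq,
    (hf.mono fun x hx => (heW (hsrc hx)).1).congr heq, ?_⟩
  · change e p ∈ c.target
    rw [hef p hpe]
    exact c.map_source (mem_chart_source F (f p))
  · exact he'.comp (hc.mono Set.inter_subset_left) Set.inter_subset_right

theorem eventually_eq_of_hasMFDerivAt_zero [IsManifold 𝓘(ℝ, E) ∞ M] {f : F → M} {s : Set F}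
    (hs : IsOpen s) (hf : ∀ x ∈ s, HasMFDerivAt 𝓘(ℝ, F) 𝓘(ℝ, E) f x (0 : F →L[ℝ] E)) {x : F}
    (hx : x ∈ s) : ∀ᶠ y in 𝓝 x, f y = f x := by
  let e := extChartAt 𝓘(ℝ, E) (f x)
  have hnear : ∀ᶠ y in 𝓝 x, y ∈ s ∧ f y ∈ e.source :=
    Filter.Eventually.and (hs.mem_nhds hx)
      ((hf x hx).continuousAt.preimage_mem_nhds (extChartAt_source_mem_nhds (f x)))
  obtain ⟨ε, hε, hball⟩ := Metric.eventually_nhds_iff_ball.1 hnear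
  have hderiv : ∀ y ∈ Metric.ball x ε, HasFDerivAt (e ∘ f) (0 : F →L[ℝ] E) y := fun y hy =>
    have hchart := (mdifferentiableAt_extChartAt (I := 𝓘(ℝ, E)) (x := f x) (y := f y)
      (by simpa [e] using (hball y hy).2)).hasMFDerivAt
    (hchart.comp y (hf y (hball y hy).1)).hasFDerivAt.congr_fderiv
      (ContinuousLinearMap.comp_zero _)
  filter_upwards [Metric.ball_mem_nhds x hε] with y hy
  have hey : e (f y) = e (f x) :=
    Metric.isOpen_ball.is_const_of_fderiv_eq_zero (convex_ball x ε).isPreconnected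
      (fun z hz => (hderiv z hz).differentiableAt.differentiableWithinAt)
      (fun z hz => (hderiv z hz).fderiv) hy (Metric.mem_ball_self hε)
  exact e.injOn (hball y hy).2 (hball x (Metric.mem_ball_self hε)).2 hey

theorem eq_of_hasMFDerivAt_zero [IsManifold 𝓘(ℝ, E) ∞ M] {f : F → M} {s : Set F} (hs : IsOpen s)
    (hs' : IsPreconnected s)
    (hf : ∀ x ∈ s, HasMFDerivAt 𝓘(ℝ, F) 𝓘(ℝ, E) f x (0 : F →L[ℝ] E)) {x y : F}
    (hx : x ∈ s) (hy : y ∈ s) : f x = f y := by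
  have : PreconnectedSpace s := isPreconnected_iff_preconnectedSpace.1 hs'
  have hconst : IsLocallyConstant (s.domRestrict f) := by
    rw [IsLocallyConstant.iff_eventually_eq]
    exact fun z => (continuous_subtype_val.tendsto z).eventually
      (eventually_eq_of_hasMFDerivAt_zero hs hf z.2)
  exact hconst.apply_eq_of_preconnectedSpace (⟨x, hx⟩ : s) ⟨y, hy⟩

end Calculus

section ParametricIntegral

open MeasureTheory

universe u

variable {A : Type*} [NormedAddCommGroup A] [NormedSpace ℝ A]
  {G : Type*} [TopologicalSpace G] [ChartedSpace A G]
  {X : Type*} [TopologicalSpace X] [CompactSpace X] [MeasurableSpace X] [BorelSpace X]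
  {E : Type u} [NormedAddCommGroup E] [NormedSpace ℝ E]

theorem contMDiffAt_param_right {F : Type*} [NormedAddCommGroup F] [NormedSpace ℝ F]
    {f : G → E → F} {g : G} {u : E}
    (hf : ContMDiffAt (𝓘(ℝ, A).prod 𝓘(ℝ, E)) 𝓘(ℝ, F) ∞ (Function.uncurry f) (g, u)) :
    ContDiffAt ℝ ∞ (f g) u := by
  rw [← contMDiffAt_iff_contDiffAt]
  exact ContMDiffAt.comp u (g := Function.uncurry f) (f := fun v => (g, v)) hf
    (contMDiffAt_const.prodMk contMDiffAt_id)

variable [IsManifold 𝓘(ℝ, A) ∞ G]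

theorem contMDiffAt_fderiv_param {F : Type*} [NormedAddCommGroup F] [NormedSpace ℝ F]
    {f : G → E → F} {g : G} {u : E}
    (hf : ContMDiffAt (𝓘(ℝ, A).prod 𝓘(ℝ, E)) 𝓘(ℝ, F) ∞ (Function.uncurry f) (g, u)) :
    ContMDiffAt (𝓘(ℝ, A).prod 𝓘(ℝ, E)) 𝓘(ℝ, E →L[ℝ] F) ∞
      (Function.uncurry fun g u => fderiv ℝ (f g) u) (g, u) := by
  have hpair : ContMDiffAt ((𝓘(ℝ, A).prod 𝓘(ℝ, E)).prod 𝓘(ℝ, E)) (𝓘(ℝ, A).prod 𝓘(ℝ, E)) ∞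
      (fun z : (G × E) × E => (z.1.1, z.2)) ((g, u), u) :=
    contMDiffAt_fst.fst.prodMk contMDiffAt_snd
  have hderiv := ContMDiffAt.mfderiv (J := 𝓘(ℝ, A).prod 𝓘(ℝ, E)) (I := 𝓘(ℝ, E)) (I' := 𝓘(ℝ, F))
    (x₀ := (g, u)) (m := ∞) (n := ∞) (fun q : G × E => f q.1) (fun q : G × E => q.2)
    (ContMDiffAt.comp ((g, u), u) (g := Function.uncurry f) hf hpair) contMDiffAt_snd (by simp)
  simp only [inTangentCoordinates_model_space, mfderiv_eq_fderiv] at hderiv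
  exact hderiv

theorem hasFDerivAt_integral_param [FiniteDimensional ℝ E] {F : Type*}
    [NormedAddCommGroup F] [NormedSpace ℝ F] [FiniteDimensional ℝ F]
    (μ : Measure X)
    [IsFiniteMeasure μ] {j : X → G} (hj : Continuous j) {U : Set E} (hU : IsOpen U) {f : G → E → F}
    (hf : ∀ x, ∀ u ∈ U, ContMDiffAt (𝓘(ℝ, A).prod 𝓘(ℝ, E)) 𝓘(ℝ, F) ∞
      (Function.uncurry f) (j x, u))
    {u : E} (hu : u ∈ U) :
    HasFDerivAt (fun v => ∫ x, f (j x) v ∂μ) (∫ x, fderiv ℝ (f (j x)) u ∂μ) u := by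
  have hcont : ∀ v ∈ U, Continuous fun x => f (j x) v := fun v hv =>
    continuous_iff_continuousAt.2 fun x =>
      ContinuousAt.comp (g := Function.uncurry f) (f := fun x => (j x, v))
        (hf x v hv).continuousAt (hj.continuousAt.prodMk continuousAt_const)
  have hderivAt : ∀ v ∈ U, ∀ x, ContinuousAt (fun z : E × X => fderiv ℝ (f (j z.2)) z.1) (v, x) :=
    fun v hv x => ContinuousAt.comp (g := Function.uncurry fun g u => fderiv ℝ (f g) u)
      (f := fun z : E × X => (j z.2, z.1)) (contMDiffAt_fderiv_param (hf x v hv)).continuousAt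
      ((hj.continuousAt.comp continuousAt_snd).prodMk continuousAt_fst)
  have hderiv : ∀ v ∈ U, Continuous fun x => fderiv ℝ (f (j x)) v := fun v hv =>
    continuous_iff_continuousAt.2 fun x =>
      (hderivAt v hv x).comp (f := fun x => (v, x)) (continuousAt_const.prodMk continuousAt_id)
  obtain ⟨C, hC⟩ := isCompact_univ.exists_bound_of_continuousOn (hderiv u hu).continuousOn
  have hbound : ∀ᶠ v in 𝓝 u, ∀ x ∈ (Set.univ : Set X), ‖fderiv ℝ (f (j x)) v‖ < C + 1 :=
    isCompact_univ.eventually_forall_of_forall_eventually fun x hx =>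
      (hderivAt u hu x).norm.eventually_lt continuousAt_const ((hC x hx).trans_lt (lt_add_one C))
  refine hasFDerivAt_integral_of_dominated_of_fderiv_le
    (F := fun v x => f (j x) v) (F' := fun v x => fderiv ℝ (f (j x)) v)
    (bound := fun _ => C + 1) (Filter.inter_mem hbound (hU.mem_nhds hu)) ?_ ?_ ?_ ?_ ?_ ?_
  · filter_upwards [hU.mem_nhds hu] with v hv
    exact (hcont v hv).aestronglyMeasurable
  · exact (hcont u hu).integrable_of_hasCompactSupport (HasCompactSupport.of_compactSpace _)
  · exact (hderiv u hu).aestronglyMeasurable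
  · exact Filter.Eventually.of_forall fun x v hv => (hv.1 x trivial).le
  · exact integrable_const _
  · exact Filter.Eventually.of_forall fun x v hv =>
      ((contMDiffAt_param_right (hf x v hv.2)).differentiableAt (by simp)).hasFDerivAt

theorem contDiffOn_integral_param [FiniteDimensional ℝ E] {F : Type u}
    [NormedAddCommGroup F] [NormedSpace ℝ F] [FiniteDimensional ℝ F]
    (μ : Measure X)
    [IsFiniteMeasure μ] {j : X → G} (hj : Continuous j) {U : Set E} (hU : IsOpen U) {f : G → E → F}
    (hf : ∀ x, ∀ u ∈ U, ContMDiffAt (𝓘(ℝ, A).prod 𝓘(ℝ, E)) 𝓘(ℝ, F) ∞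
      (Function.uncurry f) (j x, u)) :
    ContDiffOn ℝ ∞ (fun v => ∫ x, f (j x) v ∂μ) U := by
  rw [contDiffOn_infty]
  intro n
  induction n generalizing F with
  | zero =>
    refine contDiffOn_zero.2 fun u hu => ?_
    exact (hasFDerivAt_integral_param μ hj hU hf hu).continuousAt.continuousWithinAt
  | succ n ih =>
    rw [Nat.cast_succ, contDiffOn_succ_iff_fderiv_of_isOpen hU]
    refine ⟨fun u hu => (hasFDerivAt_integral_param μ hj hU hf
      hu).differentiableAt.differentiableWithinAt, by simp, ?_⟩
    refine ContDiffOn.congr (ih (f := fun g u => fderiv ℝ (f g) u)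
      fun x u hu => contMDiffAt_fderiv_param (hf x u hu)) fun u hu => ?_
    exact (hasFDerivAt_integral_param μ hj hU hf hu).fderiv

end ParametricIntegral

theorem finrank_ker_equiv_comp_comp_equiv {E E' F F' : Type*}
    [NormedAddCommGroup E] [NormedSpace ℝ E] [NormedAddCommGroup E'] [NormedSpace ℝ E']
    [NormedAddCommGroup F] [NormedSpace ℝ F] [NormedAddCommGroup F'] [NormedSpace ℝ F']
    (b : F ≃L[ℝ] F') (f : E →L[ℝ] F) (a : E' ≃L[ℝ] E) :
    Module.finrank ℝ ((b : F →L[ℝ] F').comp (f.comp (a : E' →L[ℝ] E))).ker =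
      Module.finrank ℝ f.ker := by
  refine LinearEquiv.finrank_eq (LinearEquiv.ofSubmodule' a.toLinearEquiv f.ker |>.symm.trans
    (LinearEquiv.ofEq _ _ ?_)).symm
  ext v
  simp

section Action

variable {A : Type*} [NormedAddCommGroup A] [NormedSpace ℝ A]
  {G : Type*} [TopologicalSpace G] [ChartedSpace A G] [Group G]
  {E : Type*} [NormedAddCommGroup E] [NormedSpace ℝ E]
  {M : Type*} [TopologicalSpace M] [ChartedSpace E M] [MulAction G M]

variable (A G E) in
/-- The derivative at `1` of the orbit map `g ↦ g • m`: this is `fundamentalField`, regarded as a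
map between the model spaces, so that the maps at different points can be compared. -/
noncomputable def orbitDeriv (m : M) : A →L[ℝ] E :=
  fundamentalField 𝓘(ℝ, A) G 𝓘(ℝ, E) m

variable [ContMDiffSMul 𝓘(ℝ, A) 𝓘(ℝ, E) ∞ G M]

theorem contMDiff_orbitMap (m : M) : ContMDiff 𝓘(ℝ, A) 𝓘(ℝ, E) ∞ (fun g : G => g • m) :=
  contMDiff_id.smul (I := 𝓘(ℝ, A)) contMDiff_const

theorem hasMFDerivAt_orbitMap_one (m : M) :
    HasMFDerivAt 𝓘(ℝ, A) 𝓘(ℝ, E) (fun g : G => g • m) 1 (orbitDeriv A G E m) :=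
  ((contMDiff_orbitMap m).mdifferentiable (by simp) 1).hasMFDerivAt

variable (A E) in
/-- The derivative at `m` of the action of `g`, as an automorphism of the model space. -/
noncomputable def smulDeriv (g : G) (m : M) : E ≃L[ℝ] E :=
  (Diffeomorph.smul 𝓘(ℝ, A) 𝓘(ℝ, E) ∞ g :
    M ≃ₘ^∞⟮𝓘(ℝ, E), 𝓘(ℝ, E)⟯ M).mfderivToContinuousLinearEquiv (by simp) m

theorem hasMFDerivAt_smulMap (g : G) (m : M) :
    HasMFDerivAt 𝓘(ℝ, E) 𝓘(ℝ, E) (fun y : M => g • y) m (smulDeriv A E g m : E →L[ℝ] E) :=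
  have hsmooth : ContMDiff 𝓘(ℝ, E) 𝓘(ℝ, E) ∞ (fun y : M => g • y) :=
    ContMDiffSMul.contMDiff_const_smul (I := 𝓘(ℝ, A)) g
  (hsmooth.mdifferentiable (by simp) m).hasMFDerivAt

variable [LieGroup 𝓘(ℝ, A) ∞ G]

theorem hasMFDerivAt_orbitMap (m : M) (g : G) :
    HasMFDerivAt 𝓘(ℝ, A) 𝓘(ℝ, E) (fun k : G => k • m) g
      ((smulDeriv A E g m : E →L[ℝ] E).comp
        ((orbitDeriv A G E m).comp (smulDeriv A A g⁻¹ g : A →L[ℝ] A))) := by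
  have hinv : HasMFDerivAt 𝓘(ℝ, A) 𝓘(ℝ, A) (fun k : G => g⁻¹ • k) g
      (smulDeriv A A g⁻¹ g : A →L[ℝ] A) := hasMFDerivAt_smulMap g⁻¹ g
  have horbit := hasMFDerivAt_comp_of_eq (y := (1 : G))
    (hasMFDerivAt_orbitMap_one (A := A) (E := E) m) hinv (by simp)
  have hsmul := hasMFDerivAt_comp_of_eq (y := m) (hasMFDerivAt_smulMap (A := A) (E := E) g m)
    horbit (by simp)
  exact hsmul.congr_of_eventuallyEq (Filter.Eventually.of_forall fun k => by simp [smul_smul])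

theorem exists_smulDeriv_orbitDeriv (g : G) (m : M) :
    ∃ Ad : A →L[ℝ] A, ∀ ξ,
      smulDeriv A E g m (orbitDeriv A G E m ξ) = orbitDeriv A G E (g • m) (Ad ξ) := by
  have hconj : ContMDiff 𝓘(ℝ, A) 𝓘(ℝ, A) ∞ (fun k : G => g * k * g⁻¹) :=
    (contMDiff_const.mul contMDiff_id).mul contMDiff_const
  have horbit_conj := hasMFDerivAt_comp_of_eq (y := (1 : G))
    (hasMFDerivAt_orbitMap_one (A := A) (E := E) (g • m))
    (hconj.mdifferentiable (by simp) 1).hasMFDerivAt (by simp)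
  have hsmul_orbit := hasMFDerivAt_comp_of_eq (y := m)
    (hasMFDerivAt_smulMap (A := A) (E := E) g m)
    (hasMFDerivAt_orbitMap_one (A := A) (G := G) (E := E) m) (by simp)
  have heq := hasMFDerivAt_unique (hsmul_orbit.congr_of_eventuallyEq
    (f₁ := (fun k : G => k • g • m) ∘ fun k => g * k * g⁻¹)
    (Filter.Eventually.of_forall fun k => by simp [smul_smul])) horbit_conj
  exact ⟨mfderiv 𝓘(ℝ, A) 𝓘(ℝ, A) (fun k : G => g * k * g⁻¹) 1, DFunLike.congr_fun heq⟩

theorem ker_mfderiv_orbitMap (m : M) (g : G) :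
    (mfderiv 𝓘(ℝ, A) 𝓘(ℝ, E) (fun k : G => k • m) g : A →L[ℝ] E).ker =
      (orbitDeriv A G E m).ker.comap (smulDeriv A A g⁻¹ g).toLinearMap := by
  rw [(hasMFDerivAt_orbitMap m g).mfderiv]
  ext v
  simp only [LinearMap.mem_ker]
  exact (smulDeriv A E g m).map_eq_zero_iff

theorem finrank_ker_mfderiv_orbitMap (m : M) (g : G) :
    Module.finrank ℝ (mfderiv 𝓘(ℝ, A) 𝓘(ℝ, E) (fun k : G => k • m) g : A →L[ℝ] E).ker =
      Module.finrank ℝ (orbitDeriv A G E m).ker := by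
  rw [(hasMFDerivAt_orbitMap m g).mfderiv]
  exact finrank_ker_equiv_comp_comp_equiv (smulDeriv A E g m) (orbitDeriv A G E m)
    (smulDeriv A A g⁻¹ g)

theorem finrank_range_orbitDeriv_le [FiniteDimensional ℝ E] (g : G) (p : M) :
    Module.finrank ℝ (orbitDeriv A G E p).range ≤
      Module.finrank ℝ (orbitDeriv A G E (g • p)).range := by
  obtain ⟨Ad, hAd⟩ := exists_smulDeriv_orbitDeriv (A := A) (E := E) g p
  rw [← LinearEquiv.finrank_map_eq (smulDeriv A E g p).toLinearEquiv]
  refine Submodule.finrank_mono ?_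
  rintro _ ⟨_, ⟨ξ, rfl⟩, rfl⟩
  exact ⟨Ad ξ, (hAd ξ).symm⟩

theorem finrank_range_orbitDeriv_smul [FiniteDimensional ℝ E] (g : G) (p : M) :
    Module.finrank ℝ (orbitDeriv A G E (g • p)).range =
      Module.finrank ℝ (orbitDeriv A G E p).range := by
  refine le_antisymm ?_ (finrank_range_orbitDeriv_le g p)
  have hinv := finrank_range_orbitDeriv_le (A := A) (E := E) g⁻¹ (g • p)
  rwa [inv_smul_smul] at hinv

theorem finrank_ker_orbitDeriv_smul [FiniteDimensional ℝ A] [FiniteDimensional ℝ E] (g : G)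
    (p : M) :
    Module.finrank ℝ (orbitDeriv A G E (g • p)).ker =
      Module.finrank ℝ (orbitDeriv A G E p).ker := by
  have hgp := LinearMap.finrank_range_add_finrank_ker (orbitDeriv A G E (g • p)).toLinearMap
  have hp := LinearMap.finrank_range_add_finrank_ker (orbitDeriv A G E p).toLinearMap
  have hrange := finrank_range_orbitDeriv_smul (A := A) (E := E) g p
  omega

variable [IsManifold 𝓘(ℝ, E) ∞ M]

theorem smul_eq_smul_of_stabilizer_path {F : Type*} [NormedAddCommGroup F] [NormedSpace ℝ F]
    {s : Set F} (hs : IsOpen s) (hs' : IsPreconnected s) {γ : F → G}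
    (hγ : ContMDiffOn 𝓘(ℝ, F) 𝓘(ℝ, A) ∞ γ s) {p q : M} (hγp : ∀ y ∈ s, γ y • p = p)
    (hpq : (orbitDeriv A G E p).ker ≤ (orbitDeriv A G E q).ker) {y z : F} (hy : y ∈ s)
    (hz : z ∈ s) : γ y • q = γ z • q := by
  refine eq_of_hasMFDerivAt_zero (E := E) (f := fun y => γ y • q) hs hs' (fun x hx => ?_) hy hz
  have hγx := ((hγ.contMDiffAt (hs.mem_nhds hx)).mdifferentiableAt (by simp)).hasMFDerivAt
  have horbit (m : M) := ((contMDiff_orbitMap (A := A) (E := E) m).mdifferentiable (by simp)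
    (γ x)).hasMFDerivAt
  have hp : HasMFDerivAt 𝓘(ℝ, F) 𝓘(ℝ, E) (fun y => γ y • p) x (0 : F →L[ℝ] E) :=
    (hasMFDerivAt_const p x).congr_of_eventuallyEq <| by
      filter_upwards [hs.mem_nhds hx] using hγp
  refine ((horbit q).comp x hγx).congr_mfderiv (ContinuousLinearMap.ext fun v => ?_)
  have hker : mfderiv 𝓘(ℝ, F) 𝓘(ℝ, A) γ x v ∈
      (mfderiv 𝓘(ℝ, A) 𝓘(ℝ, E) (fun k : G => k • p) (γ x) : A →L[ℝ] E).ker :=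
    DFunLike.congr_fun (hasMFDerivAt_unique ((horbit p).comp x hγx) hp) v
  have hle : (mfderiv 𝓘(ℝ, A) 𝓘(ℝ, E) (fun k : G => k • p) (γ x) : A →L[ℝ] E).ker ≤
      (mfderiv 𝓘(ℝ, A) 𝓘(ℝ, E) (fun k : G => k • q) (γ x) : A →L[ℝ] E).ker := by
    simp only [ker_mfderiv_orbitMap]
    exact Submodule.comap_mono hpq
  exact LinearMap.mem_ker.1 (hle hker)

end Action

section ConstantRank

variable {A : Type*} [NormedAddCommGroup A] [NormedSpace ℝ A]
  {E : Type*} [NormedAddCommGroup E] [NormedSpace ℝ E]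
  {M : Type*} [TopologicalSpace M] [ChartedSpace A M]
  {N : Type*} [TopologicalSpace N] [ChartedSpace E N]

theorem exists_reflexive_inverse [FiniteDimensional ℝ E] (f : A →L[ℝ] E) :
    ∃ l : E →L[ℝ] A, (∀ v, f (l (f v)) = f v) ∧ ∀ w, l (f (l w)) = l w := by
  obtain ⟨r, hr⟩ := f.toLinearMap.rangeRestrict.exists_rightInverse_of_surjective
    f.toLinearMap.range_rangeRestrict
  obtain ⟨l, hl⟩ := r.exists_extend
  have hflf : ∀ v, f (l (f v)) = f v := fun v => by
    have hlv : l (f v) = r (f.toLinearMap.rangeRestrict v) :=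
      DFunLike.congr_fun hl (f.toLinearMap.rangeRestrict v)
    rw [hlv]
    exact congrArg Subtype.val (DFunLike.congr_fun hr (f.toLinearMap.rangeRestrict v))
  exact ⟨LinearMap.toContinuousLinearMap (l ∘ₗ f.toLinearMap ∘ₗ l), fun v => by simp [hflf],
    fun w => by simp [hflf]⟩

theorem ker_comp_of_reflexive_inverse {f : A →L[ℝ] E} {l : E →L[ℝ] A}
    (hl : ∀ v, f (l (f v)) = f v) : (l.comp f).ker = f.ker := by
  refine le_antisymm (fun v hv => ?_) (LinearMap.ker_le_ker_comp f.toLinearMap l.toLinearMap)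
  have hlv : l (f v) = 0 := hv
  rw [LinearMap.mem_ker, ContinuousLinearMap.coe_coe, ← hl v, hlv, map_zero]

theorem exists_coordinates_with_projection [CompleteSpace A]
    [IsManifold 𝓘(ℝ, A) ∞ M] {f : M → E} {W : Set M} {x : M} (hW : IsOpen W) (hx : x ∈ W)
    (hf : ContMDiffOn 𝓘(ℝ, A) 𝓘(ℝ, E) ∞ f W) {D : A →L[ℝ] E}
    (hD : HasMFDerivAt 𝓘(ℝ, A) 𝓘(ℝ, E) f x D) {l : E →L[ℝ] A} (hlD : ∀ w, l (D (l w)) = l w) :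
    ∃ e : OpenPartialHomeomorph M A, x ∈ e.source ∧ e.source ⊆ W ∧ e x = 0 ∧
      ContMDiffOn 𝓘(ℝ, A) 𝓘(ℝ, A) ∞ e e.source ∧ ContMDiffOn 𝓘(ℝ, A) 𝓘(ℝ, A) ∞ e.symm e.target ∧
      HasMFDerivAt 𝓘(ℝ, A) 𝓘(ℝ, A) e x (ContinuousLinearMap.id ℝ A) ∧
      ∀ y ∈ e.source, l (D (e y)) = l (f y - f x) := by
  let c := chartAt A x
  let Q : A →L[ℝ] A := ContinuousLinearMap.id ℝ A - l.comp D
  -- The derivative of `h` at `x` is `l ∘ D + (1 - l ∘ D)`.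
  let h : M → A := fun y => l (f y - f x) + Q (c y - c x)
  have hlDh : ∀ y, l (D (h y)) = l (f y - f x) := fun y => by simp [h, Q, hlD]
  have hh : ContMDiffOn 𝓘(ℝ, A) 𝓘(ℝ, A) ∞ h (W ∩ c.source) :=
    (l.contMDiff.comp_contMDiffOn ((hf.mono Set.inter_subset_left).sub contMDiffOn_const)).add
      (Q.contMDiff.comp_contMDiffOn (((contMDiffOn_chart (I := 𝓘(ℝ, A)) (x := x)).mono
        Set.inter_subset_right).sub contMDiffOn_const))
  have hdh : HasMFDerivAt 𝓘(ℝ, A) 𝓘(ℝ, A) h x (ContinuousLinearMap.id ℝ A) := by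
    have hsum := (hasMFDerivAt_comp_of_eq (y := f x) (g := fun u => l (u - f x)) (g' := l)
      (hasFDerivAt_sub_const (f x) |> l.hasFDerivAt.comp (f x)).hasMFDerivAt hD rfl).add
      (hasMFDerivAt_comp_of_eq (y := c x) (g := fun u => Q (u - c x)) (g' := Q)
        (hasFDerivAt_sub_const (c x) |> Q.hasFDerivAt.comp (c x)).hasMFDerivAt
        (hasMFDerivAt_chartAt_self x) rfl)
    refine hsum.congr_mfderiv (ContinuousLinearMap.ext fun v => ?_)
    exact add_sub_cancel (l (D v)) v
  obtain ⟨e, hxe, heW, heh, he, he'⟩ := exists_openPartialHomeomorph_of_contMDiffOn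
    (hW.inter c.open_source) ⟨hx, mem_chart_source A x⟩ hh (ContinuousLinearEquiv.refl ℝ A) hdh
  refine ⟨e, hxe, heW.trans Set.inter_subset_left, ?_, he, he', ?_, fun y hy => ?_⟩
  · simp [heh x hxe, h]
  · exact hdh.congr_of_eventuallyEq (Filter.eventuallyEq_of_mem (e.open_source.mem_nhds hxe) heh)
  · rw [heh y hy, hlDh]

theorem eq_of_projection_eq [FiniteDimensional ℝ A] {g : A → E} {s : Set A} (hs : IsOpen s)
    (hconv : Convex ℝ s) (hg : DifferentiableOn ℝ g s) {pr : A →L[ℝ] A} {l : E →L[ℝ] A} {c : E}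
    (hpr : ∀ z ∈ s, pr z = l (g z - c))
    (hrank : ∀ z ∈ s, Module.finrank ℝ (fderiv ℝ g z).ker = Module.finrank ℝ pr.ker)
    {z z' : A} (hz : z ∈ s) (hz' : z' ∈ s) (hzz' : pr z = pr z') : g z = g z' := by
  have hgd : ∀ w ∈ s, HasFDerivAt g (fderiv ℝ g w) w := fun w hw =>
    ((hg w hw).differentiableAt (hs.mem_nhds hw)).hasFDerivAt
  have hker : ∀ w ∈ s, (fderiv ℝ g w).ker = pr.ker := fun w hw => by
    have hcomp : l.comp (fderiv ℝ g w) = pr := by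
      refine HasFDerivAt.unique (x := w) ?_ pr.hasFDerivAt
      refine (l.hasFDerivAt.comp w ((hgd w hw).sub_const c)).congr_of_eventuallyEq ?_
      exact Filter.eventuallyEq_of_mem (hs.mem_nhds hw) hpr
    refine Submodule.eq_of_le_of_finrank_eq ?_ (hrank w hw)
    rw [← hcomp]
    exact LinearMap.ker_le_ker_comp _ _
  let γ : ℝ →ᵃ[ℝ] A := AffineMap.lineMap z z'
  have hγ : Continuous γ := AffineMap.lineMap_continuous
  have hderiv : ∀ t ∈ γ ⁻¹' s, HasDerivAt (g ∘ γ) 0 t := fun t ht => by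
    have hzero : fderiv ℝ g (γ t) (z' - z) = 0 := by
      have hmem : z' - z ∈ pr.ker := by simp [LinearMap.mem_ker, hzz']
      rwa [← hker _ ht] at hmem
    rw [← hzero]
    exact (hgd _ ht).comp_hasDerivAt t (AffineMap.hasDerivAt_lineMap)
  have hconst := (hs.preimage hγ).is_const_of_deriv_eq_zero
    (hconv.affine_preimage γ).isPreconnected
    (fun t ht => (hderiv t ht).differentiableAt.differentiableWithinAt)
    (fun t ht => (hderiv t ht).deriv) (x := 0) (y := 1) (by simpa [γ] using hz)
    (by simpa [γ] using hz')
  simpa [γ] using hconst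

theorem exists_ball_target {M A : Type*} [TopologicalSpace M] [SeminormedAddCommGroup A]
    {e : OpenPartialHomeomorph M A} {x : M} (hx : x ∈ e.source) (hex : e x = 0) :
    ∃ θ : OpenPartialHomeomorph M A, x ∈ θ.source ∧ (∀ y, θ y = e y) ∧
      (∀ z, θ.symm z = e.symm z) ∧ θ.target ⊆ e.target ∧
      ∃ ε > 0, θ.target = Metric.ball (0 : A) ε := by
  obtain ⟨ε, hε, hball⟩ := Metric.isOpen_iff.1 e.open_target 0 (hex ▸ e.map_source hx)
  refine ⟨(e.symm.restrOpen (Metric.ball 0 ε) Metric.isOpen_ball).symm, ?_, fun _ => rfl,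
    fun _ => rfl, Set.inter_subset_left, ε, hε, Set.inter_eq_right.2 hball⟩
  simp [hx, hex, hε]

variable (E) in
/-- Coordinates `θ` on `M` straightening `f : M → N` near `x`, as provided by the constant rank
theorem: `θ` is centred at `x`, with image a ball and with derivative the identity at `x`, and in
these coordinates `f` is an injective function of the linear projection `pr`. -/
structure IsStraightening (f : M → N) (x : M) (θ : OpenPartialHomeomorph M A) (pr : A →L[ℝ] A) :
    Prop where
  idem : ∀ z, pr (pr z) = pr z
  ker_eq : pr.ker = (mfderiv 𝓘(ℝ, A) 𝓘(ℝ, E) f x : A →L[ℝ] E).ker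
  mem_source : x ∈ θ.source
  map_self : θ x = 0
  target_eq : ∃ ε > 0, θ.target = Metric.ball 0 ε
  contMDiffOn_symm : ContMDiffOn 𝓘(ℝ, A) 𝓘(ℝ, A) ∞ θ.symm θ.target
  hasMFDerivAt_symm : HasMFDerivAt 𝓘(ℝ, A) 𝓘(ℝ, A) θ.symm 0 (ContinuousLinearMap.id ℝ A)
  eq_iff : ∀ z ∈ θ.target, ∀ z' ∈ θ.target, f (θ.symm z) = f (θ.symm z') ↔ pr z = pr z'

namespace IsStraightening

variable {f : M → N} {x : M} {θ : OpenPartialHomeomorph M A} {pr : A →L[ℝ] A}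

theorem zero_mem (h : IsStraightening E f x θ pr) : (0 : A) ∈ θ.target :=
  h.map_self ▸ θ.map_source h.mem_source

theorem symm_zero (h : IsStraightening E f x θ pr) : θ.symm 0 = x := by
  rw [← h.map_self, θ.left_inv h.mem_source]

end IsStraightening

theorem finrank_ker_fderiv_in_coordinates {f : M → N} {e : OpenPartialHomeomorph M A}
    {φ : OpenPartialHomeomorph N E} (he : e.MDifferentiable 𝓘(ℝ, A) 𝓘(ℝ, A))
    (hφ : φ.MDifferentiable 𝓘(ℝ, E) 𝓘(ℝ, E)) (hf : MDifferentiable 𝓘(ℝ, A) 𝓘(ℝ, E) f) {z : A}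
    (hz : z ∈ e.target) (hfz : f (e.symm z) ∈ φ.source) :
    DifferentiableAt ℝ (φ ∘ f ∘ e.symm) z ∧
      Module.finrank ℝ (fderiv ℝ (φ ∘ f ∘ e.symm) z).ker =
        Module.finrank ℝ (mfderiv 𝓘(ℝ, A) 𝓘(ℝ, E) f (e.symm z) : A →L[ℝ] E).ker := by
  obtain ⟨a, ha, -⟩ := exists_hasMFDerivAt_equiv he.symm hz
  obtain ⟨b, hb, -⟩ := exists_hasMFDerivAt_equiv hφ hfz
  let D : A →L[ℝ] E := mfderiv 𝓘(ℝ, A) 𝓘(ℝ, E) f (e.symm z)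
  have hderiv : HasFDerivAt (φ ∘ f ∘ e.symm)
      ((b : E →L[ℝ] E).comp (D.comp (a : A →L[ℝ] A))) z :=
    (hb.comp z ((hf (e.symm z)).hasMFDerivAt.comp z ha)).hasFDerivAt
  refine ⟨hderiv.differentiableAt, ?_⟩
  rw [hderiv.fderiv]
  exact finrank_ker_equiv_comp_comp_equiv b D a

theorem apply_symm_eq_iff_projection_eq [FiniteDimensional ℝ A] {f : M → N}
    {e : OpenPartialHomeomorph M A} {φ : OpenPartialHomeomorph N E}
    (he : e.MDifferentiable 𝓘(ℝ, A) 𝓘(ℝ, A)) (hφ : φ.MDifferentiable 𝓘(ℝ, E) 𝓘(ℝ, E))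
    (hf : MDifferentiable 𝓘(ℝ, A) 𝓘(ℝ, E) f) {pr : A →L[ℝ] A} {l : E →L[ℝ] A} {c : E}
    (hrank : ∀ y, Module.finrank ℝ (mfderiv 𝓘(ℝ, A) 𝓘(ℝ, E) f y : A →L[ℝ] E).ker =
      Module.finrank ℝ pr.ker)
    {s : Set A} (hs : IsOpen s) (hconv : Convex ℝ s) (hse : s ⊆ e.target)
    (hsφ : ∀ z ∈ s, f (e.symm z) ∈ φ.source)
    (hpr : ∀ z ∈ s, pr z = l ((φ ∘ f ∘ e.symm) z - c)) {z z' : A} (hz : z ∈ s) (hz' : z' ∈ s) :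
    f (e.symm z) = f (e.symm z') ↔ pr z = pr z' := by
  have hcoord (w : A) (hw : w ∈ s) :=
    finrank_ker_fderiv_in_coordinates he hφ hf (hse hw) (hsφ w hw)
  refine ⟨fun h => ?_, fun h => φ.injOn (hsφ z hz) (hsφ z' hz') ?_⟩
  · simp only [hpr z hz, hpr z' hz', Function.comp_apply, h]
  · exact eq_of_projection_eq hs hconv (fun w hw => (hcoord w hw).1.differentiableWithinAt) hpr
      (fun w hw => (hcoord w hw).2.trans (hrank _)) hz hz' h

theorem exists_isStraightening_of_finrank_ker_eq [FiniteDimensional ℝ A] [FiniteDimensional ℝ E]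
    [IsManifold 𝓘(ℝ, A) ∞ M] [IsManifold 𝓘(ℝ, E) ∞ N] {f : M → N}
    (hf : ContMDiff 𝓘(ℝ, A) 𝓘(ℝ, E) ∞ f) {x : M}
    (hrank : ∀ y, Module.finrank ℝ (mfderiv 𝓘(ℝ, A) 𝓘(ℝ, E) f y : A →L[ℝ] E).ker =
      Module.finrank ℝ (mfderiv 𝓘(ℝ, A) 𝓘(ℝ, E) f x : A →L[ℝ] E).ker) :
    ∃ (θ : OpenPartialHomeomorph M A) (pr : A →L[ℝ] A), IsStraightening E f x θ pr := by
  let φ := chartAt E (f x)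
  let D : A →L[ℝ] E := mfderiv 𝓘(ℝ, A) 𝓘(ℝ, E) f x
  have hD : HasMFDerivAt 𝓘(ℝ, A) 𝓘(ℝ, E) (φ ∘ f) x D :=
    hasMFDerivAt_comp_of_eq (hasMFDerivAt_chartAt_self (f x))
      (hf.mdifferentiable (by simp) x).hasMFDerivAt rfl
  obtain ⟨l, hDl, hlD⟩ := exists_reflexive_inverse D
  have hker : (l.comp D).ker = D.ker := ker_comp_of_reflexive_inverse hDl
  obtain ⟨e, hxe, heW, hex, he, he', hed, hle⟩ := exists_coordinates_with_projection
    (φ.open_source.preimage hf.continuous) (mem_chart_source E (f x))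
    ((contMDiffOn_chart (I := 𝓘(ℝ, E)) (x := f x)).comp hf.contMDiffOn subset_rfl) hD hlD
  obtain ⟨θ, hxθ, hθe, hθe', hθt, hball⟩ := exists_ball_target hxe hex
  have hemd : e.MDifferentiable 𝓘(ℝ, A) 𝓘(ℝ, A) :=
    ⟨he.mdifferentiableOn (by simp), he'.mdifferentiableOn (by simp)⟩
  have hmem : ∀ z ∈ θ.target, f (e.symm z) ∈ φ.source := fun z hz =>
    heW (e.map_target (hθt hz))
  have hpr : ∀ z ∈ θ.target, l.comp D z = l ((φ ∘ f ∘ e.symm) z - φ (f x)) := fun z hz => by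
    simpa [e.right_inv (hθt hz)] using hle _ (e.map_target (hθt hz))
  refine ⟨θ, l.comp D, fun z => congrArg l (hDl _), hker, hxθ, (hθe x).trans hex, hball,
    (he'.mono hθt).congr fun z _ => hθe' z, ?_, fun z hz z' hz' => ?_⟩
  · rw [← hex]
    exact (hasMFDerivAt_symm_id hemd hxe hed).congr_of_eventuallyEq
      (Filter.Eventually.of_forall hθe')
  · obtain ⟨ε, -, htgt⟩ := hball
    rw [hθe', hθe']
    exact apply_symm_eq_iff_projection_eq hemd (mdifferentiable_chart (I := 𝓘(ℝ, E)) (f x))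
      (hf.mdifferentiable (by simp)) (fun y => hker ▸ hrank y) θ.open_target
      (htgt ▸ convex_ball 0 ε) hθt hmem hpr hz hz'

end ConstantRank

section OrbitMap

variable (A : Type*) [NormedAddCommGroup A] [NormedSpace ℝ A] [FiniteDimensional ℝ A]
  (G : Type*) [TopologicalSpace G] [ChartedSpace A G] [Group G] [LieGroup 𝓘(ℝ, A) ∞ G]
  (E : Type*) [NormedAddCommGroup E] [NormedSpace ℝ E] [FiniteDimensional ℝ E]
  {M : Type*} [TopologicalSpace M] [ChartedSpace E M] [MulAction G M]
  [ContMDiffSMul 𝓘(ℝ, A) 𝓘(ℝ, E) ∞ G M] [IsManifold 𝓘(ℝ, E) ∞ M]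

theorem exists_isStraightening_orbitMap (p : M) :
    ∃ (θ : OpenPartialHomeomorph G A) (pr : A →L[ℝ] A),
      IsStraightening E (fun g : G => g • p) 1 θ pr :=
  exists_isStraightening_of_finrank_ker_eq (contMDiff_orbitMap p) fun g => by
    rw [finrank_ker_mfderiv_orbitMap, finrank_ker_mfderiv_orbitMap]

end OrbitMap

section Isotropy

theorem relIndex_eq_pow_of_antitone {G : Type*} [Group G] {S : ℕ → Subgroup G} (hS : Antitone S)
    (hstep : ∀ i, (S (i + 1)).relIndex (S i) = (S 1).relIndex (S 0)) (i : ℕ) :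
    (S i).relIndex (S 0) = (S 1).relIndex (S 0) ^ i := by
  induction i with
  | zero => simp
  | succ i ih =>
    rw [pow_succ', ← ih, ← hstep i, Subgroup.relIndex_mul_relIndex _ _ _ (hS i.le_succ)
      (hS i.zero_le)]

theorem eq_of_antitone_of_relIndex_iInf_ne_zero {G : Type*} [Group G] {S : ℕ → Subgroup G}
    (hS : Antitone S) (hstep : ∀ i, (S (i + 1)).relIndex (S i) = (S 1).relIndex (S 0))
    (hfin : (⨅ i, S i).relIndex (S 0) ≠ 0) : S 1 = S 0 := by
  have hdvd : ∀ i, (S 1).relIndex (S 0) ^ i ∣ (⨅ i, S i).relIndex (S 0) := fun i => by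
    rw [← relIndex_eq_pow_of_antitone hS hstep,
      ← Subgroup.relIndex_mul_relIndex _ (S i) (S 0) (iInf_le _ i) (hS i.zero_le)]
    exact Dvd.intro_left _ rfl
  have hne : (S 1).relIndex (S 0) ≠ 0 := fun h0 =>
    hfin (zero_dvd_iff.1 (by simpa [h0] using hdvd 1))
  have hone : (S 1).relIndex (S 0) = 1 := by
    by_contra hne1
    have hlt := Nat.lt_pow_self (n := (⨅ i, S i).relIndex (S 0))
      (show 1 < (S 1).relIndex (S 0) by omega)
    exact hlt.not_ge (Nat.le_of_dvd (Nat.pos_of_ne_zero hfin) (hdvd _))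
  exact le_antisymm (hS zero_le_one) (Subgroup.relIndex_eq_one.1 hone)

theorem isCompact_stabilizer {G M : Type*} [TopologicalSpace G] [Group G] [TopologicalSpace M]
    [MulAction G M] [ProperSMul G M] (p : M) : IsCompact (MulAction.stabilizer G p : Set G) := by
  have hpre := (ProperSMul.isProperMap_smul_pair (G := G) (X := M)).isCompact_preimage
    (isCompact_singleton (x := (p, p)))
  convert! hpre.image continuous_fst using 1
  ext g
  simp

variable {A : Type*} [NormedAddCommGroup A] [NormedSpace ℝ A] [FiniteDimensional ℝ A]
  {G : Type*} [TopologicalSpace G] [ChartedSpace A G] [Group G] [LieGroup 𝓘(ℝ, A) ∞ G]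
  {E : Type*} [NormedAddCommGroup E] [NormedSpace ℝ E] [FiniteDimensional ℝ E]
  {M : Type*} [TopologicalSpace M] [ChartedSpace E M] [MulAction G M]
  [ContMDiffSMul 𝓘(ℝ, A) 𝓘(ℝ, E) ∞ G M] [IsManifold 𝓘(ℝ, E) ∞ M]

variable (A E) in
theorem ker_orbitDeriv_le_of_stabilizer_le {p q : M}
    (hpq : MulAction.stabilizer G p ≤ MulAction.stabilizer G q) :
    (orbitDeriv A G E p).ker ≤ (orbitDeriv A G E q).ker := by
  obtain ⟨θ, pr, hθ⟩ := exists_isStraightening_orbitMap A G E p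
  intro ζ hζ
  have hprζ : pr ζ = 0 := hθ.ker_eq.ge hζ
  have hline : HasFDerivAt (fun t : ℝ => t • ζ) (ContinuousLinearMap.toSpanSingleton ℝ ζ) 0 :=
    (ContinuousLinearMap.toSpanSingleton ℝ ζ).hasFDerivAt
  have hcurve := hasMFDerivAt_comp_of_eq (hasMFDerivAt_orbitMap_one (A := A) (G := G) (E := E) q)
    (hasMFDerivAt_comp_of_eq hθ.hasMFDerivAt_symm hline.hasMFDerivAt (zero_smul ℝ ζ))
    (by simp [hθ.symm_zero])
  have hconst : HasMFDerivAt 𝓘(ℝ, ℝ) 𝓘(ℝ, E)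
      ((fun g : G => g • q) ∘ (θ.symm ∘ fun t : ℝ => t • ζ)) 0 (0 : ℝ →L[ℝ] E) := by
    refine (hasMFDerivAt_const q (0 : ℝ)).congr_of_eventuallyEq ?_
    have hnear : ∀ᶠ t : ℝ in 𝓝 0, t • ζ ∈ θ.target :=
      hline.continuousAt.preimage_mem_nhds
        (θ.open_target.mem_nhds (by simpa using hθ.zero_mem))
    filter_upwards [hnear] with t ht
    have hfix := (hθ.eq_iff _ ht 0 hθ.zero_mem).2 (by simp [hprζ])
    rw [hθ.symm_zero, one_smul] at hfix
    exact hpq (MulAction.mem_stabilizer_iff.2 hfix)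
  have hzero : orbitDeriv A G E q ((1 : ℝ) • ζ) = 0 :=
    DFunLike.congr_fun (hasMFDerivAt_unique hcurve hconst) (1 : ℝ)
  rwa [one_smul] at hzero

variable (A E) in
theorem exists_nhds_one_forall_smul_eq (p : M) :
    ∃ O ∈ 𝓝 (1 : G), ∀ g ∈ O, g • p = p → ∀ q : M,
      (orbitDeriv A G E p).ker ≤ (orbitDeriv A G E q).ker → g • q = q := by
  obtain ⟨θ, pr, hθ⟩ := exists_isStraightening_orbitMap A G E p
  obtain ⟨ε, -, htgt⟩ := hθ.target_eq
  refine ⟨θ.source, θ.open_source.mem_nhds hθ.mem_source, fun g hg hgp q hpq => ?_⟩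
  have hgt := θ.map_source hg
  have hprg : pr (θ g) = 0 := by
    simpa using (hθ.eq_iff _ hgt 0 hθ.zero_mem).1
      (by rw [θ.left_inv hg, hθ.symm_zero, hgp, one_smul])
  let s : Set ℝ := (fun t : ℝ => t • θ g) ⁻¹' θ.target
  have hs : IsOpen s := θ.open_target.preimage (by fun_prop)
  have hconv : Convex ℝ s := by
    simp only [s, htgt]
    exact (convex_ball (0 : A) ε).linear_preimage (LinearMap.toSpanSingleton ℝ A (θ g))
  have hγ : ContMDiffOn 𝓘(ℝ, ℝ) 𝓘(ℝ, A) ∞ (fun t : ℝ => θ.symm (t • θ g)) s :=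
    hθ.contMDiffOn_symm.comp
      (show ContDiff ℝ ∞ (fun t : ℝ => t • θ g) by fun_prop).contMDiff.contMDiffOn subset_rfl
  have hfix : ∀ t ∈ s, θ.symm (t • θ g) • p = p := fun t ht => by
    simpa [hθ.symm_zero] using (hθ.eq_iff _ ht 0 hθ.zero_mem).2 (by simp [hprg])
  simpa [θ.left_inv hg, hθ.symm_zero] using smul_eq_smul_of_stabilizer_path (E := E) hs
    hconv.isPreconnected hγ hfix hpq (y := 1) (z := 0) (by simpa [s] using hgt)
    (by simpa [s] using hθ.zero_mem)

theorem relIndex_iInf_stabilizer_ne_zero [ProperSMul G M] {ι : Type*} {p : M} {q : ι → M}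
    (hpq : ∀ i, (orbitDeriv A G E p).ker ≤ (orbitDeriv A G E (q i)).ker) :
    (⨅ i, MulAction.stabilizer G (q i)).relIndex (MulAction.stabilizer G p) ≠ 0 := by
  have := topologicalGroup_of_lieGroup (G := G) 𝓘(ℝ, A) ∞
  obtain ⟨O, hO, hfix⟩ := exists_nhds_one_forall_smul_eq A (G := G) E p
  let J := (⨅ i, MulAction.stabilizer G (q i)).subgroupOf (MulAction.stabilizer G p)
  have : CompactSpace (MulAction.stabilizer G p) :=
    isCompact_iff_compactSpace.1 (isCompact_stabilizer p)
  have hopen : IsOpen (J : Set (MulAction.stabilizer G p)) := by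
    refine Subgroup.isOpen_of_mem_nhds _ (g := 1) ?_
    filter_upwards [continuous_subtype_val.continuousAt.preimage_mem_nhds
      (show O ∈ 𝓝 ((1 : MulAction.stabilizer G p) : G) from hO)] with g hg
    exact Subgroup.mem_subgroupOf.2 (Subgroup.mem_iInf.2 fun i => hfix g hg g.2 _ (hpq i))
  have : Finite (MulAction.stabilizer G p ⧸ J) := Subgroup.quotient_finite_of_isOpen _ hopen
  exact Subgroup.index_ne_zero_of_finite

variable (A E) in
theorem finrank_range_orbitDeriv_eq_of_conj {p q : M} {k : G}
    (hk : MulAction.stabilizer G q = (MulAction.stabilizer G p).map (MulAut.conj k).toMonoidHom) :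
    Module.finrank ℝ (orbitDeriv A G E q).range = Module.finrank ℝ (orbitDeriv A G E p).range := by
  rw [← MulAction.stabilizer_smul_eq_stabilizer_map_conj] at hk
  have hker : (orbitDeriv A G E q).ker = (orbitDeriv A G E (k • p)).ker :=
    le_antisymm (ker_orbitDeriv_le_of_stabilizer_le A E hk.le)
      (ker_orbitDeriv_le_of_stabilizer_le A E hk.ge)
  have hq := LinearMap.finrank_range_add_finrank_ker (orbitDeriv A G E q).toLinearMap
  have hp := LinearMap.finrank_range_add_finrank_ker (orbitDeriv A G E p).toLinearMap
  have hkp := finrank_ker_orbitDeriv_smul (A := A) (E := E) k p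
  rw [hker] at hq
  omega

end Isotropy

section ConjugateIsotropy

variable (A : Type*) [NormedAddCommGroup A] [NormedSpace ℝ A] [FiniteDimensional ℝ A]
  {G : Type*} [TopologicalSpace G] [ChartedSpace A G] [Group G] [LieGroup 𝓘(ℝ, A) ∞ G]
  (E : Type*) [NormedAddCommGroup E] [NormedSpace ℝ E] [FiniteDimensional ℝ E]
  {M : Type*} [TopologicalSpace M] [ChartedSpace E M] [MulAction G M]

theorem stabilizer_smul_eq_of_le [ContMDiffSMul 𝓘(ℝ, A) 𝓘(ℝ, E) ∞ G M]
    [IsManifold 𝓘(ℝ, E) ∞ M] [ProperSMul G M] {p : M} {k : G}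
    (hkp : MulAction.stabilizer G (k • p) ≤ MulAction.stabilizer G p) :
    MulAction.stabilizer G (k • p) = MulAction.stabilizer G p := by
  let S : ℕ → Subgroup G := fun i => MulAction.stabilizer G (k ^ i • p)
  have hS : ∀ i, S (i + 1) = (S i).map (MulAut.conj k).toMonoidHom := fun i => by
    simp only [S]
    rw [pow_succ', mul_smul, MulAction.stabilizer_smul_eq_stabilizer_map_conj]
  have hS0 : S 0 = MulAction.stabilizer G p := by simp [S]
  have hanti : Antitone S := antitone_nat_of_succ_le fun i => by
    induction i with
    | zero => simpa [S] using hkp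
    | succ i ih =>
      rw [hS (i + 1), hS i]
      exact Subgroup.map_mono (hS i ▸ ih)
  have hstep : ∀ i, (S (i + 1)).relIndex (S i) = (S 1).relIndex (S 0) := fun i => by
    induction i with
    | zero => rfl
    | succ i ih =>
      rw [← ih, hS (i + 1), hS i]
      exact Subgroup.relIndex_map_map_of_injective _ _ (MulAut.conj k).injective
  have hker : ∀ i, (orbitDeriv A G E p).ker ≤ (orbitDeriv A G E (k ^ i • p)).ker := fun i => by
    have hle := ker_orbitDeriv_le_of_stabilizer_le A E (hS0 ▸ hanti i.zero_le : S i ≤ _)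
    exact (Submodule.eq_of_le_of_finrank_le hle (finrank_ker_orbitDeriv_smul _ _).ge).ge
  simpa [S] using eq_of_antitone_of_relIndex_iInf_ne_zero hanti hstep
    (hS0 ▸ relIndex_iInf_stabilizer_ne_zero hker)

theorem stabilizer_eq_of_le_of_conj [ContMDiffSMul 𝓘(ℝ, A) 𝓘(ℝ, E) ∞ G M]
    [IsManifold 𝓘(ℝ, E) ∞ M] [ProperSMul G M] {p q : M} {k : G}
    (hk : MulAction.stabilizer G q = (MulAction.stabilizer G p).map (MulAut.conj k).toMonoidHom)
    (hqp : MulAction.stabilizer G q ≤ MulAction.stabilizer G p) :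
    MulAction.stabilizer G q = MulAction.stabilizer G p := by
  rw [← MulAction.stabilizer_smul_eq_stabilizer_map_conj] at hk
  rw [hk] at hqp ⊢
  exact stabilizer_smul_eq_of_le A E hqp

end ConjugateIsotropy

section Averaging

open MeasureTheory

theorem exists_isMulLeftInvariant_isProbabilityMeasure (H : Type*) [Group H] [TopologicalSpace H]
    [IsTopologicalGroup H] [CompactSpace H] [MeasurableSpace H] [BorelSpace H] :
    ∃ μ : Measure H, IsProbabilityMeasure μ ∧ μ.IsMulLeftInvariant := by
  refine ⟨Measure.haarMeasure ⊤, ⟨?_⟩, inferInstance⟩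
  simpa using Measure.haarMeasure_self (K₀ := (⊤ : TopologicalSpace.PositiveCompacts H))

theorem exists_isOpen_invariant {G M : Type*} [TopologicalSpace G] [Group G] [TopologicalSpace M]
    [MulAction G M] [ContinuousSMul G M] {H : Subgroup G} (hH : IsCompact (H : Set G))
    {W : Set M} (hW : IsOpen W) {p : M} (hp : ∀ h ∈ H, h • p ∈ W) :
    ∃ W' ⊆ W, IsOpen W' ∧ p ∈ W' ∧ ∀ h ∈ H, ∀ x ∈ W', h • x ∈ W' := by
  refine ⟨{x | ∀ h ∈ H, h • x ∈ W}, fun x hx => ?_, ?_, hp, fun h hh x hx k hk => ?_⟩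
  · simpa using hx 1 H.one_mem
  · rw [isOpen_iff_eventually]
    intro x hx
    refine hH.eventually_forall_of_forall_eventually fun h hh => ?_
    exact (continuous_snd.smul continuous_fst).continuousAt.preimage_mem_nhds
      (hW.mem_nhds (hx h hh))
  · rw [smul_smul]
    exact hx _ (H.mul_mem hk hh)

end Averaging

section Linearization

variable {A : Type*} [NormedAddCommGroup A] [NormedSpace ℝ A] {G : Type*} [Group G]
  {E : Type*} [NormedAddCommGroup E] {M : Type*} [TopologicalSpace M] [ChartedSpace E M]
  [MulAction G M]

variable (E) in
/-- The action written in the chart at `p`, translated so that points of the stabilizer of `p`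
map `chartAt E p p` to `0`. -/
noncomputable def actInChart (p : M) (g : G) (u : E) : E :=
  chartAt E p (g • (chartAt E p).symm u) - chartAt E p p

theorem actInChart_apply {p x : M} (hx : x ∈ (chartAt E p).source) (g : G) :
    actInChart E p g (chartAt E p x) = chartAt E p (g • x) - chartAt E p p := by
  rw [actInChart, (chartAt E p).left_inv hx]

variable [TopologicalSpace G] [ChartedSpace A G] [NormedSpace ℝ E]

variable (E) in
/-- The integrand whose average over the stabilizer of `p` linearises the action of the stabilizer
near `p`. On the stabilizer it is the derivative of `g` at `p` applied to `actInChart E p g⁻¹ u`;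
that derivative is written through `actInChart` so that the formula is smooth in all of `g`. -/
noncomputable def linearizingIntegrand (p : M) (g : G) (u : E) : E :=
  fderiv ℝ (actInChart E p g) (chartAt E p p) (actInChart E p g⁻¹ u)

variable [ContMDiffSMul 𝓘(ℝ, A) 𝓘(ℝ, E) ∞ G M]

theorem smulDeriv_mul_apply {p : M} (g : G) {h : G} (hh : h ∈ MulAction.stabilizer G p) (v : E) :
    smulDeriv A E (g * h) p v = smulDeriv A E g p (smulDeriv A E h p v) := by
  have hcomp := (hasMFDerivAt_comp_of_eq (hasMFDerivAt_smulMap (A := A) (E := E) g p)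
    (hasMFDerivAt_smulMap (A := A) (E := E) h p) hh).congr_of_eventuallyEq
      (f₁ := fun y : M => (g * h) • y) (.of_forall fun y => by simp [mul_smul])
  exact DFunLike.congr_fun (hasMFDerivAt_unique (hasMFDerivAt_smulMap (A := A) (g * h) p) hcomp) v

theorem smulDeriv_one_apply (p : M) (v : E) : smulDeriv A E (1 : G) p v = v := by
  have hid := (hasMFDerivAt_id p).congr_of_eventuallyEq (I := 𝓘(ℝ, E))
    (f₁ := fun y : M => (1 : G) • y) (.of_forall fun y => by simp)
  exact DFunLike.congr_fun (hasMFDerivAt_unique (hasMFDerivAt_smulMap (A := A) (1 : G) p) hid) v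

theorem smulDeriv_apply_inv {p : M} {h : G} (hh : h ∈ MulAction.stabilizer G p) (v : E) :
    smulDeriv A E h p (smulDeriv A E h⁻¹ p v) = v := by
  rw [← smulDeriv_mul_apply _ (inv_mem hh), mul_inv_cancel, smulDeriv_one_apply]

variable [IsManifold 𝓘(ℝ, E) ∞ M]

theorem contMDiffAt_actInChart {p : M} {g : G} {u : E} (hu : u ∈ (chartAt E p).target)
    (hg : g • (chartAt E p).symm u ∈ (chartAt E p).source) :
    ContMDiffAt (𝓘(ℝ, A).prod 𝓘(ℝ, E)) 𝓘(ℝ, E) ∞ (Function.uncurry (actInChart E p)) (g, u) := by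
  have hsymm : ContMDiffAt 𝓘(ℝ, E) 𝓘(ℝ, E) ∞ (chartAt E p).symm u :=
    (contMDiffOn_chart_symm (I := 𝓘(ℝ, E)) (x := p)).contMDiffAt
      ((chartAt E p).open_target.mem_nhds hu)
  have hsmul : ContMDiffAt (𝓘(ℝ, A).prod 𝓘(ℝ, E)) 𝓘(ℝ, E) ∞
      (fun z : G × E => z.1 • (chartAt E p).symm z.2) (g, u) :=
    contMDiffAt_fst.smul (I := 𝓘(ℝ, A)) (ContMDiffAt.comp (g, u) hsymm contMDiffAt_snd)
  have hchart : ContMDiffAt 𝓘(ℝ, E) 𝓘(ℝ, E) ∞ (chartAt E p) (g • (chartAt E p).symm u) :=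
    (contMDiffOn_chart (I := 𝓘(ℝ, E)) (x := p)).contMDiffAt
      ((chartAt E p).open_source.mem_nhds hg)
  exact (ContMDiffAt.comp (g, u) (g := chartAt E p) hchart hsmul).sub contMDiffAt_const

theorem contMDiffAt_actInChart_self {p : M} {h : G} (hh : h ∈ MulAction.stabilizer G p) :
    ContMDiffAt (𝓘(ℝ, A).prod 𝓘(ℝ, E)) 𝓘(ℝ, E) ∞ (Function.uncurry (actInChart E p))
      (h, chartAt E p p) := by
  refine contMDiffAt_actInChart (mem_chart_target E p) ?_
  rw [(chartAt E p).left_inv (mem_chart_source E p), MulAction.mem_stabilizer_iff.1 hh]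
  exact mem_chart_source E p

theorem hasFDerivAt_actInChart {p : M} {h : G} (hh : h ∈ MulAction.stabilizer G p) :
    HasFDerivAt (actInChart E p h) (smulDeriv A E h p : E →L[ℝ] E) (chartAt E p p) := by
  have hsmul := hasMFDerivAt_comp_of_eq (hasMFDerivAt_smulMap (A := A) (E := E) h p)
    (hasMFDerivAt_chartAt_symm_self (E := E) p) ((chartAt E p).left_inv (mem_chart_source E p))
  have hchart := hasMFDerivAt_comp_of_eq (hasMFDerivAt_chartAt_self (E := E) p) hsmul
    (by simpa [(chartAt E p).left_inv (mem_chart_source E p)] using hh)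
  exact hchart.hasFDerivAt.sub_const _

variable (A) in
theorem linearizingIntegrand_eq_smulDeriv {p : M} {h : G} (hh : h ∈ MulAction.stabilizer G p)
    (u : E) : linearizingIntegrand E p h u = smulDeriv A E h p (actInChart E p h⁻¹ u) := by
  rw [linearizingIntegrand, (hasFDerivAt_actInChart (A := A) hh).fderiv]
  rfl

theorem hasFDerivAt_linearizingIntegrand {p : M} {h : G} (hh : h ∈ MulAction.stabilizer G p) :
    HasFDerivAt (linearizingIntegrand E p h)
      ((smulDeriv A E h p : E →L[ℝ] E).comp (smulDeriv A E h⁻¹ p : E →L[ℝ] E)) (chartAt E p p) :=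
  ((smulDeriv A E h p : E →L[ℝ] E).hasFDerivAt.comp (chartAt E p p)
    (hasFDerivAt_actInChart (inv_mem hh))).congr_of_eventuallyEq
      (.of_forall (linearizingIntegrand_eq_smulDeriv A hh))

theorem linearizingIntegrand_mul_smul {p x : M} {h k : G} (hh : h ∈ MulAction.stabilizer G p)
    (hk : k ∈ MulAction.stabilizer G p) (hx : x ∈ (chartAt E p).source)
    (hhx : h • x ∈ (chartAt E p).source) :
    linearizingIntegrand E p (h * k) (chartAt E p (h • x)) =
      smulDeriv A E h p (linearizingIntegrand E p k (chartAt E p x)) := by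
  rw [linearizingIntegrand_eq_smulDeriv A (mul_mem hh hk), linearizingIntegrand_eq_smulDeriv A hk,
    smulDeriv_mul_apply _ hk, actInChart_apply hx, actInChart_apply hhx, mul_inv_rev, mul_smul,
    inv_smul_smul]

open MeasureTheory in
theorem integral_linearizingIntegrand_smul [CompleteSpace E] [IsTopologicalGroup G] {p x : M}
    [MeasurableSpace (MulAction.stabilizer G p)] [BorelSpace (MulAction.stabilizer G p)]
    {μ : Measure (MulAction.stabilizer G p)} [μ.IsMulLeftInvariant] {h : G}
    (hh : h ∈ MulAction.stabilizer G p) (hx : x ∈ (chartAt E p).source)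
    (hhx : h • x ∈ (chartAt E p).source)
    (hint : Integrable (fun k : MulAction.stabilizer G p =>
      linearizingIntegrand E p (k : G) (chartAt E p x)) μ) :
    ∫ k : MulAction.stabilizer G p, linearizingIntegrand E p (k : G) (chartAt E p (h • x)) ∂μ =
      smulDeriv A E h p (∫ k : MulAction.stabilizer G p,
        linearizingIntegrand E p (k : G) (chartAt E p x) ∂μ) := by
  let H := MulAction.stabilizer G p
  calc ∫ k : H, linearizingIntegrand E p (k : G) (chartAt E p (h • x)) ∂μ
      = ∫ k : H, linearizingIntegrand E p ((⟨h, hh⟩ * k : H) : G) (chartAt E p (h • x)) ∂μ :=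
        (integral_mul_left_eq_self
          (fun k : H => linearizingIntegrand E p (k : G) (chartAt E p (h • x))) ⟨h, hh⟩).symm
    _ = ∫ k : H, (smulDeriv A E h p : E →L[ℝ] E)
          (linearizingIntegrand E p (k : G) (chartAt E p x)) ∂μ :=
        integral_congr_ae (.of_forall fun k => linearizingIntegrand_mul_smul hh k.2 hx hhx)
    _ = _ := ContinuousLinearMap.integral_comp_comm _ hint

variable [LieGroup 𝓘(ℝ, A) ∞ G]

theorem continuousOn_smulDeriv (p : M) :
    ContinuousOn (fun h : G => (smulDeriv A E h p : E →L[ℝ] E)) (MulAction.stabilizer G p) := by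
  have hfderiv : ContinuousOn (fun h : G => fderiv ℝ (actInChart E p h) (chartAt E p p))
      (MulAction.stabilizer G p) := fun h hh => by
    have hparam := contMDiffAt_fderiv_param (A := A) (contMDiffAt_actInChart_self (E := E) hh)
    exact (ContinuousAt.comp (f := fun h : G => (h, chartAt E p p)) (x := h) hparam.continuousAt
      (continuousAt_id.prodMk continuousAt_const)).continuousWithinAt
  exact hfderiv.congr fun h hh => (hasFDerivAt_actInChart hh).fderiv.symm

theorem contMDiffAt_linearizingIntegrand {p : M} {h : G} (hh : h ∈ MulAction.stabilizer G p)
    {u : E} (hu : u ∈ (chartAt E p).target)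
    (hhu : h⁻¹ • (chartAt E p).symm u ∈ (chartAt E p).source) :
    ContMDiffAt (𝓘(ℝ, A).prod 𝓘(ℝ, E)) 𝓘(ℝ, E) ∞
      (Function.uncurry (linearizingIntegrand E p)) (h, u) := by
  have hbase : ContMDiffAt (𝓘(ℝ, A).prod 𝓘(ℝ, E)) (𝓘(ℝ, A).prod 𝓘(ℝ, E)) ∞
      (fun z : G × E => (z.1, chartAt E p p)) (h, u) := contMDiffAt_fst.prodMk contMDiffAt_const
  have hinv : ContMDiffAt (𝓘(ℝ, A).prod 𝓘(ℝ, E)) (𝓘(ℝ, A).prod 𝓘(ℝ, E)) ∞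
      (fun z : G × E => (z.1⁻¹, z.2)) (h, u) := contMDiffAt_fst.inv.prodMk contMDiffAt_snd
  have hfderiv := contMDiffAt_fderiv_param (A := A) (contMDiffAt_actInChart_self (E := E) hh)
  have hact := contMDiffAt_actInChart (A := A) hu hhu
  exact (ContMDiffAt.comp (h, u) hfderiv hbase).clm_apply (ContMDiffAt.comp (h, u) hact hinv)

open MeasureTheory in
variable (A E) in
theorem exists_equivariant_map_of_isCompact_stabilizer [FiniteDimensional ℝ E]
    [ContinuousSMul G M] {p : M} (hc : IsCompact (MulAction.stabilizer G p : Set G)) :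
    ∃ (W : Set M) (ψ : M → E), IsOpen W ∧ p ∈ W ∧ ψ p = 0 ∧
      ContMDiffOn 𝓘(ℝ, E) 𝓘(ℝ, E) ∞ ψ W ∧
      HasMFDerivAt 𝓘(ℝ, E) 𝓘(ℝ, E) ψ p (ContinuousLinearMap.id ℝ E) ∧
      ∀ h ∈ MulAction.stabilizer G p, ∀ x ∈ W, ψ (h • x) = smulDeriv A E h p (ψ x) := by
  have := topologicalGroup_of_lieGroup (G := G) 𝓘(ℝ, A) ∞
  let H := MulAction.stabilizer G p
  have : CompactSpace H := isCompact_iff_compactSpace.1 hc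
  let _ : MeasurableSpace H := borel H
  have : BorelSpace H := ⟨rfl⟩
  obtain ⟨μ, hμ, hμinv⟩ := exists_isMulLeftInvariant_isProbabilityMeasure H
  let φ := chartAt E p
  obtain ⟨W, hWφ, hW, hpW, hWH⟩ := exists_isOpen_invariant (H := H) hc φ.open_source (p := p)
    (fun h hh => (MulAction.mem_stabilizer_iff.1 hh).symm ▸ mem_chart_source E p)
  have hU : IsOpen (φ.target ∩ φ.symm ⁻¹' W) := φ.isOpen_inter_preimage_symm hW
  have hφU : ∀ x ∈ W, φ x ∈ φ.target ∩ φ.symm ⁻¹' W := fun x hx =>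
    ⟨φ.map_source (hWφ hx), by rwa [Set.mem_preimage, φ.left_inv (hWφ hx)]⟩
  have hsmooth : ∀ h : H, ∀ u ∈ φ.target ∩ φ.symm ⁻¹' W, ContMDiffAt (𝓘(ℝ, A).prod 𝓘(ℝ, E))
      𝓘(ℝ, E) ∞ (Function.uncurry (linearizingIntegrand E p)) ((h : G), u) := fun h u hu =>
    contMDiffAt_linearizingIntegrand h.2 hu.1 (hWφ (hWH _ (inv_mem h.2) _ hu.2))
  let avg : E → E := fun u => ∫ h : H, linearizingIntegrand E p (h : G) u ∂μ
  have havg : HasFDerivAt avg (ContinuousLinearMap.id ℝ E) (φ p) := by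
    have hid : ∀ h : H, fderiv ℝ (linearizingIntegrand E p (h : G)) (φ p) =
        ContinuousLinearMap.id ℝ E := fun h => by
      rw [(hasFDerivAt_linearizingIntegrand (A := A) h.2).fderiv]
      exact ContinuousLinearMap.ext (smulDeriv_apply_inv h.2)
    simpa [hid] using hasFDerivAt_integral_param μ continuous_subtype_val hU hsmooth (hφU p hpW)
  have hzero : ∀ h : H, linearizingIntegrand E p (h : G) (φ p) = 0 := fun h => by
    rw [linearizingIntegrand_eq_smulDeriv A h.2, actInChart_apply (mem_chart_source E p),
      MulAction.mem_stabilizer_iff.1 (inv_mem h.2), sub_self, map_zero]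
  refine ⟨W, avg ∘ φ, hW, hpW, ?_, ?_,
    hasMFDerivAt_comp_of_eq havg.hasMFDerivAt (hasMFDerivAt_chartAt_self p) rfl,
    fun h hh x hx => ?_⟩
  · simp [avg, hzero]
  · exact (contDiffOn_integral_param μ continuous_subtype_val hU hsmooth).contMDiffOn.comp
      ((contMDiffOn_chart (I := 𝓘(ℝ, E)) (x := p)).mono hWφ) hφU
  · have hint : Integrable (fun k : H => linearizingIntegrand E p (k : G) (φ x)) μ := by
      refine Continuous.integrable_of_hasCompactSupport
        (continuous_iff_continuousAt.2 fun k => ?_) (HasCompactSupport.of_compactSpace _)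
      exact ContinuousAt.comp (f := fun k : H => ((k : G), φ x))
        (hsmooth k (φ x) (hφU x hx)).continuousAt
        (continuous_subtype_val.continuousAt.prodMk continuousAt_const)
    exact integral_linearizingIntegrand_smul hh (hWφ hx) (hWφ (hWH h hh x hx)) hint

variable (A G) in
/-- A chart centred at `p` in which the stabilizer of `p` acts linearly, by its isotropy
representation `smulDeriv`. -/
structure IsLinearizingChart (p : M) (ψ : OpenPartialHomeomorph M E) : Prop where
  mem_source : p ∈ ψ.source
  map_self : ψ p = 0
  contMDiffOn : ContMDiffOn 𝓘(ℝ, E) 𝓘(ℝ, E) ∞ ψ ψ.source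
  contMDiffOn_symm : ContMDiffOn 𝓘(ℝ, E) 𝓘(ℝ, E) ∞ ψ.symm ψ.target
  hasMFDerivAt : HasMFDerivAt 𝓘(ℝ, E) 𝓘(ℝ, E) ψ p (ContinuousLinearMap.id ℝ E)
  smul_mem_source : ∀ h ∈ MulAction.stabilizer G p, ∀ x ∈ ψ.source, h • x ∈ ψ.source
  map_smul : ∀ h ∈ MulAction.stabilizer G p, ∀ x ∈ ψ.source, ψ (h • x) = smulDeriv A E h p (ψ x)

variable (A E) in
theorem exists_isLinearizingChart [FiniteDimensional ℝ E] [ContinuousSMul G M] {p : M}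
    (hc : IsCompact (MulAction.stabilizer G p : Set G)) :
    ∃ ψ : OpenPartialHomeomorph M E, IsLinearizingChart A G p ψ := by
  obtain ⟨W, ψ, hW, hpW, hψp, hψ, hdψ, hψsmul⟩ :=
    exists_equivariant_map_of_isCompact_stabilizer A E hc
  obtain ⟨e, hpe, heW, heψ, he, he'⟩ := exists_openPartialHomeomorph_of_contMDiffOn hW hpW hψ
    (ContinuousLinearEquiv.refl ℝ E) hdψ
  obtain ⟨W', hW'e, hW', hpW', hW'smul⟩ := exists_isOpen_invariant hc e.open_source (p := p)
    (fun h hh => (MulAction.mem_stabilizer_iff.1 hh).symm ▸ hpe)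
  have hsrc : (e.restrOpen W' hW').source = W' := by
    rw [OpenPartialHomeomorph.restrOpen_source, Set.inter_eq_right.2 hW'e]
  refine ⟨e.restrOpen W' hW', hsrc.symm ▸ hpW', (heψ p hpe).trans hψp, he.mono (hsrc.symm ▸ hW'e),
    he'.mono Set.inter_subset_left, hdψ.congr_of_eventuallyEq
      (Filter.eventuallyEq_of_mem (e.open_source.mem_nhds hpe) heψ),
    hsrc.symm ▸ hW'smul, fun h hh x hx => ?_⟩
  rw [hsrc] at hx
  exact (heψ _ (hW'e (hW'smul h hh x hx))).trans
    ((hψsmul h hh x (heW (hW'e hx))).trans (congrArg _ (heψ x (hW'e hx)).symm))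

end Linearization

section CompactRepresentation

open MeasureTheory

variable {H : Type*} [Group H] {F : Type*} [NormedAddCommGroup F] [NormedSpace ℝ F]
  {ρ : H →* F →L[ℝ] F}

/-- The representation `T ↦ ρ h ∘ T ∘ ρ h⁻¹` on endomorphisms. -/
noncomputable def conjRep (ρ : H →* F →L[ℝ] F) : H →* (F →L[ℝ] F) →L[ℝ] (F →L[ℝ] F) where
  toFun h := (ContinuousLinearMap.compL ℝ F F F (ρ h)).comp
    ((ContinuousLinearMap.compL ℝ F F F).flip (ρ h⁻¹))
  map_one' := by ext; simp
  map_mul' h k := by ext; simp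

theorem conjRep_apply (ρ : H →* F →L[ℝ] F) (h : H) (T : F →L[ℝ] F) (v : F) :
    conjRep ρ h T v = ρ h (T (ρ h⁻¹ v)) := rfl

variable [TopologicalSpace H]

theorem integrable_rep_apply [CompactSpace H] [MeasurableSpace H] [BorelSpace H] {μ : Measure H}
    [IsFiniteMeasure μ] (hρ : Continuous ρ) (v : F) : Integrable (fun h => ρ h v) μ :=
  (hρ.clm_apply continuous_const).integrable_of_hasCompactSupport (.of_compactSpace _)

variable [IsTopologicalGroup H]

theorem continuous_conjRep (hρ : Continuous ρ) : Continuous (conjRep ρ) :=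
  ((ContinuousLinearMap.compL ℝ F F F).continuous.comp hρ).clm_comp
    ((ContinuousLinearMap.compL ℝ F F F).flip.continuous.comp (hρ.comp continuous_inv))

section Integral

variable [MeasurableSpace H] [BorelSpace H] {μ : Measure H} [μ.IsMulLeftInvariant]

theorem integral_inv_rep_apply_rep (h : H) (v : F) :
    ∫ k, ρ k⁻¹ (ρ h v) ∂μ = ∫ k, ρ k⁻¹ v ∂μ := by
  rw [← integral_mul_left_eq_self (fun k => ρ k⁻¹ (ρ h v)) h]
  simp [← mul_apply_eq_comp, ← map_mul]

variable [CompactSpace H] [IsProbabilityMeasure μ]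

variable [FiniteDimensional ℝ F]

theorem rep_apply_integral (hρ : Continuous ρ) (h : H) (v : F) :
    ρ h (∫ k, ρ k v ∂μ) = ∫ k, ρ k v ∂μ := by
  rw [← ContinuousLinearMap.integral_comp_comm _ (integrable_rep_apply hρ v)]
  simpa using integral_mul_left_eq_self (μ := μ) (fun k => ρ k v) h

theorem integral_inv_rep_apply (hρ : Continuous ρ) (v : F) :
    ∫ h, ρ h⁻¹ v ∂μ = ∫ h, ρ h v ∂μ := by
  have hinv : Integrable (fun h => ρ h⁻¹) μ :=
    (hρ.comp continuous_inv).integrable_of_hasCompactSupport (.of_compactSpace _)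
  calc ∫ h, ρ h⁻¹ v ∂μ
      = ∫ k, ∫ h, ρ h⁻¹ (ρ k v) ∂μ ∂μ := by simp [integral_inv_rep_apply_rep]
    _ = ∫ k, (∫ h, ρ h⁻¹ ∂μ) (ρ k v) ∂μ := by simp only [ContinuousLinearMap.integral_apply hinv]
    _ = ∫ h, ρ h⁻¹ (∫ k, ρ k v ∂μ) ∂μ := by
      rw [ContinuousLinearMap.integral_comp_comm _ (integrable_rep_apply hρ v),
        ContinuousLinearMap.integral_apply hinv]
    _ = ∫ h, ρ h v ∂μ := by simp [rep_apply_integral hρ]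

end Integral

variable [CompactSpace H] [FiniteDimensional ℝ F]

theorem exists_average (hρ : Continuous ρ) :
    ∃ avg : F →L[ℝ] F, (∀ h v, ρ h (avg v) = avg v) ∧ (∀ h v, avg (ρ h v) = avg v) ∧
      ∀ (S : Submodule ℝ F) (v : F), (∀ h, ρ h v - v ∈ S) → avg v - v ∈ S := by
  let _ : MeasurableSpace H := borel H
  have : BorelSpace H := ⟨rfl⟩
  obtain ⟨μ, hμ, hμinv⟩ := exists_isMulLeftInvariant_isProbabilityMeasure H
  have havg : ∀ v, (∫ h, ρ h ∂μ) v = ∫ h, ρ h v ∂μ := ContinuousLinearMap.integral_apply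
    (hρ.integrable_of_hasCompactSupport (.of_compactSpace _))
  refine ⟨∫ h, ρ h ∂μ, fun h v => ?_, fun h v => ?_, fun S v hS => ?_⟩
  · rw [havg, rep_apply_integral hρ]
  · rw [havg, havg, ← integral_inv_rep_apply hρ, ← integral_inv_rep_apply hρ,
      integral_inv_rep_apply_rep]
  · have hsub : (∫ h, ρ h ∂μ) v - v = ∫ h, (ρ h v - v) ∂μ := by
      rw [havg, integral_sub (integrable_rep_apply hρ v) (integrable_const v)]
      simp
    rw [hsub]
    exact S.convex.integral_mem S.closed_of_finiteDimensional (.of_forall hS)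
      ((integrable_rep_apply hρ v).sub (integrable_const v))

theorem exists_equivariant_projection (hρ : Continuous ρ) {V : Submodule ℝ F}
    (hV : ∀ h, ∀ v ∈ V, ρ h v ∈ V) :
    ∃ Q : F →L[ℝ] F, (∀ v, Q v ∈ V) ∧ (∀ v ∈ V, Q v = v) ∧ ∀ h v, Q (ρ h v) = ρ h (Q v) := by
  have hρinv : ∀ h v, ρ h (ρ h⁻¹ v) = v := fun h v => by
    rw [← mul_apply_eq_comp, ← map_mul, mul_inv_cancel, map_one,
      one_apply_eq_self]
  obtain ⟨P, hP⟩ := Submodule.ClosedComplemented.of_finiteDimensional V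
  let Q₀ : F →L[ℝ] F := V.subtypeL.comp P
  have hQ₀mem : ∀ v, Q₀ v ∈ V := fun v => (P v).2
  have hQ₀id : ∀ v ∈ V, Q₀ v = v := fun v hv => congrArg Subtype.val (hP ⟨v, hv⟩)
  obtain ⟨avg, hfix, -, hsub⟩ := exists_average (continuous_conjRep hρ)
  refine ⟨avg Q₀, fun v => ?_, fun v hv => ?_, fun h v => ?_⟩
  · have hmem := hsub (V.comap (ContinuousLinearMap.apply ℝ F v).toLinearMap) Q₀ fun h =>
      V.sub_mem (hV h _ (hQ₀mem _)) (hQ₀mem v)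
    simpa using V.add_mem hmem (hQ₀mem v)
  · have hker := hsub (ContinuousLinearMap.apply ℝ F v).ker Q₀ fun h => by
      simp [conjRep_apply, hQ₀id _ (hV h⁻¹ v hv), hQ₀id v hv, hρinv]
    rw [LinearMap.mem_ker] at hker
    simpa [hQ₀id v hv, sub_eq_zero] using hker
  · have hcomm := DFunLike.congr_fun (hfix h Q₀) (ρ h v)
    rw [conjRep_apply, ← mul_apply_eq_comp (ρ h⁻¹), ← map_mul, inv_mul_cancel,
      map_one, one_apply_eq_self] at hcomm
    exact hcomm.symm

end CompactRepresentation

section IsotropyRep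

variable {A : Type*} [NormedAddCommGroup A] [NormedSpace ℝ A]
  {G : Type*} [TopologicalSpace G] [ChartedSpace A G] [Group G]
  {E : Type*} [NormedAddCommGroup E] [NormedSpace ℝ E]
  {M : Type*} [TopologicalSpace M] [ChartedSpace E M] [MulAction G M]
  [ContMDiffSMul 𝓘(ℝ, A) 𝓘(ℝ, E) ∞ G M]

variable (A E) in
/-- The isotropy representation of the stabilizer of `p` on the tangent space at `p`. -/
noncomputable def isotropyRep (p : M) : MulAction.stabilizer G p →* E →L[ℝ] E where
  toFun h := smulDeriv A E (h : G) p
  map_one' := ContinuousLinearMap.ext fun v => smulDeriv_one_apply p v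
  map_mul' h k := ContinuousLinearMap.ext fun v => smulDeriv_mul_apply (h : G) k.2 v

variable [LieGroup 𝓘(ℝ, A) ∞ G]

theorem smulDeriv_mem_range_orbitDeriv {p : M} {h : G} (hh : h ∈ MulAction.stabilizer G p) {v : E}
    (hv : v ∈ (orbitDeriv A G E p).range) : smulDeriv A E h p v ∈ (orbitDeriv A G E p).range := by
  obtain ⟨Ad, hAd⟩ := exists_smulDeriv_orbitDeriv (A := A) (E := E) h p
  obtain ⟨ξ, rfl⟩ := hv
  rw [MulAction.mem_stabilizer_iff.1 hh] at hAd
  exact ⟨Ad ξ, (hAd ξ).symm⟩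

variable (A G E) in
/-- The vectors at `p` that are fixed by the isotropy group modulo the tangent space of the
orbit. -/
noncomputable def fixedModVertical (p : M) : Submodule ℝ E where
  carrier := {v | ∀ h ∈ MulAction.stabilizer G p,
    smulDeriv A E h p v - v ∈ (orbitDeriv A G E p).range}
  zero_mem' := fun h _ => by simp
  add_mem' := fun {a b} ha hb h hh => by
    have := Submodule.add_mem _ (ha h hh) (hb h hh)
    rwa [sub_add_sub_comm, ← map_add] at this
  smul_mem' := fun c a ha h hh => by
    have := Submodule.smul_mem _ c (ha h hh)
    rwa [smul_sub, ← map_smul] at this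

theorem range_orbitDeriv_le_fixedModVertical (p : M) :
    (orbitDeriv A G E p).range ≤ fixedModVertical A G E p := fun _ hv _ hh =>
  Submodule.sub_mem _ (smulDeriv_mem_range_orbitDeriv hh hv) hv

variable [IsManifold 𝓘(ℝ, E) ∞ M]

theorem continuous_isotropyRep (p : M) : Continuous (isotropyRep A (G := G) E p) :=
  continuousOn_iff_continuous_domRestrict.1 (continuousOn_smulDeriv p)

variable [FiniteDimensional ℝ E]

theorem exists_average_stabilizer {p : M} (hc : IsCompact (MulAction.stabilizer G p : Set G)) :
    ∃ avg : E →L[ℝ] E,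
      (∀ h ∈ MulAction.stabilizer G p, ∀ v, smulDeriv A E h p (avg v) = avg v) ∧
      (∀ h ∈ MulAction.stabilizer G p, ∀ v, avg (smulDeriv A E h p v) = avg v) ∧
      ∀ (S : Submodule ℝ E) (v : E),
        (∀ h ∈ MulAction.stabilizer G p, smulDeriv A E h p v - v ∈ S) → avg v - v ∈ S := by
  have := topologicalGroup_of_lieGroup (G := G) 𝓘(ℝ, A) ∞
  have : CompactSpace (MulAction.stabilizer G p) := isCompact_iff_compactSpace.1 hc
  obtain ⟨avg, hfix, hinv, hsub⟩ := exists_average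
    (continuous_isotropyRep (A := A) (G := G) (E := E) p)
  exact ⟨avg, fun h hh => hfix ⟨h, hh⟩, fun h hh => hinv ⟨h, hh⟩,
    fun S v hS => hsub S v fun h => hS h h.2⟩

theorem exists_vertical_projection {p : M} (hc : IsCompact (MulAction.stabilizer G p : Set G)) :
    ∃ Q : E →L[ℝ] E, (∀ v, Q v ∈ (orbitDeriv A G E p).range) ∧
      (∀ v ∈ (orbitDeriv A G E p).range, Q v = v) ∧
      ∀ h ∈ MulAction.stabilizer G p, ∀ v, Q (smulDeriv A E h p v) = smulDeriv A E h p (Q v) := by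
  have := topologicalGroup_of_lieGroup (G := G) 𝓘(ℝ, A) ∞
  have : CompactSpace (MulAction.stabilizer G p) := isCompact_iff_compactSpace.1 hc
  obtain ⟨Q, hmem, hid, hcomm⟩ := exists_equivariant_projection
    (continuous_isotropyRep (A := A) (G := G) (E := E) p)
    (V := (orbitDeriv A G E p).range) (fun h v hv => smulDeriv_mem_range_orbitDeriv h.2 hv)
  exact ⟨Q, hmem, hid, fun h hh => hcomm ⟨h, hh⟩⟩

end IsotropyRep

theorem exists_nhds_of_stabilizer_subset {G M : Type*} [TopologicalSpace G] [Group G]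
    [TopologicalSpace M] [MulAction G M] [ProperSMul G M] {p : M} {O : Set G} (hO : IsOpen O)
    (hp : (MulAction.stabilizer G p : Set G) ⊆ O) :
    ∃ W : Set M, IsOpen W ∧ p ∈ W ∧ ∀ (g : G), ∀ x ∈ W, g • x ∈ W → g ∈ O := by
  have hclosed := (ProperSMul.isProperMap_smul_pair (G := G) (X := M)).isClosedMap
    (Oᶜ ×ˢ Set.univ) (hO.isClosed_compl.prod isClosed_univ)
  have hpp : (p, p) ∈ ((fun gx : G × M => (gx.1 • gx.2, gx.2)) '' (Oᶜ ×ˢ Set.univ))ᶜ := by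
    rintro ⟨⟨g, x⟩, ⟨hg, -⟩, hgx⟩
    obtain ⟨hgx, rfl⟩ := Prod.mk.inj hgx
    exact hg (hp hgx)
  obtain ⟨u, v, hu, hv, hpu, hpv, huv⟩ := isOpen_prod_iff.1 hclosed.isOpen_compl p p hpp
  refine ⟨u ∩ v, hu.inter hv, ⟨hpu, hpv⟩, fun g x hx hgx => ?_⟩
  by_contra hg
  exact huv (Set.mk_mem_prod hgx.1 hx.2) ⟨(g, x), ⟨hg, trivial⟩, rfl⟩

/-- The open set on which `tubeMap` is smooth. -/
def tubeDomain {A G E M : Type*} [NormedAddCommGroup A] [NormedSpace ℝ A] [TopologicalSpace G]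
    [NormedAddCommGroup E] [NormedSpace ℝ E] [TopologicalSpace M] (ψ : OpenPartialHomeomorph M E)
    (θ : OpenPartialHomeomorph G A) (Q : E →L[ℝ] E) (lift : E →L[ℝ] A) : Set E :=
  lift ⁻¹' θ.target ∩ (fun v => v - Q v) ⁻¹' ψ.target

theorem isOpen_tubeDomain {A G E M : Type*} [NormedAddCommGroup A] [NormedSpace ℝ A]
    [TopologicalSpace G] [NormedAddCommGroup E] [NormedSpace ℝ E] [TopologicalSpace M]
    (ψ : OpenPartialHomeomorph M E) (θ : OpenPartialHomeomorph G A) (Q : E →L[ℝ] E)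
    (lift : E →L[ℝ] A) : IsOpen (tubeDomain ψ θ Q lift) :=
  (θ.open_target.preimage lift.continuous).inter (ψ.open_target.preimage (by fun_prop))

section Slice

variable {A : Type*} [NormedAddCommGroup A] [NormedSpace ℝ A]
  {G : Type*} [TopologicalSpace G] [ChartedSpace A G] [Group G]
  {E : Type*} [NormedAddCommGroup E] [NormedSpace ℝ E]
  {M : Type*} [TopologicalSpace M] [ChartedSpace E M] [MulAction G M]
  [ContMDiffSMul 𝓘(ℝ, A) 𝓘(ℝ, E) ∞ G M]

variable (A G) in
/-- The linear data of a tubular neighbourhood of the orbit of `p`: a chart `ψ` at `p` linearizing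
the isotropy action, coordinates `θ` on `G` straightening the orbit map, an equivariant projection
`Q` onto the tangent space of the orbit, and a lift of `Q` to the directions in `G` complementary to
the isotropy group, which are the fixed vectors of `pr`. The transversal is `Q ∘ ψ = 0`. -/
structure IsTube (p : M) (ψ : OpenPartialHomeomorph M E) (θ : OpenPartialHomeomorph G A)
    (pr : A →L[ℝ] A) (Q : E →L[ℝ] E) (lift : E →L[ℝ] A) : Prop where
  chart : IsLinearizingChart A G p ψ
  straightening : IsStraightening E (fun g : G => g • p) 1 θ pr
  proj_mem : ∀ v, Q v ∈ (orbitDeriv A G E p).range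
  proj_eq_self : ∀ v ∈ (orbitDeriv A G E p).range, Q v = v
  proj_smulDeriv : ∀ h ∈ MulAction.stabilizer G p, ∀ v,
    Q (smulDeriv A E h p v) = smulDeriv A E h p (Q v)
  orbitDeriv_lift : ∀ v, orbitDeriv A G E p (lift v) = Q v
  pr_lift : ∀ v, pr (lift v) = lift v

/-- The parametrization of a neighbourhood of the orbit by tangent vectors `v`: the component of `v`
in the transversal gives a point of the slice, which is then moved by the lift of the component
tangent to the orbit. -/
noncomputable def tubeMap (ψ : OpenPartialHomeomorph M E) (θ : OpenPartialHomeomorph G A)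
    (Q : E →L[ℝ] E) (lift : E →L[ℝ] A) (v : E) : M :=
  θ.symm (lift v) • ψ.symm (v - Q v)

namespace IsTube

variable {p : M} {ψ : OpenPartialHomeomorph M E} {θ : OpenPartialHomeomorph G A}
  {pr : A →L[ℝ] A} {Q : E →L[ℝ] E} {lift : E →L[ℝ] A}

theorem pr_eq_zero (h : IsTube A G p ψ θ pr Q lift) {ζ : A} (hζ : orbitDeriv A G E p ζ = 0) :
    pr ζ = 0 :=
  h.straightening.ker_eq.ge hζ

theorem proj_orbitDeriv (h : IsTube A G p ψ θ pr Q lift) (ζ : A) :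
    Q (orbitDeriv A G E p ζ) = orbitDeriv A G E p ζ :=
  h.proj_eq_self _ ⟨ζ, rfl⟩

theorem proj_proj (h : IsTube A G p ψ θ pr Q lift) (v : E) : Q (Q v) = Q v :=
  h.proj_eq_self _ (h.proj_mem v)

theorem proj_sub_proj (h : IsTube A G p ψ θ pr Q lift) (v : E) : Q (v - Q v) = 0 := by
  rw [map_sub, h.proj_proj, sub_self]

theorem lift_add (h : IsTube A G p ψ θ pr Q lift) {ζ : A} {n : E} (hζ : pr ζ = ζ) (hn : Q n = 0) :
    lift (orbitDeriv A G E p ζ + n) = ζ := by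
  have hpr : pr (lift (orbitDeriv A G E p ζ + n) - ζ) = 0 := h.pr_eq_zero <| by
    rw [map_sub, h.orbitDeriv_lift, map_add, hn, add_zero, h.proj_orbitDeriv, sub_self]
  rwa [map_sub, h.pr_lift, hζ, sub_eq_zero] at hpr

theorem lift_eq_zero (h : IsTube A G p ψ θ pr Q lift) {n : E} (hn : Q n = 0) : lift n = 0 := by
  simpa using h.lift_add (map_zero pr) hn

theorem proj_smul (h : IsTube A G p ψ θ pr Q lift) {k : G} (hk : k ∈ MulAction.stabilizer G p)
    {s : M} (hs : s ∈ ψ.source) (hQs : Q (ψ s) = 0) : Q (ψ (k • s)) = 0 := by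
  rw [h.chart.map_smul k hk s hs, h.proj_smulDeriv k hk, hQs, map_zero]

theorem symm_zero (h : IsTube A G p ψ θ pr Q lift) : ψ.symm 0 = p := by
  rw [← h.chart.map_self, ψ.left_inv h.chart.mem_source]

theorem tubeMap_zero (h : IsTube A G p ψ θ pr Q lift) : tubeMap ψ θ Q lift 0 = p := by
  simp [tubeMap, h.straightening.symm_zero, h.symm_zero]

theorem tubeMap_add (h : IsTube A G p ψ θ pr Q lift) {ζ : A} (hζ : pr ζ = ζ) {s : M}
    (hs : s ∈ ψ.source) (hQs : Q (ψ s) = 0) :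
    tubeMap ψ θ Q lift (orbitDeriv A G E p ζ + ψ s) = θ.symm ζ • s := by
  rw [tubeMap, h.lift_add hζ hQs, map_add, h.proj_orbitDeriv, hQs, add_zero, add_sub_cancel_left,
    ψ.left_inv hs]

theorem tubeMap_apply_chart (h : IsTube A G p ψ θ pr Q lift) {s : M} (hs : s ∈ ψ.source)
    (hQs : Q (ψ s) = 0) : tubeMap ψ θ Q lift (ψ s) = s := by
  simpa [h.straightening.symm_zero] using h.tubeMap_add (map_zero pr) hs hQs

theorem zero_mem_tubeDomain (h : IsTube A G p ψ θ pr Q lift) :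
    0 ∈ tubeDomain ψ θ Q lift :=
  ⟨by simpa using h.straightening.zero_mem,
    by simpa using h.chart.map_self ▸ ψ.map_source h.chart.mem_source⟩

theorem contMDiffOn_slicePart (h : IsTube A G p ψ θ pr Q lift) :
    ContMDiffOn 𝓘(ℝ, E) 𝓘(ℝ, E) ∞ (fun v => ψ.symm (v - Q v))
      ((fun v => v - Q v) ⁻¹' ψ.target) :=
  h.chart.contMDiffOn_symm.comp (contMDiff_id.sub Q.contMDiff).contMDiffOn fun _ hv => hv

theorem contMDiffOn_tubeMap (h : IsTube A G p ψ θ pr Q lift) :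
    ContMDiffOn 𝓘(ℝ, E) 𝓘(ℝ, E) ∞ (tubeMap ψ θ Q lift)
      (tubeDomain ψ θ Q lift) :=
  (h.straightening.contMDiffOn_symm.comp lift.contMDiff.contMDiffOn fun _ hv => hv.1).smul
    (I := 𝓘(ℝ, A)) (h.contMDiffOn_slicePart.mono Set.inter_subset_right)

theorem hasMFDerivAt_tubeMap_proj (h : IsTube A G p ψ θ pr Q lift) :
    HasMFDerivAt 𝓘(ℝ, E) 𝓘(ℝ, E) (tubeMap ψ θ Q lift ∘ Q) 0 Q := by
  have hθ := hasMFDerivAt_comp_of_eq (x := (0 : E)) h.straightening.hasMFDerivAt_symm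
    (lift.comp Q).hasFDerivAt.hasMFDerivAt (by simp)
  have horbit := hasMFDerivAt_comp_of_eq
    (hasMFDerivAt_orbitMap_one (A := A) (G := G) (E := E) p) hθ
    (by simp [h.straightening.symm_zero])
  refine (horbit.congr_mfderiv ?_).congr_of_eventuallyEq (Filter.Eventually.of_forall fun v => ?_)
  · exact ContinuousLinearMap.ext fun v : E => (h.orbitDeriv_lift (Q v)).trans (h.proj_proj v)
  · simp [tubeMap, h.proj_proj, h.symm_zero]

theorem hasMFDerivAt_tubeMap_sub_proj (h : IsTube A G p ψ θ pr Q lift) :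
    HasMFDerivAt 𝓘(ℝ, E) 𝓘(ℝ, E) (tubeMap ψ θ Q lift ∘ (ContinuousLinearMap.id ℝ E - Q)) 0
      (ContinuousLinearMap.id ℝ E - Q) := by
  have hψ : HasMFDerivAt 𝓘(ℝ, E) 𝓘(ℝ, E) ψ.symm (ψ p) (ContinuousLinearMap.id ℝ E) :=
    hasMFDerivAt_symm_id ⟨h.chart.contMDiffOn.mdifferentiableOn (by simp),
      h.chart.contMDiffOn_symm.mdifferentiableOn (by simp)⟩ h.chart.mem_source h.chart.hasMFDerivAt
  refine (hasMFDerivAt_comp_of_eq (x := (0 : E)) hψ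
    (ContinuousLinearMap.id ℝ E - Q).hasFDerivAt.hasMFDerivAt
    (by rw [map_zero, h.chart.map_self])).congr_of_eventuallyEq
    (Filter.Eventually.of_forall fun v => ?_)
  simp [tubeMap, h.lift_eq_zero (h.proj_sub_proj v), h.straightening.symm_zero, h.proj_proj]

theorem hasMFDerivAt_tubeMap (h : IsTube A G p ψ θ pr Q lift) :
    HasMFDerivAt 𝓘(ℝ, E) 𝓘(ℝ, E) (tubeMap ψ θ Q lift) 0 (ContinuousLinearMap.id ℝ E) := by
  obtain ⟨D, hD⟩ : ∃ D : E →L[ℝ] E, HasMFDerivAt 𝓘(ℝ, E) 𝓘(ℝ, E) (tubeMap ψ θ Q lift) 0 D :=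
    ⟨_, ((h.contMDiffOn_tubeMap.contMDiffAt
      ((isOpen_tubeDomain ψ θ Q lift).mem_nhds h.zero_mem_tubeDomain)
      ).mdifferentiableAt (by simp)).hasMFDerivAt⟩
  have hDQ : D.comp Q = Q := hasMFDerivAt_unique
    (hasMFDerivAt_comp_of_eq hD Q.hasFDerivAt.hasMFDerivAt (map_zero Q))
    h.hasMFDerivAt_tubeMap_proj
  have hDN : D.comp (ContinuousLinearMap.id ℝ E - Q) = ContinuousLinearMap.id ℝ E - Q :=
    hasMFDerivAt_unique (hasMFDerivAt_comp_of_eq hD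
      (ContinuousLinearMap.id ℝ E - Q).hasFDerivAt.hasMFDerivAt (map_zero _))
    h.hasMFDerivAt_tubeMap_sub_proj
  refine hD.congr_mfderiv ?_
  rwa [ContinuousLinearMap.comp_sub, hDQ, ContinuousLinearMap.comp_id, sub_left_inj] at hDN

theorem exists_nhds_factorization (h : IsTube A G p ψ θ pr Q lift) [IsTopologicalGroup G]
    {O : Set A} (hO : O ∈ 𝓝 (0 : A)) :
    ∃ U : Set G, IsOpen U ∧ (MulAction.stabilizer G p : Set G) ⊆ U ∧ ∀ g ∈ U,
      ∃ k ∈ MulAction.stabilizer G p, ∃ ζ ∈ O, pr ζ = ζ ∧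
        ∃ k' ∈ MulAction.stabilizer G p, g = k * (θ.symm ζ * k') := by
  have hθ := h.straightening
  obtain ⟨O', hO'O, hO', h0O'⟩ := mem_nhds_iff.1 hO
  let U₁ : Set G := θ.source ∩ θ ⁻¹' (pr ⁻¹' (θ.target ∩ O'))
  have hU₁ : IsOpen U₁ :=
    θ.isOpen_inter_preimage ((θ.open_target.inter hO').preimage pr.continuous)
  have h1U₁ : (1 : G) ∈ U₁ := ⟨hθ.mem_source, by
    simpa [hθ.map_self] using And.intro hθ.zero_mem h0O'⟩
  refine ⟨⋃ k ∈ MulAction.stabilizer G p, (fun g => k⁻¹ * g) ⁻¹' U₁,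
    isOpen_biUnion fun k _ => hU₁.preimage (by fun_prop),
    fun k hk => Set.mem_biUnion hk (by simpa using h1U₁), fun g hg => ?_⟩
  obtain ⟨k, hk, hkg, hpr, hprO⟩ : ∃ k ∈ MulAction.stabilizer G p, k⁻¹ * g ∈ U₁ := by
    simpa using hg
  have hp : θ.symm (pr (θ (k⁻¹ * g))) • p = (k⁻¹ * g) • p := by
    have hiff := (hθ.eq_iff _ hpr _ (θ.map_source hkg)).2 (hθ.idem _)
    rwa [θ.left_inv hkg] at hiff
  refine ⟨k, hk, pr (θ (k⁻¹ * g)), hO'O hprO, hθ.idem _,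
    (θ.symm (pr (θ (k⁻¹ * g))))⁻¹ * (k⁻¹ * g), ?_, by group⟩
  rw [MulAction.mem_stabilizer_iff, mul_smul, ← hp, inv_smul_smul]

variable [IsManifold 𝓘(ℝ, E) ∞ M] [FiniteDimensional ℝ E]

theorem exists_tubeChart (h : IsTube A G p ψ θ pr Q lift) :
    ∃ e : OpenPartialHomeomorph E M, 0 ∈ e.source ∧
      e.source ⊆ tubeDomain ψ θ Q lift ∧
      (∀ v ∈ e.source, e v = tubeMap ψ θ Q lift v) ∧
      ContMDiffOn 𝓘(ℝ, E) 𝓘(ℝ, E) ∞ e e.source ∧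
      ContMDiffOn 𝓘(ℝ, E) 𝓘(ℝ, E) ∞ e.symm e.target :=
  exists_openPartialHomeomorph_of_hasMFDerivAt_equiv (isOpen_tubeDomain ψ θ Q lift)
    h.zero_mem_tubeDomain
    h.contMDiffOn_tubeMap (ContinuousLinearEquiv.refl ℝ E) h.hasMFDerivAt_tubeMap

theorem exists_nhds_eq_zero_of_smul_eq (h : IsTube A G p ψ θ pr Q lift) :
    ∃ O ∈ 𝓝 (0 : A), ∃ W ∈ 𝓝 p, ∀ ζ ∈ O, pr ζ = ζ → ∀ s ∈ W ∩ ψ.source, Q (ψ s) = 0 →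
      θ.symm ζ • s ∈ W ∩ ψ.source → Q (ψ (θ.symm ζ • s)) = 0 → ζ = 0 := by
  obtain ⟨e, h0e, -, heq, -, -⟩ := h.exists_tubeChart
  have hcont : ContinuousAt (fun z : A × M => orbitDeriv A G E p z.1 + ψ z.2) (0, p) :=
    ((orbitDeriv A G E p).continuous.continuousAt.comp continuousAt_fst).add
      (ContinuousAt.comp (g := ψ) (x := ((0 : A), p)) (ψ.continuousAt h.chart.mem_source)
        continuousAt_snd)
  obtain ⟨O, hO, W, hW, hOW⟩ := mem_nhds_prod_iff.1 (hcont.preimage_mem_nhds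
    (e.open_source.mem_nhds (by simpa [h.chart.map_self] using h0e)))
  refine ⟨O, hO, W, hW, fun ζ hζ hprζ s hs hQs hs' hQs' => ?_⟩
  have hζs : orbitDeriv A G E p ζ + ψ s ∈ e.source := hOW (Set.mk_mem_prod hζ hs.1)
  have hs'e : ψ (θ.symm ζ • s) ∈ e.source := by
    simpa using hOW (Set.mk_mem_prod (mem_of_mem_nhds hO) hs'.1)
  have hsum : orbitDeriv A G E p ζ + ψ s = ψ (θ.symm ζ • s) := e.injOn hζs hs'e <| by
    rw [heq _ hζs, heq _ hs'e, h.tubeMap_add hprζ hs.2 hQs, h.tubeMap_apply_chart hs'.2 hQs']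
  have hQsum := congrArg Q hsum
  rw [map_add, h.proj_orbitDeriv, hQs, hQs', add_zero] at hQsum
  rw [← hprζ, h.pr_eq_zero hQsum]

theorem exists_isOpen_mem_stabilizer [LieGroup 𝓘(ℝ, A) ∞ G] [ProperSMul G M]
    (h : IsTube A G p ψ θ pr Q lift) :
    ∃ W ⊆ ψ.source, IsOpen W ∧ p ∈ W ∧ ∀ s ∈ W, Q (ψ s) = 0 → ∀ g : G, g • s ∈ W →
      Q (ψ (g • s)) = 0 → g ∈ MulAction.stabilizer G p := by
  have := topologicalGroup_of_lieGroup (G := G) 𝓘(ℝ, A) ∞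
  obtain ⟨O, hO, W₁, hW₁, hinj⟩ := h.exists_nhds_eq_zero_of_smul_eq
  obtain ⟨U, hU, hHU, hfactor⟩ := h.exists_nhds_factorization hO
  obtain ⟨W₂, hW₂sub, hW₂, hpW₂, hW₂H⟩ := exists_isOpen_invariant
    (isCompact_stabilizer (G := G) p) (isOpen_interior.inter ψ.open_source) (p := p) (fun k hk => by
      rw [MulAction.mem_stabilizer_iff.1 hk]
      exact ⟨mem_interior_iff_mem_nhds.2 hW₁, h.chart.mem_source⟩)
  replace hW₂sub : W₂ ⊆ W₁ ∩ ψ.source := fun x hx =>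
    ⟨interior_subset (hW₂sub hx).1, (hW₂sub hx).2⟩
  obtain ⟨W₃, hW₃, hpW₃, hW₃U⟩ := exists_nhds_of_stabilizer_subset hU hHU
  refine ⟨W₂ ∩ W₃, fun x hx => (hW₂sub hx.1).2, hW₂.inter hW₃, ⟨hpW₂, hpW₃⟩,
    fun s hs hQs g hgs hQgs => ?_⟩
  obtain ⟨k, hk, ζ, hζ, hprζ, k', hk', rfl⟩ := hfactor g (hW₃U g s hs.2 hgs.2)
  have hkgs : k⁻¹ • (k * (θ.symm ζ * k')) • s = θ.symm ζ • k' • s := by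
    rw [smul_smul, inv_mul_cancel_left, mul_smul]
  have hζ0 : ζ = 0 := hinj ζ hζ hprζ (k' • s) (hW₂sub (hW₂H k' hk' s hs.1))
    (h.proj_smul hk' (hW₂sub hs.1).2 hQs)
    (hkgs ▸ hW₂sub (hW₂H k⁻¹ (inv_mem hk) _ hgs.1))
    (hkgs ▸ h.proj_smul (inv_mem hk) (hW₂sub hgs.1).2 hQgs)
  rw [hζ0, h.straightening.symm_zero, one_mul]
  exact mul_mem hk hk'

end IsTube

variable [FiniteDimensional ℝ A] [LieGroup 𝓘(ℝ, A) ∞ G] [FiniteDimensional ℝ E]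
  [IsManifold 𝓘(ℝ, E) ∞ M]

variable (A G E) in
theorem exists_isTube [ContinuousSMul G M] {p : M}
    (hc : IsCompact (MulAction.stabilizer G p : Set G)) :
    ∃ (ψ : OpenPartialHomeomorph M E) (θ : OpenPartialHomeomorph G A) (pr : A →L[ℝ] A)
      (Q : E →L[ℝ] E) (lift : E →L[ℝ] A), IsTube A G p ψ θ pr Q lift := by
  have := topologicalGroup_of_lieGroup (G := G) 𝓘(ℝ, A) ∞
  obtain ⟨ψ, hψ⟩ := exists_isLinearizingChart A E hc
  obtain ⟨θ, pr, hθ⟩ := exists_isStraightening_orbitMap A G E p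
  obtain ⟨Q, hmem, hself, hcomm⟩ := exists_vertical_projection (A := A) (E := E) hc
  obtain ⟨l, hl, -⟩ := exists_reflexive_inverse (orbitDeriv A G E p)
  have hpr : ∀ ζ, orbitDeriv A G E p (pr ζ) = orbitDeriv A G E p ζ := fun ζ => by
    have hker : pr ζ - ζ ∈ pr.ker := by simp [hθ.idem]
    rw [← sub_eq_zero, ← map_sub]
    exact hθ.ker_eq.le hker
  refine ⟨ψ, θ, pr, Q, pr.comp (l.comp Q), hψ, hθ, hmem, hself, hcomm, fun v => ?_,
    fun v => hθ.idem _⟩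
  obtain ⟨ξ, hξ⟩ := hmem v
  change orbitDeriv A G E p (pr (l (Q v))) = Q v
  rw [hpr, ← hξ]
  exact hl ξ

variable (A E) in
/-- A slice at `p`: coordinates `Ψ` near `p` in which a point with coordinate `v` is moved, by some
element of the group, to a point of a transversal `S` whose coordinate agrees with `v` up to a
vector tangent to the orbit; elements mapping `S` to `S` lie in the isotropy group of `p`, which
acts linearly on `S`. -/
structure IsSliceChart (p : M) (Ψ : OpenPartialHomeomorph M E) (S : Set M) (y : M → E) : Prop where
  mem_source : p ∈ Ψ.source
  map_self : Ψ p = 0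
  contMDiffOn : ContMDiffOn 𝓘(ℝ, E) 𝓘(ℝ, E) ∞ Ψ Ψ.source
  contMDiffOn_symm : ContMDiffOn 𝓘(ℝ, E) 𝓘(ℝ, E) ∞ Ψ.symm Ψ.target
  hasMFDerivAt : HasMFDerivAt 𝓘(ℝ, E) 𝓘(ℝ, E) Ψ p (ContinuousLinearMap.id ℝ E)
  exists_smul : ∀ x ∈ Ψ.source, ∃ g : G, g • x ∈ S ∧ Ψ x - y (g • x) ∈ (orbitDeriv A G E p).range
  mem_stabilizer : ∀ s ∈ S, ∀ g : G, g • s ∈ S → g ∈ MulAction.stabilizer G p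
  map_smul : ∀ h ∈ MulAction.stabilizer G p, ∀ s ∈ S, y (h • s) = smulDeriv A E h p (y s)
  smul_eq_of_map_eq : ∀ h ∈ MulAction.stabilizer G p, ∀ s ∈ S, y (h • s) = y s → h • s = s
  disjoint : ∀ h ∈ MulAction.stabilizer G p, ∀ s ∈ S,
    smulDeriv A E h p (y s) - y s ∈ (orbitDeriv A G E p).range → smulDeriv A E h p (y s) = y s

variable (A E) in
theorem exists_isSliceChart [ProperSMul G M] (p : M) :
    ∃ (Ψ : OpenPartialHomeomorph M E) (S : Set M) (y : M → E),
      IsSliceChart A (G := G) E p Ψ S y := by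
  obtain ⟨ψ, θ, pr, Q, lift, h⟩ := exists_isTube A G E (isCompact_stabilizer (G := G) p)
  obtain ⟨W, hWψ, hW, hpW, hstab⟩ := h.exists_isOpen_mem_stabilizer
  obtain ⟨e₀, h0e₀, -, he₀, he₀s, he₀s'⟩ := h.exists_tubeChart
  have hB := ContinuousOn.isOpen_inter_preimage
    (h.contMDiffOn_slicePart.continuousOn.mono Set.inter_subset_right)
    (isOpen_tubeDomain ψ θ Q lift) hW
  let e := e₀.restrOpen _ hB
  have h0e : (0 : E) ∈ e.source := ⟨h0e₀, h.zero_mem_tubeDomain, by simpa [h.symm_zero] using hpW⟩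
  have he : ∀ v ∈ e.source, e v = tubeMap ψ θ Q lift v := fun v hv => he₀ v hv.1
  have he0 : e 0 = p := (he 0 h0e).trans h.tubeMap_zero
  have hs : ContMDiffOn 𝓘(ℝ, E) 𝓘(ℝ, E) ∞ e e.source := he₀s.mono Set.inter_subset_left
  have hs' : ContMDiffOn 𝓘(ℝ, E) 𝓘(ℝ, E) ∞ e.symm e.target := he₀s'.mono Set.inter_subset_left
  have hde : HasMFDerivAt 𝓘(ℝ, E) 𝓘(ℝ, E) e 0 (ContinuousLinearMap.id ℝ E) :=
    h.hasMFDerivAt_tubeMap.congr_of_eventuallyEq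
      (Filter.eventuallyEq_of_mem (e.open_source.mem_nhds h0e) he)
  refine ⟨e.symm, {s ∈ W | Q (ψ s) = 0}, ψ, he0 ▸ e.map_source h0e, he0 ▸ e.left_inv h0e, hs', hs,
    he0 ▸ hasMFDerivAt_symm_id ⟨hs.mdifferentiableOn (by simp), hs'.mdifferentiableOn (by simp)⟩
      h0e hde, fun x hx => ?_, fun s hs g hg => hstab s hs.1 hs.2 g hg.1 hg.2,
    fun k hk s hs => h.chart.map_smul k hk s (hWψ hs.1), fun k hk s hs heq => ?_,
    fun k hk s hs hrange => ?_⟩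
  · let v := e.symm x
    have hv : v ∈ e.source := e.map_target hx
    have hxv : x = tubeMap ψ θ Q lift v := by rw [← he v hv, e.right_inv hx]
    have hψv : ψ (ψ.symm (v - Q v)) = v - Q v := ψ.right_inv hv.2.1.2
    refine ⟨(θ.symm (lift v))⁻¹, ?_⟩
    change _ ∧ v - _ ∈ _
    rw [hxv, tubeMap, inv_smul_smul, hψv, sub_sub_cancel]
    exact ⟨⟨hv.2.2, by rw [hψv, h.proj_sub_proj]⟩, h.proj_mem v⟩
  · exact ψ.injOn (h.chart.smul_mem_source k hk s (hWψ hs.1)) (hWψ hs.1) heq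
  · have hfix := h.proj_eq_self _ hrange
    rw [map_sub, h.proj_smulDeriv k hk, hs.2, map_zero, sub_zero] at hfix
    exact sub_eq_zero.1 hfix.symm

end Slice

theorem mem_of_hasMFDerivAt_of_eventually_mem {F E : Type*} [NormedAddCommGroup F]
    [NormedSpace ℝ F] [NormedAddCommGroup E] [NormedSpace ℝ E] [FiniteDimensional ℝ E]
    {N : Type*} [TopologicalSpace N] [ChartedSpace F N] {f : N → E} {x : N} {D : F →L[ℝ] E}
    (hf : HasMFDerivAt 𝓘(ℝ, F) 𝓘(ℝ, E) f x D) {S : Submodule ℝ E} (hS : ∀ᶠ z in 𝓝 x, f z ∈ S)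
    (v : F) : D v ∈ S := by
  by_contra hv
  obtain ⟨a, hav, haS⟩ := Submodule.exists_le_ker_of_notMem hv
  let a' : E →L[ℝ] ℝ := LinearMap.toContinuousLinearMap a
  have haD := hasMFDerivAt_comp_of_eq a'.hasFDerivAt.hasMFDerivAt hf rfl
  have hzero : HasMFDerivAt 𝓘(ℝ, F) 𝓘(ℝ, ℝ) (fun z => a' (f z)) x (0 : F →L[ℝ] ℝ) :=
    (hasMFDerivAt_const (0 : ℝ) x).congr_of_eventuallyEq (hS.mono fun z hz => haS hz)
  exact hav (DFunLike.congr_fun (hasMFDerivAt_unique haD hzero) v)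

section SubspaceCharts

variable {E : Type*} [NormedAddCommGroup E] [NormedSpace ℝ E]
  {F : Type*} [NormedAddCommGroup F] [NormedSpace ℝ F] [FiniteDimensional ℝ F]
  {H : Type*} [NormedAddCommGroup H] [NormedSpace ℝ H]
  {M : Type*} [TopologicalSpace M] [ChartedSpace H M]

theorem hasMFDerivAt_transition_mem {X : Set M} {x : M} (hxX : x ∈ X)
    {φ : OpenPartialHomeomorph M E} {φ' : OpenPartialHomeomorph M F} (hx : x ∈ φ.source)
    (hx' : x ∈ φ'.source) {T : Submodule ℝ E} {T' : Submodule ℝ F}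
    (hφ : ∀ z ∈ φ.source, z ∈ X ↔ φ z ∈ T) (hφ' : ∀ z ∈ φ'.source, z ∈ X ↔ φ' z ∈ T')
    {D : E →L[ℝ] H} {D' : H →L[ℝ] F} (hD : HasMFDerivAt 𝓘(ℝ, E) 𝓘(ℝ, H) φ.symm (φ x) D)
    (hD' : HasMFDerivAt 𝓘(ℝ, H) 𝓘(ℝ, F) φ' x D') {w : E} (hw : w ∈ T) : D' (D w) ∈ T' := by
  have hline : HasFDerivAt (fun t : ℝ => φ x + t • w)
      ((ContinuousLinearMap.id ℝ ℝ).smulRight w) 0 :=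
    ((ContinuousLinearMap.id ℝ ℝ).smulRight w).hasFDerivAt.const_add _
  have hcurve := hasMFDerivAt_comp_of_eq hD hline.hasMFDerivAt (by simp)
  have hmem : ∀ᶠ t in 𝓝 (0 : ℝ), φ' (φ.symm (φ x + t • w)) ∈ T' := by
    have htarget : ∀ᶠ t in 𝓝 (0 : ℝ), φ x + t • w ∈ φ.target :=
      hline.continuousAt.eventually_mem (φ.open_target.mem_nhds (by simpa using φ.map_source hx))
    have hsource : ∀ᶠ t in 𝓝 (0 : ℝ), φ.symm (φ x + t • w) ∈ φ'.source :=
      hcurve.continuousAt.eventually_mem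
        (φ'.open_source.mem_nhds (by simpa [φ.left_inv hx] using hx'))
    filter_upwards [htarget, hsource] with t ht ht'
    refine (hφ' _ ht').1 ((hφ _ (φ.map_target ht)).2 ?_)
    rw [φ.right_inv ht]
    exact T.add_mem ((hφ x hx).1 hxX) (T.smul_mem _ hw)
  have hone : D' (D ((1 : ℝ) • w)) ∈ T' := mem_of_hasMFDerivAt_of_eventually_mem
    (hasMFDerivAt_comp_of_eq hD' hcurve (by simpa using φ.left_inv hx)) hmem 1
  rwa [one_smul] at hone

end SubspaceCharts

section SliceCharts

theorem exists_forall_eq_apply_smul {G M R : Type*} [Group G] [MulAction G M]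
    {s : Set M} {φ : M → R}
    (hφ : ∀ (g : G), ∀ x ∈ s, g • x ∈ s → φ (g • x) = φ x) :
    ∃ f : M → R, ∀ (g : G) (x : M), g • x ∈ s → f x = φ (g • x) := by
  classical
  refine ⟨fun x => if h : ∃ g : G, g • x ∈ s then φ (h.choose • x) else φ x, fun g x hx => ?_⟩
  have hex : ∃ g : G, g • x ∈ s := ⟨g, hx⟩
  have hchoose : hex.choose • x = (hex.choose * g⁻¹) • g • x := by simp [mul_smul]
  simp only [dif_pos hex]
  rw [hchoose]
  exact hφ _ _ hx (hchoose ▸ hex.choose_spec)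

variable {A : Type*} [NormedAddCommGroup A] [NormedSpace ℝ A]
  {G : Type*} [TopologicalSpace G] [ChartedSpace A G] [Group G]
  {E : Type*} [NormedAddCommGroup E] [NormedSpace ℝ E]
  {M : Type*} [TopologicalSpace M] [ChartedSpace E M] [MulAction G M]
  [ContMDiffSMul 𝓘(ℝ, A) 𝓘(ℝ, E) ∞ G M]
  {p : M} {Ψ : OpenPartialHomeomorph M E} {S : Set M} {y : M → E}

namespace IsSliceChart

theorem mdifferentiable (hΨ : IsSliceChart A (G := G) E p Ψ S y) :
    Ψ.MDifferentiable 𝓘(ℝ, E) 𝓘(ℝ, E) :=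
  ⟨hΨ.contMDiffOn.mdifferentiableOn (by simp), hΨ.contMDiffOn_symm.mdifferentiableOn (by simp)⟩

theorem mem_fixedModVertical_iff (hΨ : IsSliceChart A (G := G) E p Ψ S y) {s : M} (hs : s ∈ S) :
    y s ∈ fixedModVertical A G E p ↔
      MulAction.stabilizer G p ≤ MulAction.stabilizer G s := by
  refine ⟨fun hy k hk => hΨ.smul_eq_of_map_eq k hk s hs ?_, fun hle k hk => ?_⟩
  · rw [hΨ.map_smul k hk s hs]
    exact hΨ.disjoint k hk s hs (hy k hk)
  · rw [← hΨ.map_smul k hk s hs, MulAction.mem_stabilizer_iff.1 (hle hk), sub_self]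
    exact Submodule.zero_mem _

theorem stabilizer_le (hΨ : IsSliceChart A (G := G) E p Ψ S y) {s : M} (hs : s ∈ S) :
    MulAction.stabilizer G s ≤ MulAction.stabilizer G p := fun k hk =>
  hΨ.mem_stabilizer s hs k (by rwa [MulAction.mem_stabilizer_iff.1 hk])

theorem apply_map_smul (hΨ : IsSliceChart A (G := G) E p Ψ S y) {a : E →L[ℝ] ℝ}
    (ha : ∀ v ∈ (orbitDeriv A G E p).range, a v = 0)
    (haH : ∀ h ∈ MulAction.stabilizer G p, ∀ v, a (smulDeriv A E h p v) = a v) {g : G} {x : M}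
    (hx : x ∈ Ψ.source) (hgx : g • x ∈ Ψ.source) : a (Ψ (g • x)) = a (Ψ x) := by
  obtain ⟨g₁, hS₁, hrange₁⟩ := hΨ.exists_smul x hx
  obtain ⟨g₂, hS₂, hrange₂⟩ := hΨ.exists_smul _ hgx
  have ha₁ := ha _ hrange₁
  have ha₂ := ha _ hrange₂
  rw [map_sub, sub_eq_zero] at ha₁ ha₂
  have hsmul : g₂ • g • x = (g₂ * g * g₁⁻¹) • g₁ • x := by simp [mul_smul]
  rw [hsmul] at ha₂ hS₂
  have hstab := hΨ.mem_stabilizer _ hS₁ _ hS₂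
  rw [ha₂, hΨ.map_smul _ hstab _ hS₁, haH _ hstab, ha₁]

theorem exists_invariant_function (hΨ : IsSliceChart A (G := G) E p Ψ S y)
    {a : E →L[ℝ] ℝ} (ha : ∀ v ∈ (orbitDeriv A G E p).range, a v = 0)
    (haH : ∀ h ∈ MulAction.stabilizer G p, ∀ v, a (smulDeriv A E h p v) = a v) :
    ∃ (U : Set M) (f : M → ℝ), IsOpen U ∧ p ∈ U ∧ (∀ (g : G), ∀ x ∈ U, g • x ∈ U) ∧
      ContMDiffOn 𝓘(ℝ, E) 𝓘(ℝ, ℝ) ∞ f U ∧ (∀ (g : G), ∀ x ∈ U, f (g • x) = f x) ∧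
      HasMFDerivAt 𝓘(ℝ, E) 𝓘(ℝ, ℝ) f p a := by
  obtain ⟨f, hf⟩ := exists_forall_eq_apply_smul (s := Ψ.source) (φ := a ∘ Ψ)
    fun g x hx hgx => hΨ.apply_map_smul ha haH hx hgx
  have hcont : ∀ g : G, Continuous fun x : M => g • x := fun g =>
    (ContMDiffSMul.contMDiff_const_smul (I := 𝓘(ℝ, A)) (I' := 𝓘(ℝ, E)) (n := ∞) g).continuous
  refine ⟨{x | ∃ g : G, g • x ∈ Ψ.source}, f, ?_, ⟨1, by simpa using hΨ.mem_source⟩, ?_, ?_, ?_, ?_⟩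
  · rw [Set.ofPred_exists]
    exact isOpen_iUnion fun g => Ψ.open_source.preimage (hcont g)
  · rintro g x ⟨k, hk⟩
    exact ⟨k * g⁻¹, by simpa [mul_smul] using hk⟩
  · rintro x ⟨g, hg⟩
    have hsmooth : ContMDiffAt 𝓘(ℝ, E) 𝓘(ℝ, ℝ) ∞ (fun z => a (Ψ (g • z))) x :=
      a.contMDiff.contMDiffAt.comp x (ContMDiffAt.comp x
        (hΨ.contMDiffOn.contMDiffAt (Ψ.open_source.mem_nhds hg))
        (ContMDiffSMul.contMDiff_const_smul (I := 𝓘(ℝ, A)) g x))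
    refine (hsmooth.congr_of_eventuallyEq ?_).contMDiffWithinAt
    filter_upwards [(Ψ.open_source.preimage (hcont g)).mem_nhds hg] with z hz using hf g z hz
  · rintro g x ⟨k, hk⟩
    have hsmul : (k * g⁻¹) • g • x = k • x := by simp [mul_smul]
    rw [hf k x hk, hf (k * g⁻¹) (g • x) (by rwa [hsmul]), hsmul]
  · refine HasMFDerivAt.congr_of_eventuallyEq (f := a ∘ Ψ)
      (hasMFDerivAt_comp_of_eq a.hasFDerivAt.hasMFDerivAt hΨ.hasMFDerivAt rfl) ?_
    filter_upwards [Ψ.open_source.mem_nhds hΨ.mem_source] with z hz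
    simpa using hf 1 z (by simpa using hz)

end IsSliceChart

variable [FiniteDimensional ℝ A] [LieGroup 𝓘(ℝ, A) ∞ G] [FiniteDimensional ℝ E]
  [IsManifold 𝓘(ℝ, E) ∞ M] [ProperSMul G M]

variable (A E) in
theorem exists_invariant_function {a : E →L[ℝ] ℝ} (ha : ∀ v ∈ (orbitDeriv A G E p).range, a v = 0)
    (haH : ∀ h ∈ MulAction.stabilizer G p, ∀ v, a (smulDeriv A E h p v) = a v) :
    ∃ (U : Set M) (f : M → ℝ), IsOpen U ∧ p ∈ U ∧ (∀ (g : G), ∀ x ∈ U, g • x ∈ U) ∧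
      ContMDiffOn 𝓘(ℝ, E) 𝓘(ℝ, ℝ) ∞ f U ∧ (∀ (g : G), ∀ x ∈ U, f (g • x) = f x) ∧
      HasMFDerivAt 𝓘(ℝ, E) 𝓘(ℝ, ℝ) f p a := by
  obtain ⟨Ψ, S, y, hΨ⟩ := exists_isSliceChart A (G := G) E p
  exact hΨ.exists_invariant_function ha haH

namespace IsSliceChart

theorem mem_orbitTypeSet_iff_of_mem (hΨ : IsSliceChart A (G := G) E p Ψ S y) {K : Subgroup G}
    (hp : p ∈ orbitTypeSet M K) {s : M} (hs : s ∈ S) :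
    s ∈ orbitTypeSet M K ↔ MulAction.stabilizer G p ≤ MulAction.stabilizer G s := by
  obtain ⟨a, ha⟩ := hp
  refine ⟨fun ⟨b, hb⟩ => ?_, fun hle => ⟨a, (le_antisymm (hΨ.stabilizer_le hs) hle).trans ha⟩⟩
  refine (stabilizer_eq_of_le_of_conj A E (k := b * a⁻¹) ?_ (hΨ.stabilizer_le hs)).ge
  rw [hb, ha, Subgroup.map_map]
  congr 1
  ext x
  simp [mul_assoc]

theorem mem_orbitTypeSet_iff (hΨ : IsSliceChart A (G := G) E p Ψ S y) {K : Subgroup G}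
    (hp : p ∈ orbitTypeSet M K) {x : M} (hx : x ∈ Ψ.source) :
    x ∈ orbitTypeSet M K ↔ Ψ x ∈ fixedModVertical A G E p := by
  obtain ⟨g, hgS, hg⟩ := hΨ.exists_smul x hx
  have hsmul : x ∈ orbitTypeSet M K ↔ g • x ∈ orbitTypeSet M K :=
    ⟨smul_mem_orbitTypeSet K g, fun hgx => by simpa using smul_mem_orbitTypeSet K g⁻¹ hgx⟩
  rw [hsmul, hΨ.mem_orbitTypeSet_iff_of_mem hp hgS, ← hΨ.mem_fixedModVertical_iff hgS]
  simpa using (Submodule.add_mem_iff_right _ (y := y (g • x))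
    (range_orbitDeriv_le_fixedModVertical p hg)).symm

theorem exists_map_fixedModVertical (hΨ : IsSliceChart A (G := G) E p Ψ S y) {K : Subgroup G}
    (hp : p ∈ orbitTypeSet M K) {x : M} (hx : x ∈ Ψ.source) (hxK : x ∈ orbitTypeSet M K) :
    ∃ D : E ≃L[ℝ] E, HasMFDerivAt 𝓘(ℝ, E) 𝓘(ℝ, E) Ψ x (D : E →L[ℝ] E) ∧
      HasMFDerivAt 𝓘(ℝ, E) 𝓘(ℝ, E) Ψ.symm (Ψ x) (D.symm : E →L[ℝ] E) ∧
      ∀ v, v ∈ fixedModVertical A G E x ↔ D v ∈ fixedModVertical A G E p := by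
  obtain ⟨D, hD, hD'⟩ := exists_hasMFDerivAt_equiv hΨ.mdifferentiable hx
  obtain ⟨Ψ', S', y', hΨ'⟩ := exists_isSliceChart A (G := G) E x
  have hΨx := hasMFDerivAt_symm_id hΨ'.mdifferentiable hΨ'.mem_source hΨ'.hasMFDerivAt
  refine ⟨D, hD, hD', fun v => ⟨fun hv => ?_, fun hv => ?_⟩⟩
  · exact hasMFDerivAt_transition_mem hxK hΨ'.mem_source hx
      (fun z hz => hΨ'.mem_orbitTypeSet_iff hxK hz) (fun z hz => hΨ.mem_orbitTypeSet_iff hp hz)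
      hΨx hD hv
  · simpa using hasMFDerivAt_transition_mem hxK hx hΨ'.mem_source
      (fun z hz => hΨ.mem_orbitTypeSet_iff hp hz) (fun z hz => hΨ'.mem_orbitTypeSet_iff hxK hz)
      hD' hΨ'.hasMFDerivAt hv

theorem finrank_fixedModVertical_eq (hΨ : IsSliceChart A (G := G) E p Ψ S y) {K : Subgroup G}
    (hp : p ∈ orbitTypeSet M K) {x : M} (hx : x ∈ Ψ.source) (hxK : x ∈ orbitTypeSet M K) :
    Module.finrank ℝ (fixedModVertical A G E x) =
      Module.finrank ℝ (fixedModVertical A G E p) := by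
  obtain ⟨D, -, -, hD⟩ := hΨ.exists_map_fixedModVertical hp hx hxK
  refine LinearEquiv.finrank_eq (LinearEquiv.ofSubmodules D.toLinearEquiv _ _ ?_)
  ext v
  refine ⟨?_, fun hv => ⟨D.symm v, (hD _).2 (by simpa using hv), by simp⟩⟩
  rintro ⟨w, hw, rfl⟩
  exact (hD w).1 hw

end IsSliceChart

end SliceCharts

theorem exists_equiv_prod_of_submodule {F F' E : Type*} [NormedAddCommGroup F]
    [NormedSpace ℝ F] [FiniteDimensional ℝ F] [NormedAddCommGroup F'] [NormedSpace ℝ F']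
    [FiniteDimensional ℝ F'] [NormedAddCommGroup E] [NormedSpace ℝ E] [FiniteDimensional ℝ E]
    (T : Submodule ℝ E) (hF : Module.finrank ℝ T = Module.finrank ℝ F)
    (hF' : Module.finrank ℝ F + Module.finrank ℝ F' = Module.finrank ℝ E) :
    ∃ e : (F × F') ≃L[ℝ] E, ∀ v, v ∈ T ↔ e ((e.symm v).1, 0) = v := by
  obtain ⟨T', hT'⟩ := T.exists_isCompl
  have hcompl := Submodule.finrank_add_eq_of_isCompl hT'
  let e₁ : F ≃ₗ[ℝ] T := LinearEquiv.ofFinrankEq _ _ hF.symm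
  let e₂ : F' ≃ₗ[ℝ] T' := LinearEquiv.ofFinrankEq _ _ (by omega)
  let e := ((e₁.prodCongr e₂).trans (Submodule.prodEquivOfIsCompl T T' hT')).toContinuousLinearEquiv
  have he : ∀ u w, e (u, w) = (e₁ u : E) + (e₂ w : E) := fun u w => rfl
  refine ⟨e, fun v => ⟨fun hv => ?_, fun hv => ?_⟩⟩
  · have hsymm : e (e₁.symm ⟨v, hv⟩, 0) = v := by simp [he]
    nth_rewrite 1 [← hsymm]
    rw [e.symm_apply_apply, hsymm]
  · rw [← hv, he]
    simp

section Submanifold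

variable {E : Type*} [NormedAddCommGroup E] [NormedSpace ℝ E] {M : Type*} [TopologicalSpace M]
  {F F' : Type*} [NormedAddCommGroup F] [NormedSpace ℝ F] [NormedAddCommGroup F']
  [NormedSpace ℝ F'] {N : Type*} {ι : N → M}
  {Ψ Ψ' : OpenPartialHomeomorph M E} {e e' : (F × F') ≃L[ℝ] E}

/-- In the chart `Ψ` of `M`, read through the linear coordinates `e`, the image of `ι` is the
coordinate subspace `F × 0`. -/
def StraightensRange (ι : N → M) (Ψ : OpenPartialHomeomorph M E) (e : (F × F') ≃L[ℝ] E) : Prop :=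
  ∀ x ∈ Ψ.source, x ∈ Set.range ι ↔ e ((e.symm (Ψ x)).1, 0) = Ψ x

namespace StraightensRange

theorem apply_map (h : StraightensRange ι Ψ e) {q : N} (hq : ι q ∈ Ψ.source) :
    e ((e.symm (Ψ (ι q))).1, 0) = Ψ (ι q) :=
  (h _ hq).1 ⟨q, rfl⟩

theorem apply_map_mem_target (h : StraightensRange ι Ψ e) {q : N} (hq : ι q ∈ Ψ.source) :
    e ((e.symm (Ψ (ι q))).1, 0) ∈ Ψ.target := by
  rw [h.apply_map hq]
  exact Ψ.map_source hq

theorem map_invFun [Nonempty N] (h : StraightensRange ι Ψ e) {u : F} (hu : e (u, 0) ∈ Ψ.target) :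
    ι (Function.invFun ι (Ψ.symm (e (u, 0)))) = Ψ.symm (e (u, 0)) :=
  Function.invFun_eq ((h _ (Ψ.map_target hu)).2 (by rw [Ψ.right_inv hu]; simp))

variable [TopologicalSpace N]

/-- The chart `q ↦ (e⁻¹ (Ψ (ι q))).1` of `N` induced by a chart of `M` straightening the image of
`ι`. -/
noncomputable def inducedChart [Nonempty N] (h : StraightensRange ι Ψ e) (hι : IsEmbedding ι) :
    OpenPartialHomeomorph N F where
  toFun q := (e.symm (Ψ (ι q))).1
  invFun u := Function.invFun ι (Ψ.symm (e (u, 0)))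
  source := ι ⁻¹' Ψ.source
  target := (fun u : F => e (u, 0)) ⁻¹' Ψ.target
  map_source' _ hq := h.apply_map_mem_target hq
  map_target' u hu := by
    rw [Set.mem_preimage, h.map_invFun hu]
    exact Ψ.map_target hu
  left_inv' q hq := hι.injective <| by
    rw [h.map_invFun (h.apply_map_mem_target hq), h.apply_map hq, Ψ.left_inv hq]
  right_inv' u hu := by
    rw [h.map_invFun hu, Ψ.right_inv hu]
    simp
  open_source := Ψ.open_source.preimage hι.continuous
  open_target := Ψ.open_target.preimage (by fun_prop)
  continuousOn_toFun := (continuous_fst.comp e.symm.continuous).comp_continuousOn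
    (Ψ.continuousOn.comp hι.continuous.continuousOn fun _ hq => hq)
  continuousOn_invFun := by
    rw [hι.isInducing.continuousOn_iff]
    exact (Ψ.continuousOn_symm.comp (f := fun u : F => e (u, 0)) (by fun_prop)
      fun _ hu => hu).congr fun _ hu => h.map_invFun hu

theorem map_inducedChart_symm [Nonempty N] (h : StraightensRange ι Ψ e) (hι : IsEmbedding ι)
    {u : F} (hu : u ∈ (h.inducedChart hι).target) :
    ι ((h.inducedChart hι).symm u) = Ψ.symm (e (u, 0)) :=
  h.map_invFun hu

variable [ChartedSpace E M]

theorem contDiffOn_inducedChart_comp_symm [Nonempty N] (h : StraightensRange ι Ψ e)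
    (h' : StraightensRange ι Ψ' e') (hι : IsEmbedding ι)
    (hsymm : ContMDiffOn 𝓘(ℝ, E) 𝓘(ℝ, E) ∞ Ψ.symm Ψ.target)
    (hΨ' : ContMDiffOn 𝓘(ℝ, E) 𝓘(ℝ, E) ∞ Ψ' Ψ'.source) :
    ContDiffOn ℝ ∞ (h'.inducedChart hι ∘ (h.inducedChart hι).symm)
      ((h.inducedChart hι).target ∩
        (h.inducedChart hι).symm ⁻¹' (h'.inducedChart hι).source) := by
  rw [← contMDiffOn_iff_contDiffOn]
  have hincl : ContMDiff 𝓘(ℝ, F) 𝓘(ℝ, E) ∞ (fun u : F => e (u, 0)) :=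
    (e.contDiff.comp (contDiff_id.prodMk contDiff_const)).contMDiff
  have hproj : ContMDiff 𝓘(ℝ, E) 𝓘(ℝ, F) ∞ (fun v : E => (e'.symm v).1) :=
    (contDiff_fst.comp e'.symm.contDiff).contMDiff
  refine ((hproj.contMDiffOn (s := Set.univ)).comp (hΨ'.comp (hsymm.comp hincl.contMDiffOn
    fun u hu => hu.1) fun u hu => ?_) (Set.mapsTo_univ _ _)).congr fun u hu => ?_
  · rw [Set.mem_preimage, Function.comp_apply, ← h.map_inducedChart_symm hι hu.1]
    exact hu.2
  · exact congrArg (fun x => (e'.symm (Ψ' x)).1) (h.map_inducedChart_symm hι hu.1)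

end StraightensRange

variable [TopologicalSpace N] [ChartedSpace E M] [IsManifold 𝓘(ℝ, E) ∞ M]

theorem exists_chartedSpace_of_straightensRange (hι : IsEmbedding ι)
    (h : ∀ q : N, ∃ (Ψ : OpenPartialHomeomorph M E) (e : (F × F') ≃L[ℝ] E), ι q ∈ Ψ.source ∧
      ContMDiffOn 𝓘(ℝ, E) 𝓘(ℝ, E) ∞ Ψ Ψ.source ∧
      ContMDiffOn 𝓘(ℝ, E) 𝓘(ℝ, E) ∞ Ψ.symm Ψ.target ∧ StraightensRange ι Ψ e) :
    ∃ _ : ChartedSpace F N, IsManifold 𝓘(ℝ, F) ∞ N ∧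
      IsSmoothEmbedding 𝓘(ℝ, F) 𝓘(ℝ, E) ∞ ι := by
  choose Ψ e hmem hΨ hΨsymm hstr using h
  let φ (q : N) : OpenPartialHomeomorph N F :=
    have : Nonempty N := ⟨q⟩
    (hstr q).inducedChart hι
  let _ : ChartedSpace F N :=
    { atlas := Set.range φ
      chartAt := φ
      mem_chart_source := hmem
      chart_mem_atlas := fun q => ⟨q, rfl⟩ }
  have hN : IsManifold 𝓘(ℝ, F) ∞ N := by
    refine isManifold_of_contDiffOn _ _ _ ?_
    rintro _ _ ⟨q, rfl⟩ ⟨q', rfl⟩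
    have : Nonempty N := ⟨q⟩
    simpa using
      (hstr q).contDiffOn_inducedChart_comp_symm (hstr q') hι (hΨsymm q) (hΨ q')
  refine ⟨inferInstance, hN, IsImmersionOfComplement.isImmersion (F := F') fun q => ?_, hι⟩
  refine IsImmersionAtOfComplement.mk_of_continuousAt hι.continuous.continuousAt (e q) (φ q) (Ψ q)
    (hmem q) (hmem q) (IsManifold.subset_maximalAtlas ⟨q, rfl⟩)
    ((IsManifold.mem_maximalAtlas_iff_contMDiffOn _).2 ⟨hΨ q, hΨsymm q⟩) fun u hu => ?_
  have hu' : u ∈ (φ q).target := by simpa using hu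
  have : Nonempty N := ⟨q⟩
  change Ψ q (ι ((φ q).symm u)) = e q (u, 0)
  rw [(hstr q).map_inducedChart_symm hι hu', (Ψ q).right_inv hu']

end Submanifold

section Stratum

variable {A : Type*} [NormedAddCommGroup A] [NormedSpace ℝ A]
  {G : Type*} [TopologicalSpace G] [ChartedSpace A G] [Group G]
  {E : Type*} [NormedAddCommGroup E] [NormedSpace ℝ E]
  {M : Type*} [TopologicalSpace M] [ChartedSpace E M] [MulAction G M]
  [ContMDiffSMul 𝓘(ℝ, A) 𝓘(ℝ, E) ∞ G M]

theorem IsSliceChart.restrOpen {p : M} {Ψ : OpenPartialHomeomorph M E} {S : Set M} {y : M → E}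
    (hΨ : IsSliceChart A (G := G) E p Ψ S y) {U : Set M} (hU : IsOpen U) (hp : p ∈ U) :
    IsSliceChart A (G := G) E p (Ψ.restrOpen U hU) S y where
  mem_source := ⟨hΨ.mem_source, hp⟩
  map_self := hΨ.map_self
  contMDiffOn := hΨ.contMDiffOn.mono Set.inter_subset_left
  contMDiffOn_symm := hΨ.contMDiffOn_symm.mono Set.inter_subset_left
  hasMFDerivAt := hΨ.hasMFDerivAt
  exists_smul := fun x hx => hΨ.exists_smul x hx.1
  mem_stabilizer := hΨ.mem_stabilizer
  map_smul := hΨ.map_smul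
  smul_eq_of_map_eq := hΨ.smul_eq_of_map_eq
  disjoint := hΨ.disjoint

variable [FiniteDimensional ℝ A] [LieGroup 𝓘(ℝ, A) ∞ G] [FiniteDimensional ℝ E]
  [IsManifold 𝓘(ℝ, E) ∞ M] [ProperSMul G M]

variable (A E) in
theorem exists_isSliceChart_component {K : Subgroup G} {p m₀ : M}
    (hp : p ∈ connectedComponentIn (orbitTypeSet M K) m₀) :
    ∃ (Ψ : OpenPartialHomeomorph M E) (S : Set M) (y : M → E),
      IsSliceChart A (G := G) E p Ψ S y ∧ ∀ x ∈ Ψ.source,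
        x ∈ connectedComponentIn (orbitTypeSet M K) m₀ ↔ Ψ x ∈ fixedModVertical A G E p := by
  obtain ⟨Ψ, S, y, hΨ⟩ := exists_isSliceChart A (G := G) E p
  have hpK := connectedComponentIn_subset _ _ hp
  have h0 : (0 : E) ∈ Ψ.target := hΨ.map_self ▸ Ψ.map_source hΨ.mem_source
  obtain ⟨r, hr, hball⟩ := Metric.isOpen_iff.1 Ψ.open_target 0 h0
  have hU := Ψ.isOpen_inter_preimage (Metric.isOpen_ball (x := (0 : E)) (ε := r))
  refine ⟨Ψ.restrOpen _ hU, S, y, hΨ.restrOpen hU ⟨hΨ.mem_source, ?_⟩, ?_⟩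
  · rw [Set.mem_preimage, hΨ.map_self]
    exact Metric.mem_ball_self hr
  rintro x ⟨hx, -, hxr⟩
  change _ ↔ Ψ x ∈ _
  rw [← hΨ.mem_orbitTypeSet_iff hpK hx]
  refine ⟨fun h => connectedComponentIn_subset _ _ h, fun h => ?_⟩
  rw [connectedComponentIn_eq hp]
  have hconv : Convex ℝ ((fixedModVertical A G E p : Set E) ∩ Metric.ball 0 r) :=
    (Submodule.convex _).inter (convex_ball _ _)
  have hconn : IsPreconnected (Ψ.symm '' ((fixedModVertical A G E p : Set E) ∩ Metric.ball 0 r)) :=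
    hconv.isPreconnected.image _ (Ψ.continuousOn_symm.mono fun v hv => hball hv.2)
  refine hconn.subset_connectedComponentIn
    ⟨0, ⟨Submodule.zero_mem _, Metric.mem_ball_self hr⟩, ?_⟩ ?_
    ⟨Ψ x, ⟨(hΨ.mem_orbitTypeSet_iff hpK hx).1 h, hxr⟩, Ψ.left_inv hx⟩
  · rw [← hΨ.map_self, Ψ.left_inv hΨ.mem_source]
  · rintro _ ⟨v, ⟨hv, hvr⟩, rfl⟩
    rw [hΨ.mem_orbitTypeSet_iff hpK (Ψ.map_target (hball hvr)), Ψ.right_inv (hball hvr)]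
    exact hv

variable (A E) in
theorem finrank_fixedModVertical_eq_of_mem_component {K : Subgroup G} {p q m₀ : M}
    (hp : p ∈ connectedComponentIn (orbitTypeSet M K) m₀)
    (hq : q ∈ connectedComponentIn (orbitTypeSet M K) m₀) :
    Module.finrank ℝ (fixedModVertical A G E p) = Module.finrank ℝ (fixedModVertical A G E q) := by
  refine isPreconnected_connectedComponentIn.constant
    (f := fun x => Module.finrank ℝ (fixedModVertical A G E x)) (fun x hx => ?_) hp hq
  obtain ⟨Ψ, S, y, hΨ⟩ := exists_isSliceChart A (G := G) E x
  refine tendsto_const_nhds.congr' ?_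
  filter_upwards [self_mem_nhdsWithin, mem_nhdsWithin_of_mem_nhds
    (Ψ.open_source.mem_nhds hΨ.mem_source)] with z hz hzΨ
  exact (hΨ.finrank_fixedModVertical_eq (connectedComponentIn_subset _ _ hx) hzΨ
    (connectedComponentIn_subset _ _ hz)).symm

theorem exists_chartedSpace_of_range_eq_component {K : Subgroup G} {m₀ : M} {F : Type*}
    [NormedAddCommGroup F] [NormedSpace ℝ F] [FiniteDimensional ℝ F]
    (hF : Module.finrank ℝ F = Module.finrank ℝ (fixedModVertical A G E m₀)) {N : Type*}
    [TopologicalSpace N] {ι : N → M} (hι : IsEmbedding ι)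
    (hrange : Set.range ι = connectedComponentIn (orbitTypeSet M K) m₀) :
    ∃ _ : ChartedSpace F N, IsManifold 𝓘(ℝ, F) ∞ N ∧
      IsSmoothEmbedding 𝓘(ℝ, F) 𝓘(ℝ, E) ∞ ι := by
  have hle : Module.finrank ℝ F ≤ Module.finrank ℝ E := hF ▸ Submodule.finrank_le _
  refine exists_chartedSpace_of_straightensRange
    (F' := EuclideanSpace ℝ (Fin (Module.finrank ℝ E - Module.finrank ℝ F))) hι fun q => ?_
  have hq : ι q ∈ connectedComponentIn (orbitTypeSet M K) m₀ := hrange ▸ ⟨q, rfl⟩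
  have hm₀ : m₀ ∈ connectedComponentIn (orbitTypeSet M K) m₀ :=
    mem_connectedComponentIn (connectedComponentIn_nonempty_iff.1 ⟨ι q, hq⟩)
  obtain ⟨Ψ, S, y, hΨ, hmem⟩ := exists_isSliceChart_component A (G := G) E hq
  obtain ⟨e, he⟩ := exists_equiv_prod_of_submodule (fixedModVertical A G E (ι q))
    (F' := EuclideanSpace ℝ (Fin (Module.finrank ℝ E - Module.finrank ℝ F)))
    ((finrank_fixedModVertical_eq_of_mem_component A E hq hm₀).trans hF.symm)
    (by rw [finrank_euclideanSpace_fin]; omega)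
  refine ⟨Ψ, e, hΨ.mem_source, hΨ.contMDiffOn, hΨ.contMDiffOn_symm, fun x hx => ?_⟩
  rw [hrange, hmem x hx, he]

end Stratum

section Sections

variable {E : Type*} [NormedAddCommGroup E] [NormedSpace ℝ E]
  {M : Type*} [TopologicalSpace M] [ChartedSpace E M] [IsManifold 𝓘(ℝ, E) ∞ M]
  {F : Type*} [NormedAddCommGroup F] [NormedSpace ℝ F]
  {N : Type*} [TopologicalSpace N] [ChartedSpace F N]

/-- The differential of a function, as a one-form. -/
noncomputable def differential (f : M → ℝ) (x : M) : CotangentSpace 𝓘(ℝ, E) x :=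
  mfderiv 𝓘(ℝ, E) 𝓘(ℝ, ℝ) f x

theorem smoothFormOn_differential {f : M → ℝ} {U : Set M} (hU : IsOpen U)
    (hf : ContMDiffOn 𝓘(ℝ, E) 𝓘(ℝ, ℝ) ∞ f U) :
    SmoothFormOn 𝓘(ℝ, E) 𝓘(ℝ, E) (fun x : M => x) (differential f) U := by
  intro x₀ hx₀
  refine ContMDiffAt.contMDiffWithinAt ?_
  rw [contMDiffAt_hom_bundle]
  refine ⟨contMDiffAt_id, ?_⟩
  have hderiv := (hf.contMDiffAt (hU.mem_nhds hx₀)).mfderiv_const (m := ∞) (by simp)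
  refine hderiv.congr_of_eventuallyEq (Filter.Eventually.of_forall fun x => ?_)
  ext v
  simp only [ContinuousLinearMap.inCoordinates, differential, Trivial.fiberBundle_trivializationAt',
    Trivial.continuousLinearMapAt_trivialization, ContinuousLinearMap.id_comp,
    inTangentCoordinates, TangentBundle.continuousLinearMapAt_model_space, id_eq]
  rfl

theorem contMDiffOn_form_apply {ι : N → M} {α : ∀ q, CotangentSpace 𝓘(ℝ, E) (ι q)}
    {X : ∀ q, TangentSpace 𝓘(ℝ, E) (ι q)} {U : Set N}
    (hα : SmoothFormOn 𝓘(ℝ, E) 𝓘(ℝ, F) ι α U) (hX : SmoothFieldOn 𝓘(ℝ, E) 𝓘(ℝ, F) ι X U) :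
    ContMDiffOn 𝓘(ℝ, F) 𝓘(ℝ, ℝ) ∞ (fun q => (α q (X q) : ℝ)) U := fun q hq =>
  (contMDiffWithinAt_totalSpace.1 (ContMDiffWithinAt.clm_bundle_apply (F₁ := E) (F₂ := ℝ)
    (E₁ := fun m : M => TangentSpace 𝓘(ℝ, E) m) (E₂ := Bundle.Trivial M ℝ)
    (hα q hq) (hX q hq))).2

theorem smoothFormOn_sum_smul {κ : Type*} [Fintype κ] {ι : N → M}
    {σ : κ → ∀ q, CotangentSpace 𝓘(ℝ, E) (ι q)} {c : κ → N → ℝ} {U : Set N}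
    (hι : ContMDiffOn 𝓘(ℝ, F) 𝓘(ℝ, E) ∞ ι U)
    (hσ : ∀ i, SmoothFormOn 𝓘(ℝ, E) 𝓘(ℝ, F) ι (σ i) U)
    (hc : ∀ i, ContMDiffOn 𝓘(ℝ, F) 𝓘(ℝ, ℝ) ∞ (c i) U) :
    SmoothFormOn 𝓘(ℝ, E) 𝓘(ℝ, F) ι (fun q => ∑ i, c i q • σ i q) U := by
  intro q hq
  rw [contMDiffWithinAt_hom_bundle]
  refine ⟨hι q hq, ?_⟩
  have hsum := ContMDiffWithinAt.sum (t := Finset.univ) fun i _ =>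
    ContMDiffWithinAt.smul (hc i q hq) ((contMDiffWithinAt_hom_bundle _).1 (hσ i q hq)).2
  refine hsum.congr_of_mem (fun x _ => ?_) hq
  ext v
  simp [ContinuousLinearMap.inCoordinates]

theorem smoothFieldOn_add_sum_smul {κ : Type*} [Fintype κ] {ι : N → M}
    {X : ∀ q, TangentSpace 𝓘(ℝ, E) (ι q)}
    {Y : κ → ∀ q, TangentSpace 𝓘(ℝ, E) (ι q)} {c : κ → N → ℝ} {U : Set N}
    (hι : ContMDiffOn 𝓘(ℝ, F) 𝓘(ℝ, E) ∞ ι U) (hX : SmoothFieldOn 𝓘(ℝ, E) 𝓘(ℝ, F) ι X U)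
    (hY : ∀ i, SmoothFieldOn 𝓘(ℝ, E) 𝓘(ℝ, F) ι (Y i) U)
    (hc : ∀ i, ContMDiffOn 𝓘(ℝ, F) 𝓘(ℝ, ℝ) ∞ (c i) U) :
    SmoothFieldOn 𝓘(ℝ, E) 𝓘(ℝ, F) ι (fun q => X q + ∑ i, c i q • Y i q) U := by
  intro q hq
  rw [contMDiffWithinAt_totalSpace]
  refine ⟨hι q hq, ?_⟩
  have hsum := (contMDiffWithinAt_totalSpace.1 (hX q hq)).2.add
    (ContMDiffWithinAt.sum (t := Finset.univ) fun i _ =>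
      ContMDiffWithinAt.smul (hc i q hq) (contMDiffWithinAt_totalSpace.1 (hY i q hq)).2)
  let e := trivializationAt E (TangentSpace 𝓘(ℝ, E) : M → Type _) (ι q)
  have hlinear : ∀ x, ι x ∈ e.baseSet → (e ⟨ι x, X x + ∑ i, c i x • Y i x⟩).2 =
      (e ⟨ι x, X x⟩).2 + ∑ i, c i x • (e ⟨ι x, Y i x⟩).2 := by
    intro x hx
    have hcoe : ∀ v, (e ⟨ι x, v⟩).2 = e.continuousLinearMapAt ℝ (ι x) v := fun v =>
      (congrFun (e.coe_linearMapAt_of_mem (R := ℝ) hx) v).symm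
    simp only [hcoe, map_add, map_sum, map_smul]
  have hmem : ι q ∈ e.baseSet := mem_baseSet_trivializationAt _ _ _
  refine hsum.congr_of_eventuallyEq ?_ (hlinear q hmem)
  filter_upwards [(hι q hq).continuousWithinAt.preimage_mem_nhdsWithin
    (e.open_baseSet.mem_nhds hmem)] with x hx using hlinear x hx

theorem SmoothFormOn.comp_map {α : ∀ x : M, CotangentSpace 𝓘(ℝ, E) x} {U : Set M}
    (hα : SmoothFormOn 𝓘(ℝ, E) 𝓘(ℝ, E) (fun x : M => x) α U) {ι : N → M}
    (hι : ContMDiff 𝓘(ℝ, F) 𝓘(ℝ, E) ∞ ι) :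
    SmoothFormOn 𝓘(ℝ, E) 𝓘(ℝ, F) ι (fun q => α (ι q)) (ι ⁻¹' U) :=
  ContMDiffOn.comp hα hι.contMDiffOn fun _ hq => hq

theorem SmoothFieldOn.comp_map {X : ∀ x : M, TangentSpace 𝓘(ℝ, E) x} {U : Set M}
    (hX : SmoothFieldOn 𝓘(ℝ, E) 𝓘(ℝ, E) (fun x : M => x) X U) {ι : N → M}
    (hι : ContMDiff 𝓘(ℝ, F) 𝓘(ℝ, E) ∞ ι) :
    SmoothFieldOn 𝓘(ℝ, E) 𝓘(ℝ, F) ι (fun q => X (ι q)) (ι ⁻¹' U) :=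
  ContMDiffOn.comp hX hι.contMDiffOn fun _ hq => hq

theorem exists_smoothField_eq (x : M) (v : TangentSpace 𝓘(ℝ, E) x) :
    ∃ (U : Set M) (X : ∀ y : M, TangentSpace 𝓘(ℝ, E) y), IsOpen U ∧ x ∈ U ∧
      SmoothFieldOn 𝓘(ℝ, E) 𝓘(ℝ, E) (fun y : M => y) X U ∧ X x = v := by
  let e := trivializationAt E (TangentSpace 𝓘(ℝ, E) : M → Type _) x
  refine ⟨e.baseSet, fun y => e.symm y (e ⟨x, v⟩).2, e.open_baseSet,
    mem_baseSet_trivializationAt _ _ x, ?_, ?_⟩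
  · intro y hy
    refine ContMDiffAt.contMDiffWithinAt ?_
    refine (e.contMDiffAt_section_iff hy).2 ?_
    refine (contMDiffAt_const (c := (e ⟨x, v⟩).2)).congr_of_eventuallyEq ?_
    filter_upwards [e.open_baseSet.mem_nhds hy] with z hz
    rw [e.apply_mk_symm hz]
  · exact e.symm_apply_apply_mk (mem_baseSet_trivializationAt _ _ x) v

end Sections

section Fundamental

variable {A : Type*} [NormedAddCommGroup A] [NormedSpace ℝ A]
  {G : Type*} [TopologicalSpace G] [ChartedSpace A G] [Group G] [LieGroup 𝓘(ℝ, A) ∞ G]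
  {E : Type*} [NormedAddCommGroup E] [NormedSpace ℝ E]
  {M : Type*} [TopologicalSpace M] [ChartedSpace E M] [MulAction G M]
  [ContMDiffSMul 𝓘(ℝ, A) 𝓘(ℝ, E) ∞ G M] [IsManifold 𝓘(ℝ, E) ∞ M]

theorem smoothFieldOn_fundamentalField (ξ : GroupLieAlgebra 𝓘(ℝ, A) G) :
    SmoothFieldOn 𝓘(ℝ, E) 𝓘(ℝ, E) (fun x : M => x)
      (fun x => fundamentalField 𝓘(ℝ, A) G 𝓘(ℝ, E) x ξ) Set.univ := by
  have hsm : ContMDiff (𝓘(ℝ, A).prod 𝓘(ℝ, E)) 𝓘(ℝ, E) ∞ (fun z : G × M => z.1 • z.2) :=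
    contMDiff_smul
  have hξ : ContMDiff 𝓘(ℝ, E) (𝓘(ℝ, A).prod 𝓘(ℝ, A)) ∞
      (fun _ : M => (TotalSpace.mk' A (1 : G) ξ : TangentBundle 𝓘(ℝ, A) G)) := contMDiff_const
  have hzero : ContMDiff 𝓘(ℝ, E) (𝓘(ℝ, E).prod 𝓘(ℝ, E)) ∞
      (fun x : M => (TotalSpace.mk' E x 0 : TangentBundle 𝓘(ℝ, E) M)) := contMDiff_zeroSection _ _
  have hprod : ContMDiff ((𝓘(ℝ, A).prod 𝓘(ℝ, A)).prod (𝓘(ℝ, E).prod 𝓘(ℝ, E))) _ ∞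
      (equivTangentBundleProd 𝓘(ℝ, A) G 𝓘(ℝ, E) M).symm := contMDiff_equivTangentBundleProd_symm
  have htangent := hsm.contMDiff_tangentMap (m := ∞) (by simp)
  refine (((htangent.comp hprod).comp (hξ.prodMk hzero)).congr fun x => ?_).contMDiffOn
  refine TotalSpace.ext (by simp) ?_
  simp only [Function.comp_apply, tangentMap]
  rw [mfderiv_prod_eq_add_apply (hsm.mdifferentiableAt (by simp))]
  exact heq_of_eq (show orbitDeriv A G E x ξ = orbitDeriv A G E x ξ + smulDeriv A E (1 : G) x 0 by
    rw [map_zero, add_zero])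

end Fundamental

section Embedding

variable {E : Type*} [NormedAddCommGroup E] [NormedSpace ℝ E]
  {M : Type*} [TopologicalSpace M] [ChartedSpace E M]
  {F : Type*} [NormedAddCommGroup F] [NormedSpace ℝ F]
  {N : Type*} [TopologicalSpace N] [ChartedSpace F N] {ι : N → M}

theorem exists_leftInverse_of_isImmersion (hι : IsImmersion 𝓘(ℝ, F) 𝓘(ℝ, E) ∞ ι) (q : N) :
    ∃ (d : F →L[ℝ] E) (l : E →L[ℝ] F), HasMFDerivAt 𝓘(ℝ, F) 𝓘(ℝ, E) ι q d ∧ ∀ v, l (d v) = v := by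
  have him := (hι.isImmersionAt q).isImmersionAtOfComplement_complement
  set φ := him.domChart
  set ψ := him.codChart
  set e := him.equiv
  have hq : q ∈ φ.source := him.mem_domChart_source
  have hψι : ∀ x ∈ φ.source, ψ (ι x) = e (φ x, 0) := fun x hx => by
    have hx' : φ x ∈ (φ.extend 𝓘(ℝ, F)).target := by simpa using φ.map_source hx
    have hwritten : ψ (ι (φ.symm (φ x))) = e (φ x, 0) := him.writtenInCharts hx'
    rwa [φ.left_inv hx] at hwritten
  have hψ : ContMDiffAt 𝓘(ℝ, E) 𝓘(ℝ, E) ∞ ψ (ι q) :=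
    contMDiffAt_of_mem_maximalAtlas him.codChart_mem_maximalAtlas him.mem_codChart_source
  have hproj : ContMDiff 𝓘(ℝ, E) 𝓘(ℝ, F) ∞ (fun v : E => (e.symm v).1) :=
    (contDiff_fst.comp e.symm.contDiff).contMDiff
  have hφ : ContMDiffAt 𝓘(ℝ, F) 𝓘(ℝ, F) ∞ φ.symm ((e.symm (ψ (ι q))).1) := by
    rw [hψι q hq]
    simpa using contMDiffAt_symm_of_mem_maximalAtlas him.domChart_mem_maximalAtlas
      (φ.map_source hq)
  have hretract :=
    ((hφ.comp (ι q) ((hproj _).comp (ι q) hψ)).mdifferentiableAt (by simp)).hasMFDerivAt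
  have hd := ((hι.contMDiff q).mdifferentiableAt (by simp)).hasMFDerivAt
  have hcomp := hasMFDerivAt_comp_of_eq hretract hd rfl
  refine ⟨_, _, hd, DFunLike.congr_fun (hasMFDerivAt_unique hcomp
    ((hasMFDerivAt_id q).congr_of_eventuallyEq ?_))⟩
  filter_upwards [φ.open_source.mem_nhds hq] with x hx
  simp [hψι x hx, φ.left_inv hx]

variable {A : Type*} [NormedAddCommGroup A] [NormedSpace ℝ A]
  {G : Type*} [TopologicalSpace G] [ChartedSpace A G] [Group G]
  [MulAction G M] [ContMDiffSMul 𝓘(ℝ, A) 𝓘(ℝ, E) ∞ G M] [MulAction G N]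

theorem contMDiffSMul_of_isSmoothEmbedding (hι : IsSmoothEmbedding 𝓘(ℝ, F) 𝓘(ℝ, E) ∞ ι)
    (hG : ∀ (g : G) q, ι (g • q) = g • ι q) : ContMDiffSMul 𝓘(ℝ, A) 𝓘(ℝ, F) ∞ G N := by
  have hcomp : ContMDiff (𝓘(ℝ, A).prod 𝓘(ℝ, F)) 𝓘(ℝ, E) ∞ (ι ∘ fun z : G × N => z.1 • z.2) :=
    (contMDiff_fst.smul (I := 𝓘(ℝ, A)) (hι.contMDiff.comp contMDiff_snd)).congr fun z =>
      hG z.1 z.2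
  refine ⟨fun z => ?_⟩
  rw [ContMDiffAt.iff_comp_isImmersionAt (hι.isImmersion.isImmersionAt _)]
  exact ⟨hι.isEmbedding.isInducing.continuousAt_iff.2 (hcomp z).continuousAt, hcomp z⟩

end Embedding

section Invariant

variable {A : Type*} [NormedAddCommGroup A] [NormedSpace ℝ A]
  {G : Type*} [TopologicalSpace G] [ChartedSpace A G] [Group G]
  {E : Type*} [NormedAddCommGroup E] [NormedSpace ℝ E]
  {M : Type*} [TopologicalSpace M] [ChartedSpace E M] [MulAction G M]
  [ContMDiffSMul 𝓘(ℝ, A) 𝓘(ℝ, E) ∞ G M]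

theorem apply_orbitDeriv_eq_zero_of_invariant {f : M → ℝ} {x : M} {a : E →L[ℝ] ℝ}
    (hf : HasMFDerivAt 𝓘(ℝ, E) 𝓘(ℝ, ℝ) f x a) (hfG : ∀ g : G, f (g • x) = f x) (ξ : A) :
    a (orbitDeriv A G E x ξ) = 0 := by
  have hcomp := hasMFDerivAt_comp_of_eq hf (hasMFDerivAt_orbitMap_one (A := A) (G := G) x)
    (one_smul G x)
  have hconst : HasMFDerivAt 𝓘(ℝ, A) 𝓘(ℝ, ℝ) (fun g : G => f (g • x)) 1 (0 : A →L[ℝ] ℝ) :=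
    (hasMFDerivAt_const (f x) 1).congr_of_eventuallyEq (Filter.Eventually.of_forall hfG)
  exact DFunLike.congr_fun (hasMFDerivAt_unique hcomp hconst) ξ

theorem apply_smulDeriv_of_invariant {f : M → ℝ} {x : M} {g : G} {a b : E →L[ℝ] ℝ}
    (hf : HasMFDerivAt 𝓘(ℝ, E) 𝓘(ℝ, ℝ) f x a) (hf' : HasMFDerivAt 𝓘(ℝ, E) 𝓘(ℝ, ℝ) f (g • x) b)
    (hfG : ∀ᶠ y in 𝓝 x, f (g • y) = f y) (v : E) : b (smulDeriv A E g x v) = a v := by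
  have hcomp := hasMFDerivAt_comp_of_eq hf' (hasMFDerivAt_smulMap (A := A) (E := E) g x) rfl
  exact DFunLike.congr_fun (hasMFDerivAt_unique hcomp (hf.congr_of_eventuallyEq hfG)) v

variable (A G E) in
/-- The covectors at `p` that vanish on the orbit through `p` and are invariant under the isotropy
group of `p`. -/
noncomputable def basicCovectors (p : M) : Submodule ℝ (E →L[ℝ] ℝ) where
  carrier := {a | (∀ v ∈ (orbitDeriv A G E p).range, a v = 0) ∧
    ∀ h ∈ MulAction.stabilizer G p, ∀ v, a (smulDeriv A E h p v) = a v}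
  zero_mem' := ⟨fun _ _ => rfl, fun _ _ _ => rfl⟩
  add_mem' := fun {a b} ha hb => ⟨fun v hv => by simp [ha.1 v hv, hb.1 v hv],
    fun h hh v => by simp [ha.2 h hh v, hb.2 h hh v]⟩
  smul_mem' := fun c a ha => ⟨fun v hv => by simp [ha.1 v hv],
    fun h hh v => by simp [ha.2 h hh v]⟩

variable [IsManifold 𝓘(ℝ, E) ∞ M]

theorem differential_mem_smoothAnnihilator {f : M → ℝ} {U : Set M} (hU : IsOpen U)
    (hf : ContMDiffOn 𝓘(ℝ, E) 𝓘(ℝ, ℝ) ∞ f U)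
    (hfG : ∀ (g : G), ∀ x ∈ U, f (g • x) = f x) {x : M} (hx : x ∈ U) :
    differential f x ∈
      smoothAnnihilator 𝓘(ℝ, E) (fun y : M => verticalSpace 𝓘(ℝ, A) G 𝓘(ℝ, E) y) x := by
  refine ⟨U, hU, hx, differential f, smoothFormOn_differential hU hf, ?_, rfl⟩
  intro W X _ _ hX z hz
  obtain ⟨ξ, hξ⟩ := hX z hz.2
  rw [← hξ]
  exact apply_orbitDeriv_eq_zero_of_invariant (A := A) (G := G)
    ((hf.contMDiffAt (hU.mem_nhds hz.1)).mdifferentiableAt (by simp)).hasMFDerivAt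
    (fun g => hfG g z hz.1) ξ

theorem differential_mem_invariantVerticalAnnihilator {f : M → ℝ} {U : Set M} (hU : IsOpen U)
    (hUG : ∀ (g : G), ∀ x ∈ U, g • x ∈ U) (hf : ContMDiffOn 𝓘(ℝ, E) 𝓘(ℝ, ℝ) ∞ f U)
    (hfG : ∀ (g : G), ∀ x ∈ U, f (g • x) = f x) {x : M} (hx : x ∈ U) :
    differential f x ∈ invariantVerticalAnnihilator 𝓘(ℝ, A) G 𝓘(ℝ, E) x := by
  refine ⟨U, hU, hx, hUG, differential f, smoothFormOn_differential hU hf,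
    fun z hz => differential_mem_smoothAnnihilator hU hf hfG hz, fun g z hz => ?_, rfl⟩
  have hd : ∀ y ∈ U, HasMFDerivAt 𝓘(ℝ, E) 𝓘(ℝ, ℝ) f y (differential f y) := fun y hy =>
    ((hf.contMDiffAt (hU.mem_nhds hy)).mdifferentiableAt (by simp)).hasMFDerivAt
  exact ContinuousLinearMap.ext fun v => apply_smulDeriv_of_invariant (A := A) (hd z hz)
    (hd _ (hUG g z hz)) (Filter.mem_of_superset (hU.mem_nhds hz) fun y hy => hfG g y hy) v

variable [LieGroup 𝓘(ℝ, A) ∞ G]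

theorem apply_orbitDeriv_eq_zero_of_mem_smoothAnnihilator {p : M} {a : CotangentSpace 𝓘(ℝ, E) p}
    (ha : a ∈ smoothAnnihilator 𝓘(ℝ, E) (fun y : M => verticalSpace 𝓘(ℝ, A) G 𝓘(ℝ, E) y) p)
    (ξ : A) : a (orbitDeriv A G E p ξ) = 0 := by
  obtain ⟨U, -, hpU, α, -, hα, rfl⟩ := ha
  exact hα Set.univ _ isOpen_univ (smoothFieldOn_fundamentalField ξ) (fun x _ => ⟨ξ, rfl⟩) p
    ⟨hpU, trivial⟩

theorem mem_basicCovectors_of_mem_invariantVerticalAnnihilator {p : M} {a : E →L[ℝ] ℝ}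
    (ha : (show CotangentSpace 𝓘(ℝ, E) p from a) ∈
      invariantVerticalAnnihilator 𝓘(ℝ, A) G 𝓘(ℝ, E) p) : a ∈ basicCovectors A G E p := by
  obtain ⟨U, -, hpU, -, α, -, hαV, hαG, rfl : α p = a⟩ := ha
  refine ⟨?_, fun h hh v => ?_⟩
  · rintro _ ⟨ξ, rfl⟩
    exact apply_orbitDeriv_eq_zero_of_mem_smoothAnnihilator (hαV p hpU) ξ
  · have hinv : (α (h • p) : E →L[ℝ] ℝ) (smulDeriv A E h p v) = (α p : E →L[ℝ] ℝ) v :=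
      DFunLike.congr_fun (hαG h p hpU) v
    have hcongr : ∀ x, x = p → (α x : E →L[ℝ] ℝ) = (α p : E →L[ℝ] ℝ) := by
      rintro x rfl
      rfl
    rwa [hcongr _ hh] at hinv

theorem mem_invariantVerticalAnnihilator_iff [FiniteDimensional ℝ A] [FiniteDimensional ℝ E]
    [ProperSMul G M] {p : M} {a : E →L[ℝ] ℝ} :
    (show CotangentSpace 𝓘(ℝ, E) p from a) ∈ invariantVerticalAnnihilator 𝓘(ℝ, A) G 𝓘(ℝ, E) p ↔
      a ∈ basicCovectors A G E p := by
  refine ⟨mem_basicCovectors_of_mem_invariantVerticalAnnihilator, fun ⟨haV, haH⟩ => ?_⟩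
  obtain ⟨U, f, hU, hpU, hUG, hf, hfG, hfa⟩ := exists_invariant_function A E haV haH
  exact hfa.mfderiv ▸ differential_mem_invariantVerticalAnnihilator (A := A) hU hUG hf hfG hpU

end Invariant

section LinearAlgebra

theorem exists_dual_vectors {K E κ : Type*} [Field K] [AddCommGroup E] [Module K E] [Finite κ]
    [DecidableEq κ] {a : κ → E →ₗ[K] K} (ha : LinearIndependent K a) :
    ∃ v : κ → E, ∀ i j, a i (v j) = if i = j then 1 else 0 := by
  have := Fintype.ofFinite κ
  have hsurj : LinearMap.range (LinearMap.pi a) = ⊤ := by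
    by_contra h
    obtain ⟨c, hc, hle⟩ := Submodule.exists_le_ker_of_lt_top _ (lt_top_iff_ne_top.2 h)
    have hrelation : ∑ i, c (Pi.single i 1) • a i = 0 := by
      ext x
      have hcx : c (LinearMap.pi a x) = 0 := hle ⟨x, rfl⟩
      rw [← LinearMap.sum_single_apply (fun _ => K) (LinearMap.pi a x), map_sum] at hcx
      rw [LinearMap.sum_apply, LinearMap.zero_apply, ← hcx]
      refine Finset.sum_congr rfl fun i _ => ?_
      rw [LinearMap.smul_apply, smul_eq_mul, mul_comm, ← smul_eq_mul, ← map_smul, ← Pi.single_smul,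
        smul_eq_mul, mul_one]
      rfl
    exact hc (LinearMap.pi_ext' fun i => LinearMap.ext_ring
      (Fintype.linearIndependent_iff.1 ha _ hrelation i))
  choose v hv using fun j => LinearMap.range_eq_top.1 hsurj (Pi.single j (1 : K))
  exact ⟨v, fun i j => by simpa [Pi.single_apply] using congrFun (hv j) i⟩

theorem exists_linearIndependent_of_finrank_eq {K V : Type*} [Field K]
    [AddCommGroup V] [Module K V] [FiniteDimensional K V] (S : Submodule K V) {r : ℕ}
    (hr : Module.finrank K S = r) :
    ∃ a : Fin r → V, (∀ i, a i ∈ S) ∧ LinearIndependent K a := by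
  have hli : LinearIndependent K (S.subtype ∘ Module.finBasisOfFinrankEq K S hr) :=
    (Module.finBasisOfFinrankEq K S hr).linearIndependent.map' _ (Submodule.ker_subtype _)
  exact ⟨_, fun i => (Module.finBasisOfFinrankEq K S hr i).2, hli⟩

theorem eq_sum_smul_of_mem_span_of_dual {K V κ : Type*} [Field K] [AddCommGroup V] [Module K V]
    [Fintype κ] [DecidableEq κ] {σ : κ → V} {φ : κ → V →ₗ[K] K}
    (hdual : ∀ i j, φ j (σ i) = if i = j then 1 else 0) {a : V}
    (ha : a ∈ Submodule.span K (Set.range σ)) : a = ∑ i, φ i a • σ i := by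
  obtain ⟨c, rfl⟩ := (Submodule.mem_span_range_iff_exists_fun K).1 ha
  simp [hdual]

end LinearAlgebra

section SmoothMatrix

variable {F : Type*} [NormedAddCommGroup F] [NormedSpace ℝ F]
  {N : Type*} [TopologicalSpace N] [ChartedSpace F N] {κ : Type*} [Fintype κ] [DecidableEq κ]

theorem contMDiffOn_det {B : N → Matrix κ κ ℝ} {U : Set N}
    (hB : ∀ i j, ContMDiffOn 𝓘(ℝ, F) 𝓘(ℝ, ℝ) ∞ (fun x => B x i j) U) :
    ContMDiffOn 𝓘(ℝ, F) 𝓘(ℝ, ℝ) ∞ (fun x => (B x).det) U := by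
  simp only [Matrix.det_apply']
  intro x hx
  refine ContMDiffWithinAt.sum fun σ _ => ContMDiffWithinAt.mul contMDiffWithinAt_const ?_
  exact ContMDiffWithinAt.prod fun i _ => hB _ _ x hx

theorem contMDiffOn_matrix_inv {B : N → Matrix κ κ ℝ} {U : Set N}
    (hB : ∀ i j, ContMDiffOn 𝓘(ℝ, F) 𝓘(ℝ, ℝ) ∞ (fun x => B x i j) U)
    (hdet : ∀ x ∈ U, (B x).det ≠ 0) (i j : κ) :
    ContMDiffOn 𝓘(ℝ, F) 𝓘(ℝ, ℝ) ∞ (fun x => (B x)⁻¹ i j) U := by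
  have hadj : ContMDiffOn 𝓘(ℝ, F) 𝓘(ℝ, ℝ) ∞ (fun x => (B x).adjugate i j) U := by
    simp only [Matrix.adjugate_apply]
    refine contMDiffOn_det fun k l => ?_
    simp only [Matrix.updateRow_apply]
    split_ifs
    · exact contMDiffOn_const
    · exact hB k l
  refine ((contMDiffOn_det hB).inv₀ hdet |>.mul hadj).congr fun x _ => ?_
  simp [Matrix.inv_def]

end SmoothMatrix

section DualFields

variable {E : Type*} [NormedAddCommGroup E] [NormedSpace ℝ E]
  {M : Type*} [TopologicalSpace M] [ChartedSpace E M] [IsManifold 𝓘(ℝ, E) ∞ M]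
  {F : Type*} [NormedAddCommGroup F] [NormedSpace ℝ F]
  {N : Type*} [TopologicalSpace N] [ChartedSpace F N] {κ : Type*} [Finite κ] [DecidableEq κ]

theorem exists_dual_fields_of_dual_at {ι : N → M} (hι : ContMDiff 𝓘(ℝ, F) 𝓘(ℝ, E) ∞ ι)
    {σ : κ → ∀ q, CotangentSpace 𝓘(ℝ, E) (ι q)} {Y : κ → ∀ q, TangentSpace 𝓘(ℝ, E) (ι q)}
    {U : Set N} (hU : IsOpen U) (hσ : ∀ i, SmoothFormOn 𝓘(ℝ, E) 𝓘(ℝ, F) ι (σ i) U)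
    (hY : ∀ i, SmoothFieldOn 𝓘(ℝ, E) 𝓘(ℝ, F) ι (Y i) U) {q : N} (hq : q ∈ U)
    (hdual : ∀ i j, σ i q (Y j q) = if i = j then (1 : ℝ) else 0) :
    ∃ (W : Set N) (Z : κ → ∀ q, TangentSpace 𝓘(ℝ, E) (ι q)), IsOpen W ∧ q ∈ W ∧ W ⊆ U ∧
      (∀ i, SmoothFieldOn 𝓘(ℝ, E) 𝓘(ℝ, F) ι (Z i) W) ∧
      ∀ x ∈ W, ∀ i j, σ i x (Z j x) = if i = j then (1 : ℝ) else 0 := by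
  have := Fintype.ofFinite κ
  let B : N → Matrix κ κ ℝ := fun x => Matrix.of fun i j => σ i x (Y j x)
  have hB : ∀ i j, ContMDiffOn 𝓘(ℝ, F) 𝓘(ℝ, ℝ) ∞ (fun x => B x i j) U := fun i j =>
    contMDiffOn_form_apply (hσ i) (hY j)
  have hBq : B q = 1 := Matrix.ext fun i j => (hdual i j).trans (Matrix.one_apply).symm
  let W : Set N := U ∩ (fun x => (B x).det) ⁻¹' {0}ᶜ
  have hWU : W ⊆ U := Set.inter_subset_left
  have hinv : ∀ i j, ContMDiffOn 𝓘(ℝ, F) 𝓘(ℝ, ℝ) ∞ (fun x => (B x)⁻¹ i j) W :=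
    contMDiffOn_matrix_inv (fun i j => (hB i j).mono hWU) fun x hx => hx.2
  have hzero : SmoothFieldOn 𝓘(ℝ, E) 𝓘(ℝ, F) ι (fun _ => 0) W :=
    ((contMDiff_zeroSection ℝ (fun m : M => TangentSpace 𝓘(ℝ, E) m)).comp hι).contMDiffOn
  refine ⟨W, fun k x => 0 + ∑ j, (B x)⁻¹ j k • Y j x,
    (contMDiffOn_det hB).continuousOn.isOpen_inter_preimage hU isOpen_compl_singleton,
    ⟨hq, by simp [hBq]⟩, hWU, fun k => smoothFieldOn_add_sum_smul hι.contMDiffOn hzero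
      (fun j => (hY j).mono hWU) fun j => hinv j k, fun x hx i k => ?_⟩
  calc σ i x (0 + ∑ j, (B x)⁻¹ j k • Y j x)
      = ∑ j, B x i j * (B x)⁻¹ j k := by
        rw [zero_add]
        exact (map_sum (σ i x) _ _).trans (Finset.sum_congr rfl fun j _ =>
          (map_smul (σ i x) _ _).trans (mul_comm _ _))
    _ = if i = k then 1 else 0 := by
        rw [← Matrix.mul_apply, Matrix.mul_nonsing_inv _ (isUnit_iff_ne_zero.2 hx.2),
          Matrix.one_apply]

theorem exists_dual_fields {ι : N → M} (hι : ContMDiff 𝓘(ℝ, F) 𝓘(ℝ, E) ∞ ι)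
    {σ : κ → ∀ q, CotangentSpace 𝓘(ℝ, E) (ι q)} {U : Set N} (hU : IsOpen U)
    (hσ : ∀ i, SmoothFormOn 𝓘(ℝ, E) 𝓘(ℝ, F) ι (σ i) U) {q : N} (hq : q ∈ U)
    (hli : LinearIndependent ℝ fun i => σ i q) :
    ∃ (W : Set N) (Z : κ → ∀ q, TangentSpace 𝓘(ℝ, E) (ι q)), IsOpen W ∧ q ∈ W ∧ W ⊆ U ∧
      (∀ i, SmoothFieldOn 𝓘(ℝ, E) 𝓘(ℝ, F) ι (Z i) W) ∧
      ∀ x ∈ W, ∀ i j, σ i x (Z j x) = if i = j then (1 : ℝ) else 0 := by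
  let s : κ → E →L[ℝ] ℝ := fun i => σ i q
  have hs : LinearIndependent ℝ s := hli
  obtain ⟨v, hv⟩ := exists_dual_vectors (hs.map' (ContinuousLinearMap.coeLM ℝ)
    (LinearMap.ker_eq_bot.2 ContinuousLinearMap.coe_injective))
  choose V Y hV hqV hY hYv using fun j => exists_smoothField_eq (M := M) (ι q) (v j)
  have hU' : IsOpen (U ∩ ⋂ j, ι ⁻¹' V j) :=
    hU.inter (isOpen_iInter_of_finite fun j => (hV j).preimage hι.continuous)
  obtain ⟨W, Z, hW, hqW, hWU, hZ, hdual⟩ := exists_dual_fields_of_dual_at hι hU'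
    (Y := fun j x => Y j (ι x)) (fun i => (hσ i).mono Set.inter_subset_left)
    (fun j => ((hY j).comp_map hι).mono fun x hx => Set.mem_iInter.1 hx.2 j)
    ⟨hq, Set.mem_iInter.2 hqV⟩ fun i j => (congrArg (σ i q) (hYv j)).trans (hv i j)
  exact ⟨W, Z, hW, hqW, hWU.trans Set.inter_subset_left, hZ, hdual⟩

end DualFields

section Subbundle

variable {E : Type*} [NormedAddCommGroup E] [NormedSpace ℝ E]
  {M : Type*} [TopologicalSpace M] [ChartedSpace E M] [IsManifold 𝓘(ℝ, E) ∞ M]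
  {F : Type*} [NormedAddCommGroup F] [NormedSpace ℝ F]
  {N : Type*} [TopologicalSpace N] [ChartedSpace F N] {ι : N → M}

/-- Evaluation at the tangent vector `v`, as a functional on covectors. -/
noncomputable def evalCovector {x : M} (v : TangentSpace 𝓘(ℝ, E) x) :
    CotangentSpace 𝓘(ℝ, E) x →ₗ[ℝ] ℝ where
  toFun a := a v
  map_add' _ _ := rfl
  map_smul' _ _ := rfl

theorem mem_smoothCoannihilator_iff (hι : ContMDiff 𝓘(ℝ, F) 𝓘(ℝ, E) ∞ ι)
    {C : ∀ q, Submodule ℝ (CotangentSpace 𝓘(ℝ, E) (ι q))}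
    (hC : IsSmoothSubbundle 𝓘(ℝ, E) 𝓘(ℝ, F) ι C) {q : N} {v : TangentSpace 𝓘(ℝ, E) (ι q)} :
    v ∈ smoothCoannihilator 𝓘(ℝ, E) 𝓘(ℝ, F) ι C q ↔ ∀ a ∈ C q, a v = (0 : ℝ) := by
  obtain ⟨r, hr⟩ := hC
  obtain ⟨U, hU, hqU, σ, hσ, hframe⟩ := hr q
  have hσC : ∀ i, ∀ x ∈ U, σ i x ∈ C x := fun i x hx =>
    (hframe x hx).2 ▸ Submodule.subset_span ⟨i, rfl⟩
  have hkill : ∀ x ∈ U, ∀ w : TangentSpace 𝓘(ℝ, E) (ι x), (∀ i, σ i x w = (0 : ℝ)) →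
      ∀ a ∈ C x, a w = (0 : ℝ) := fun x hx w hw a ha => by
    have hle : C x ≤ LinearMap.ker (evalCovector w) := by
      rw [← (hframe x hx).2, Submodule.span_le]
      rintro _ ⟨i, rfl⟩
      exact hw i
    exact hle ha
  constructor
  · rintro ⟨V, -, hqV, X, -, hXC, rfl⟩
    exact hkill q hqU _ fun i => hXC U (σ i) hU (hσ i) (hσC i) q ⟨hqV, hqU⟩
  · intro hv
    obtain ⟨W, Z, hW, hqW, hWU, hZ, hdual⟩ := exists_dual_fields hι hU hσ hqU (hframe q hqU).1
    obtain ⟨V, Y, hV, hqV, hY, hYv⟩ := exists_smoothField_eq (ι q) v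
    have hYι : SmoothFieldOn 𝓘(ℝ, E) 𝓘(ℝ, F) ι (fun x => Y (ι x)) (W ∩ ι ⁻¹' V) :=
      (hY.comp_map hι).mono Set.inter_subset_right
    refine ⟨W ∩ ι ⁻¹' V, hW.inter (hV.preimage hι.continuous), ⟨hqW, hqV⟩,
      fun x => Y (ι x) + ∑ i, -(σ i x (Y (ι x)) : ℝ) • Z i x,
      smoothFieldOn_add_sum_smul hι.contMDiffOn hYι
        (fun i => (hZ i).mono Set.inter_subset_left) (fun i => (contMDiffOn_form_apply
          ((hσ i).mono fun x hx => hWU hx.1) hYι).neg), ?_, ?_⟩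
    · intro V' α _ _ hα x hx
      refine hkill x (hWU hx.1.1) _ (fun i => ?_) _ (hα x hx.2)
      simp [hdual x hx.1.1]
    · simp [hYv, hv _ (hσC _ q hqU)]

variable [IsManifold 𝓘(ℝ, F) ∞ N]

theorem SmoothFormOn.pullback (hι : ContMDiff 𝓘(ℝ, F) 𝓘(ℝ, E) ∞ ι)
    {σ : ∀ q, CotangentSpace 𝓘(ℝ, E) (ι q)} {U : Set N} (hU : IsOpen U)
    (hσ : SmoothFormOn 𝓘(ℝ, E) 𝓘(ℝ, F) ι σ U) :
    SmoothFormOn 𝓘(ℝ, F) 𝓘(ℝ, F) (fun q : N => q)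
      (fun q => pullbackCovector 𝓘(ℝ, E) 𝓘(ℝ, F) ι q (σ q)) U := by
  intro q hq
  refine ContMDiffAt.contMDiffWithinAt ?_
  rw [contMDiffAt_hom_bundle]
  refine ⟨contMDiffAt_id, ?_⟩
  have hσq := ((contMDiffAt_hom_bundle _).1 ((hσ q hq).contMDiffAt (hU.mem_nhds hq))).2
  have hd := (hι q).mfderiv_const (m := ∞) (by simp)
  refine (hσq.clm_comp hd).congr_of_eventuallyEq ?_
  let e := trivializationAt E (TangentSpace 𝓘(ℝ, E) : M → Type _) (ι q)
  filter_upwards [hι.continuous.continuousAt.preimage_mem_nhds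
    (e.open_baseSet.mem_nhds (mem_baseSet_trivializationAt _ _ (ι q)))] with x hx
  ext v
  simp only [ContinuousLinearMap.inCoordinates, inTangentCoordinates,
    ContinuousLinearMap.comp_apply]
  exact congrArg _ (congrArg (σ x) (e.symmL_continuousLinearMapAt (R := ℝ) hx _).symm)

theorem smoothFormOn_of_pullback (hι : ContMDiff 𝓘(ℝ, F) 𝓘(ℝ, E) ∞ ι)
    {C : ∀ q, Submodule ℝ (CotangentSpace 𝓘(ℝ, E) (ι q))}
    (hC : IsSmoothSubbundle 𝓘(ℝ, E) 𝓘(ℝ, F) ι C)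
    (hinj : ∀ q, Set.InjOn (pullbackCovector 𝓘(ℝ, E) 𝓘(ℝ, F) ι q) (C q))
    {s : ∀ q, CotangentSpace 𝓘(ℝ, E) (ι q)} {U : Set N} (hsC : ∀ q ∈ U, s q ∈ C q)
    (hs : SmoothFormOn 𝓘(ℝ, F) 𝓘(ℝ, F) (fun q : N => q)
      (fun q => pullbackCovector 𝓘(ℝ, E) 𝓘(ℝ, F) ι q (s q)) U) :
    SmoothFormOn 𝓘(ℝ, E) 𝓘(ℝ, F) ι s U := by
  obtain ⟨r, hr⟩ := hC
  refine contMDiffOn_of_locally_contMDiffOn fun q _ => ?_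
  obtain ⟨V, hV, hqV, σ, hσ, hframe⟩ := hr q
  have hli : LinearIndependent ℝ fun i => pullbackCovector 𝓘(ℝ, E) 𝓘(ℝ, F) ι q (σ i q) :=
    (hframe q hqV).1.map_injOn _ ((hframe q hqV).2 ▸ hinj q)
  obtain ⟨W, Y, hW, hqW, hWV, hY, hdual⟩ := exists_dual_fields (M := N) (ι := fun x : N => x)
    contMDiff_id hV (fun i => (hσ i).pullback hι hV) hqV hli
  refine ⟨W, hW, hqW, ?_⟩
  have hsum := smoothFormOn_sum_smul (hι.contMDiffOn (s := U ∩ W))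
    (fun i => (hσ i).mono fun x hx => hWV hx.2)
    (fun i => contMDiffOn_form_apply (hs.mono Set.inter_subset_left)
      ((hY i).mono Set.inter_subset_right))
  refine ContMDiffOn.congr hsum fun x hx => congrArg _ ?_
  exact eq_sum_smul_of_mem_span_of_dual (φ := fun j =>
    evalCovector (Y j x) ∘ₗ pullbackCovector 𝓘(ℝ, E) 𝓘(ℝ, F) ι x) (hdual x hx.2)
    ((hframe x (hWV hx.2)).2 ▸ hsC x hx.1)

theorem isPullbackBundleIso_of_bijOn (hι : ContMDiff 𝓘(ℝ, F) 𝓘(ℝ, E) ∞ ι)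
    {C : ∀ q, Submodule ℝ (CotangentSpace 𝓘(ℝ, E) (ι q))}
    {D : ∀ q : N, Submodule ℝ (CotangentSpace 𝓘(ℝ, F) q)}
    (hC : IsSmoothSubbundle 𝓘(ℝ, E) 𝓘(ℝ, F) ι C)
    (hbij : ∀ q, Set.BijOn (pullbackCovector 𝓘(ℝ, E) 𝓘(ℝ, F) ι q) (C q) (D q)) :
    IsPullbackBundleIso 𝓘(ℝ, E) 𝓘(ℝ, F) ι C D := by
  refine ⟨hC, ?_, hbij, fun U s hU hsC => ⟨fun hs => hs.pullback hι hU,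
    smoothFormOn_of_pullback hι hC (fun q => (hbij q).injOn) hsC⟩⟩
  obtain ⟨r, hr⟩ := hC
  refine ⟨r, fun q => ?_⟩
  obtain ⟨V, hV, hqV, σ, hσ, hframe⟩ := hr q
  refine ⟨V, hV, hqV, _, fun i => (hσ i).pullback hι hV, fun x hx => ?_⟩
  obtain ⟨hli, hspan⟩ := hframe x hx
  refine ⟨hli.map_injOn _ (hspan ▸ (hbij x).injOn), ?_⟩
  rw [← Function.comp_def, Set.range_comp, ← Submodule.map_span, hspan]
  exact SetLike.coe_injective (hbij x).image_eq

end Subbundle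

section Covectors

variable {A : Type*} [NormedAddCommGroup A] [NormedSpace ℝ A]
  {G : Type*} [TopologicalSpace G] [ChartedSpace A G] [Group G] [LieGroup 𝓘(ℝ, A) ∞ G]
  {E : Type*} [NormedAddCommGroup E] [NormedSpace ℝ E] [FiniteDimensional ℝ E]
  {M : Type*} [TopologicalSpace M] [ChartedSpace E M] [MulAction G M]
  [ContMDiffSMul 𝓘(ℝ, A) 𝓘(ℝ, E) ∞ G M] [IsManifold 𝓘(ℝ, E) ∞ M] [ProperSMul G M]

variable (A) in
theorem exists_mem_basicCovectors_eqOn {p : M} {b : E →L[ℝ] ℝ}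
    (hb : ∀ v ∈ (orbitDeriv A G E p).range, b v = 0) :
    ∃ a ∈ basicCovectors A G E p, ∀ v ∈ fixedModVertical A G E p, a v = b v := by
  obtain ⟨avg, -, hinv, hsub⟩ := exists_average_stabilizer (A := A) (E := E)
    (isCompact_stabilizer (G := G) p)
  refine ⟨b.comp avg, ⟨fun v hv => ?_, fun h hh v => ?_⟩, fun v hv => ?_⟩
  · have hmem := hsub _ v fun h hh => range_orbitDeriv_le_fixedModVertical p hv h hh
    exact hb _ (by simpa using Submodule.add_mem _ hmem hv)
  · simp [hinv h hh v]
  · have hzero := hb _ (hsub _ v hv)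
    rwa [map_sub, sub_eq_zero] at hzero

theorem eq_zero_of_mem_basicCovectors {p : M} {a : E →L[ℝ] ℝ} (ha : a ∈ basicCovectors A G E p)
    (h : ∀ v ∈ fixedModVertical A G E p, a v = 0) : a = 0 := by
  obtain ⟨avg, hfix, -, hsub⟩ := exists_average_stabilizer (A := A) (E := E)
    (isCompact_stabilizer (G := G) p)
  ext v
  have hker : avg v - v ∈ a.ker := hsub _ v fun k hk => by
    rw [LinearMap.mem_ker]
    exact (map_sub a _ _).trans (by rw [ha.2 k hk, sub_self])
  have havg : a (avg v) = 0 := h _ fun k hk => by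
    rw [hfix k hk, sub_self]
    exact Submodule.zero_mem _
  have hsub' : a (avg v) - a v = 0 := (map_sub a _ _).symm.trans hker
  simpa [havg] using hsub'

variable (A G E) in
theorem finrank_range_orbitDeriv_add_finrank_basicCovectors (p : M) :
    Module.finrank ℝ (orbitDeriv A G E p).range + Module.finrank ℝ (basicCovectors A G E p) =
      Module.finrank ℝ (fixedModVertical A G E p) := by
  let T := fixedModVertical A G E p
  let V : Submodule ℝ T := (orbitDeriv A G E p).range.comap T.subtype
  let restrict : basicCovectors A G E p →ₗ[ℝ] Module.Dual ℝ T :=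
    ((Module.Dual.transpose T.subtype).comp (ContinuousLinearMap.coeLM ℝ)).domRestrict _
  have hinj : Function.Injective restrict := by
    rw [injective_iff_map_eq_zero]
    rintro ⟨a, ha⟩ h
    exact Subtype.ext (eq_zero_of_mem_basicCovectors ha fun v hv =>
      DFunLike.congr_fun h (⟨v, hv⟩ : T))
  have hrange : LinearMap.range restrict = V.dualAnnihilator := by
    refine le_antisymm ?_ fun b hb => ?_
    · rintro _ ⟨⟨a, ha⟩, rfl⟩
      rw [Submodule.mem_dualAnnihilator]
      exact fun v hv => ha.1 v hv
    · obtain ⟨b', rfl⟩ := LinearMap.exists_extend b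
      obtain ⟨a, ha, hab⟩ := exists_mem_basicCovectors_eqOn A (G := G) (p := p)
        (b := LinearMap.toContinuousLinearMap b') fun v hv =>
          (Submodule.mem_dualAnnihilator _).1 hb
            ⟨v, range_orbitDeriv_le_fixedModVertical p hv⟩ hv
      exact ⟨⟨a, ha⟩, LinearMap.ext fun v => hab v v.2⟩
  have hV : Module.finrank ℝ V = Module.finrank ℝ (orbitDeriv A G E p).range :=
    (Submodule.comapSubtypeEquivOfLe (range_orbitDeriv_le_fixedModVertical p)).finrank_eq
  rw [← LinearMap.finrank_range_of_inj hinj, hrange, ← hV]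
  exact Subspace.finrank_add_finrank_dualAnnihilator_eq V

variable [FiniteDimensional ℝ A]

variable (A E) in
theorem finrank_basicCovectors_eq_of_mem_component {K : Subgroup G} {p q m₀ : M}
    (hp : p ∈ connectedComponentIn (orbitTypeSet M K) m₀)
    (hq : q ∈ connectedComponentIn (orbitTypeSet M K) m₀) :
    Module.finrank ℝ (basicCovectors A G E p) = Module.finrank ℝ (basicCovectors A G E q) := by
  obtain ⟨a, ha⟩ := connectedComponentIn_subset _ _ hp
  obtain ⟨b, hb⟩ := connectedComponentIn_subset _ _ hq
  have hvertical := finrank_range_orbitDeriv_eq_of_conj A E (p := p) (q := q) (k := b * a⁻¹) (by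
    rw [hb, ha, Subgroup.map_map]
    congr 1
    ext x
    simp [mul_assoc])
  have hfixed := finrank_fixedModVertical_eq_of_mem_component A E hp hq
  have hp' := finrank_range_orbitDeriv_add_finrank_basicCovectors A G E p
  have hq' := finrank_range_orbitDeriv_add_finrank_basicCovectors A G E q
  omega

variable (A G E) in
theorem exists_invariant_functions (p : M) {r : ℕ}
    (hr : Module.finrank ℝ (basicCovectors A G E p) = r) :
    ∃ (W : Set M) (f : Fin r → M → ℝ), IsOpen W ∧ p ∈ W ∧ (∀ (g : G), ∀ x ∈ W, g • x ∈ W) ∧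
      (∀ i, ContMDiffOn 𝓘(ℝ, E) 𝓘(ℝ, ℝ) ∞ (f i) W) ∧
      (∀ i (g : G), ∀ x ∈ W, f i (g • x) = f i x) ∧
      LinearIndependent ℝ fun i => (differential (f i) p : CotangentSpace 𝓘(ℝ, E) p) := by
  obtain ⟨b, hb, hli⟩ := exists_linearIndependent_of_finrank_eq (basicCovectors A G E p) hr
  choose U f hU hpU hUG hf hfG hfb using fun i =>
    exists_invariant_function A E (hb i).1 (hb i).2
  refine ⟨⋂ i, U i, f, isOpen_iInter_of_finite hU, Set.mem_iInter.2 hpU, fun g x hx =>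
    Set.mem_iInter.2 fun i => hUG i g x (Set.mem_iInter.1 hx i), fun i =>
    (hf i).mono (Set.iInter_subset _ i), fun i g x hx => hfG i g x (Set.mem_iInter.1 hx i), ?_⟩
  have hdf : (fun i => (differential (f i) p : E →L[ℝ] ℝ)) = b :=
    funext fun i => (hfb i).mfderiv
  exact (hdf ▸ hli : LinearIndependent ℝ fun i => (differential (f i) p : E →L[ℝ] ℝ))

end Covectors

section TangentSpace

variable {E : Type*} [NormedAddCommGroup E] [NormedSpace ℝ E]
  {M : Type*} [TopologicalSpace M] [ChartedSpace E M]
  {F : Type*} [NormedAddCommGroup F] [NormedSpace ℝ F]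
  {N : Type*} [TopologicalSpace N] [ChartedSpace F N] {ι : N → M}

theorem range_le_of_eventually_mem_range {X : Type*} [NormedAddCommGroup X] [NormedSpace ℝ X]
    (hι : IsSmoothEmbedding 𝓘(ℝ, F) 𝓘(ℝ, E) ∞ ι) {q : N} {d : F →L[ℝ] E}
    (hd : HasMFDerivAt 𝓘(ℝ, F) 𝓘(ℝ, E) ι q d) {γ : X → M} {x : X} {γ' : X →L[ℝ] E}
    (hγ : ContMDiffAt 𝓘(ℝ, X) 𝓘(ℝ, E) ∞ γ x) (hγ' : HasMFDerivAt 𝓘(ℝ, X) 𝓘(ℝ, E) γ x γ')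
    (hγx : γ x = ι q) (hmem : ∀ᶠ z in 𝓝 x, γ z ∈ Set.range ι) : γ'.range ≤ d.range := by
  have : Nonempty N := ⟨q⟩
  let c : X → N := Function.invFun ι ∘ γ
  have hlift : ι ∘ c =ᶠ[𝓝 x] γ := hmem.mono fun z hz => Function.invFun_eq hz
  have hcx : c x = q := hι.isEmbedding.injective (hlift.self_of_nhds.trans hγx)
  have hιc : ContMDiffAt 𝓘(ℝ, X) 𝓘(ℝ, E) ∞ (ι ∘ c) x := hγ.congr_of_eventuallyEq hlift
  have hc : ContMDiffAt 𝓘(ℝ, X) 𝓘(ℝ, F) ∞ c x := by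
    rw [ContMDiffAt.iff_comp_isImmersionAt (hι.isImmersion.isImmersionAt _)]
    exact ⟨hι.isEmbedding.isInducing.continuousAt_iff.2 hιc.continuousAt, hιc⟩
  have hcomp := hasMFDerivAt_comp_of_eq hd (hc.mdifferentiableAt (by simp)).hasMFDerivAt hcx
  have heq := hasMFDerivAt_unique (hγ'.congr_of_eventuallyEq hlift) hcomp
  rintro _ ⟨v, rfl⟩
  exact ⟨_, (DFunLike.congr_fun heq v).symm⟩

variable {A : Type*} [NormedAddCommGroup A] [NormedSpace ℝ A] [FiniteDimensional ℝ A]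
  {G : Type*} [TopologicalSpace G] [ChartedSpace A G] [Group G] [LieGroup 𝓘(ℝ, A) ∞ G]
  [FiniteDimensional ℝ E] [MulAction G M]
  [ContMDiffSMul 𝓘(ℝ, A) 𝓘(ℝ, E) ∞ G M] [IsManifold 𝓘(ℝ, E) ∞ M] [ProperSMul G M]

variable (A) in
theorem range_eq_fixedModVertical_of_hasMFDerivAt {K : Subgroup G} {m₀ : M}
    (hι : IsSmoothEmbedding 𝓘(ℝ, F) 𝓘(ℝ, E) ∞ ι)
    (hrange : Set.range ι = connectedComponentIn (orbitTypeSet M K) m₀) {q : N} {d : F →L[ℝ] E}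
    (hd : HasMFDerivAt 𝓘(ℝ, F) 𝓘(ℝ, E) ι q d) :
    d.range = fixedModVertical A G E (ι q) := by
  have hq : ι q ∈ connectedComponentIn (orbitTypeSet M K) m₀ := hrange ▸ ⟨q, rfl⟩
  obtain ⟨Ψ, S, y, hΨ, hmem⟩ := exists_isSliceChart_component A (G := G) E hq
  refine le_antisymm ?_ ?_
  · rintro _ ⟨w, rfl⟩
    refine mem_of_hasMFDerivAt_of_eventually_mem (f := Ψ ∘ ι)
      (hasMFDerivAt_comp_of_eq hΨ.hasMFDerivAt hd rfl) ?_ w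
    filter_upwards [hd.continuousAt.preimage_mem_nhds (Ψ.open_source.mem_nhds hΨ.mem_source)]
      with x hx
    exact (hmem _ hx).1 (hrange ▸ ⟨x, rfl⟩)
  · let T := fixedModVertical A G E (ι q)
    have h0 : T.subtypeL 0 ∈ Ψ.target := by
      simpa [hΨ.map_self] using Ψ.map_source hΨ.mem_source
    have hsymm := hasMFDerivAt_comp_of_eq (hasMFDerivAt_symm_id hΨ.mdifferentiable hΨ.mem_source
      hΨ.hasMFDerivAt) (T.subtypeL.hasFDerivAt (x := 0)).hasMFDerivAt (by simp [hΨ.map_self])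
    have hsm : ContMDiffAt 𝓘(ℝ, T) 𝓘(ℝ, E) ∞ (Ψ.symm ∘ T.subtypeL) 0 :=
      (hΨ.contMDiffOn_symm.contMDiffAt (Ψ.open_target.mem_nhds h0)).comp 0
        T.subtypeL.contDiff.contMDiff.contMDiffAt
    have hle := range_le_of_eventually_mem_range hι hd hsm hsymm
      (by simpa [hΨ.map_self] using Ψ.left_inv hΨ.mem_source) ?_
    · exact fun v hv => hle ⟨⟨v, hv⟩, rfl⟩
    · filter_upwards [T.subtypeL.continuous.continuousAt.preimage_mem_nhds
        (Ψ.open_target.mem_nhds h0)] with v hv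
      rw [hrange]
      exact (hmem _ (Ψ.map_target hv)).2 ((Ψ.right_inv hv).symm ▸ v.2)

end TangentSpace

section Pullback

variable {E : Type*} [NormedAddCommGroup E] [NormedSpace ℝ E]
  {M : Type*} [TopologicalSpace M] [ChartedSpace E M]
  {F : Type*} [NormedAddCommGroup F] [NormedSpace ℝ F]
  {N : Type*} [TopologicalSpace N] [ChartedSpace F N] {ι : N → M}

theorem pullbackCovector_differential {f : M → ℝ} {q : N}
    (hι : MDifferentiableAt 𝓘(ℝ, F) 𝓘(ℝ, E) ι q)
    (hf : MDifferentiableAt 𝓘(ℝ, E) 𝓘(ℝ, ℝ) f (ι q)) :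
    pullbackCovector 𝓘(ℝ, E) 𝓘(ℝ, F) ι q (differential f (ι q)) = differential (f ∘ ι) q :=
  (mfderiv_comp q hf hι).symm

theorem pullbackCovector_apply_of_hasMFDerivAt {q : N} {d : F →L[ℝ] E}
    (hd : HasMFDerivAt 𝓘(ℝ, F) 𝓘(ℝ, E) ι q d) (a : CotangentSpace 𝓘(ℝ, E) (ι q)) (v : F) :
    pullbackCovector 𝓘(ℝ, E) 𝓘(ℝ, F) ι q a v = a (d v) := by
  have hmf : mfderiv 𝓘(ℝ, F) 𝓘(ℝ, E) ι q = d := hd.mfderiv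
  change a (mfderiv 𝓘(ℝ, F) 𝓘(ℝ, E) ι q v) = _
  rw [hmf]
  rfl

variable {A : Type*} [NormedAddCommGroup A] [NormedSpace ℝ A]
  {G : Type*} [TopologicalSpace G] [ChartedSpace A G] [Group G]
  [MulAction G M] [ContMDiffSMul 𝓘(ℝ, A) 𝓘(ℝ, E) ∞ G M]

theorem apply_orbitDeriv_of_equivariant [MulAction G N]
    [ContMDiffSMul 𝓘(ℝ, A) 𝓘(ℝ, F) ∞ G N] (hG : ∀ (g : G) q, ι (g • q) = g • ι q) {q : N}
    {d : F →L[ℝ] E} (hd : HasMFDerivAt 𝓘(ℝ, F) 𝓘(ℝ, E) ι q d) (ξ : A) :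
    d (orbitDeriv A G F q ξ) = orbitDeriv A G E (ι q) ξ := by
  have hcomp := hasMFDerivAt_comp_of_eq hd (hasMFDerivAt_orbitMap_one (A := A) (G := G) q)
    (one_smul G q)
  have horbit := (hasMFDerivAt_orbitMap_one (A := A) (G := G) (E := E) (ι q)).congr_of_eventuallyEq
    (Filter.Eventually.of_forall fun g => hG g q)
  exact DFunLike.congr_fun (hasMFDerivAt_unique hcomp horbit) ξ

variable [FiniteDimensional ℝ A] [LieGroup 𝓘(ℝ, A) ∞ G] [FiniteDimensional ℝ E]
  [IsManifold 𝓘(ℝ, E) ∞ M] [ProperSMul G M]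

variable (A) in
theorem injOn_pullbackCovector {K : Subgroup G} {m₀ : M}
    (hι : IsSmoothEmbedding 𝓘(ℝ, F) 𝓘(ℝ, E) ∞ ι)
    (hrange : Set.range ι = connectedComponentIn (orbitTypeSet M K) m₀) (q : N) :
    Set.InjOn (pullbackCovector 𝓘(ℝ, E) 𝓘(ℝ, F) ι q)
      (invariantVerticalAnnihilator 𝓘(ℝ, A) G 𝓘(ℝ, E) (ι q)) := by
  obtain ⟨d, -, hd, -⟩ := exists_leftInverse_of_isImmersion hι.isImmersion q
  intro a ha b hb hab
  rw [← sub_eq_zero] at hab ⊢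
  rw [← map_sub] at hab
  refine eq_zero_of_mem_basicCovectors (A := A) (G := G) (E := E) (p := ι q)
    (mem_invariantVerticalAnnihilator_iff.1 (Submodule.sub_mem _ ha hb)) ?_
  rw [← range_eq_fixedModVertical_of_hasMFDerivAt A hι hrange hd]
  rintro _ ⟨v, rfl⟩
  exact (pullbackCovector_apply_of_hasMFDerivAt hd (a - b) v).symm.trans
    (DFunLike.congr_fun hab v)

variable [MulAction G N] [ContMDiffSMul 𝓘(ℝ, A) 𝓘(ℝ, F) ∞ G N]
  [IsManifold 𝓘(ℝ, F) ∞ N]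

theorem pullbackCovector_mem_smoothAnnihilator (hι : ContMDiff 𝓘(ℝ, F) 𝓘(ℝ, E) ∞ ι)
    (hG : ∀ (g : G) q, ι (g • q) = g • ι q) {q : N} {a : CotangentSpace 𝓘(ℝ, E) (ι q)}
    (ha : a ∈ invariantVerticalAnnihilator 𝓘(ℝ, A) G 𝓘(ℝ, E) (ι q)) :
    pullbackCovector 𝓘(ℝ, E) 𝓘(ℝ, F) ι q a ∈
      smoothAnnihilator 𝓘(ℝ, F) (fun x : N => verticalSpace 𝓘(ℝ, A) G 𝓘(ℝ, F) x) q := by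
  obtain ⟨haV, haH⟩ := mem_invariantVerticalAnnihilator_iff.1 ha
  obtain ⟨U, f, hU, hqU, -, hf, hfG, hfa⟩ := exists_invariant_function A E haV haH
  have hdf : differential f (ι q) = a := hfa.mfderiv
  rw [← hdf, pullbackCovector_differential ((hι q).mdifferentiableAt (by simp))
    hfa.mdifferentiableAt]
  refine differential_mem_smoothAnnihilator (U := ι ⁻¹' U) (hU.preimage hι.continuous)
    (hf.comp hι.contMDiffOn fun _ hx => hx) (fun g x hx => ?_) hqU
  simp only [Function.comp_apply, hG]
  exact hfG g _ hx

theorem map_invariantVerticalAnnihilator {K : Subgroup G} {m₀ : M}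
    (hι : IsSmoothEmbedding 𝓘(ℝ, F) 𝓘(ℝ, E) ∞ ι)
    (hrange : Set.range ι = connectedComponentIn (orbitTypeSet M K) m₀)
    (hG : ∀ (g : G) q, ι (g • q) = g • ι q) (q : N) :
    (invariantVerticalAnnihilator 𝓘(ℝ, A) G 𝓘(ℝ, E) (ι q)).map
        (pullbackCovector 𝓘(ℝ, E) 𝓘(ℝ, F) ι q) =
      smoothAnnihilator 𝓘(ℝ, F) (fun x : N => verticalSpace 𝓘(ℝ, A) G 𝓘(ℝ, F) x) q := by
  refine le_antisymm ?_ fun b hb => ?_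
  · rintro _ ⟨a, ha, rfl⟩
    exact pullbackCovector_mem_smoothAnnihilator hι.contMDiff hG ha
  · obtain ⟨d, l, hd, hl⟩ := exists_leftInverse_of_isImmersion hι.isImmersion q
    have hT := range_eq_fixedModVertical_of_hasMFDerivAt A hι hrange hd
    let b' : F →L[ℝ] ℝ := b
    have hbV : ∀ v ∈ (orbitDeriv A G E (ι q)).range, (b'.comp l) v = 0 := by
      rintro _ ⟨ξ, rfl⟩
      change b' (l (orbitDeriv A G E (ι q) ξ)) = 0
      rw [← apply_orbitDeriv_of_equivariant hG hd, hl]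
      exact apply_orbitDeriv_eq_zero_of_mem_smoothAnnihilator hb ξ
    obtain ⟨a, ha, hab⟩ := exists_mem_basicCovectors_eqOn A hbV
    refine ⟨a, mem_invariantVerticalAnnihilator_iff.2 ha, ContinuousLinearMap.ext fun v => ?_⟩
    calc pullbackCovector 𝓘(ℝ, E) 𝓘(ℝ, F) ι q a v
        = a (d v) := pullbackCovector_apply_of_hasMFDerivAt hd _ v
      _ = b' (l (d v)) := hab (d v) (hT ▸ ⟨v, rfl⟩)
      _ = b' v := congrArg b' (hl v)

end Pullback

section Stratum

variable {A : Type*} [NormedAddCommGroup A] [NormedSpace ℝ A] [FiniteDimensional ℝ A]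
  {G : Type*} [TopologicalSpace G] [ChartedSpace A G] [Group G] [LieGroup 𝓘(ℝ, A) ∞ G]
  {E : Type*} [NormedAddCommGroup E] [NormedSpace ℝ E] [FiniteDimensional ℝ E]
  {M : Type*} [TopologicalSpace M] [ChartedSpace E M] [MulAction G M]
  [ContMDiffSMul 𝓘(ℝ, A) 𝓘(ℝ, E) ∞ G M] [IsManifold 𝓘(ℝ, E) ∞ M] [ProperSMul G M]
  {F : Type*} [NormedAddCommGroup F] [NormedSpace ℝ F]
  {N : Type*} [TopologicalSpace N] [ChartedSpace F N] {ι : N → M}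

theorem span_differential_eq_invariantVerticalAnnihilator {r : ℕ} {W : Set M} {f : Fin r → M → ℝ}
    (hW : IsOpen W) (hWG : ∀ (g : G), ∀ x ∈ W, g • x ∈ W)
    (hf : ∀ i, ContMDiffOn 𝓘(ℝ, E) 𝓘(ℝ, ℝ) ∞ (f i) W)
    (hfG : ∀ i (g : G), ∀ x ∈ W, f i (g • x) = f i x) {x : M} (hx : x ∈ W)
    (hr : Module.finrank ℝ (basicCovectors A G E x) = r)
    (hli : LinearIndependent ℝ fun i => (differential (f i) x : CotangentSpace 𝓘(ℝ, E) x)) :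
    Submodule.span ℝ (Set.range fun i => (differential (f i) x : CotangentSpace 𝓘(ℝ, E) x)) =
      invariantVerticalAnnihilator 𝓘(ℝ, A) G 𝓘(ℝ, E) x := by
  let s : Fin r → E →L[ℝ] ℝ := fun i => differential (f i) x
  have hs : LinearIndependent ℝ s := hli
  have hspan : Submodule.span ℝ (Set.range s) = basicCovectors A G E x := by
    refine Submodule.eq_of_le_of_finrank_eq (Submodule.span_le.2 ?_) ?_
    · rintro _ ⟨i, rfl⟩
      exact mem_invariantVerticalAnnihilator_iff.1
        (differential_mem_invariantVerticalAnnihilator hW hWG (hf i) (hfG i) hx)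
    · rw [finrank_span_eq_card hs, hr, Fintype.card_fin]
  ext a
  exact (SetLike.ext_iff.1 hspan a).trans mem_invariantVerticalAnnihilator_iff.symm

theorem isSmoothSubbundle_invariantVerticalAnnihilator (hι : ContMDiff 𝓘(ℝ, F) 𝓘(ℝ, E) ∞ ι)
    {r : ℕ} (hr : ∀ q, Module.finrank ℝ (basicCovectors A G E (ι q)) = r) :
    IsSmoothSubbundle 𝓘(ℝ, E) 𝓘(ℝ, F) ι
      fun q => invariantVerticalAnnihilator 𝓘(ℝ, A) G 𝓘(ℝ, E) (ι q) := by
  refine ⟨r, fun q => ?_⟩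
  obtain ⟨W, f, hW, hqW, hWG, hf, hfG, hli⟩ := exists_invariant_functions A G E (ι q) (hr q)
  have hdf : ∀ i, SmoothFormOn 𝓘(ℝ, E) 𝓘(ℝ, F) ι (fun x => differential (f i) (ι x)) (ι ⁻¹' W) :=
    fun i => (smoothFormOn_differential hW (hf i)).comp_map hι
  obtain ⟨U, Z, hU, hqU, hUW, -, hdual⟩ :=
    exists_dual_fields hι (hW.preimage hι.continuous) hdf hqW hli
  refine ⟨U, hU, hqU, fun i x => differential (f i) (ι x), fun i => (hdf i).mono hUW,
    fun x hx => ?_⟩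
  have hlix : LinearIndependent ℝ fun i =>
      (differential (f i) (ι x) : CotangentSpace 𝓘(ℝ, E) (ι x)) :=
    .of_pairwise_dual_eq_zero_one _ (fun j => evalCovector (Z j x))
      (fun j i hne => (hdual x hx i j).trans (if_neg hne.symm))
      fun i => (hdual x hx i i).trans (if_pos rfl)
  exact ⟨hlix, span_differential_eq_invariantVerticalAnnihilator hW hWG hf hfG (hUW hx) (hr x) hlix⟩

variable (A) in
theorem isSmoothSubbundle_invariantVerticalAnnihilator_of_range {K : Subgroup G} {m₀ : M}
    (hι : ContMDiff 𝓘(ℝ, F) 𝓘(ℝ, E) ∞ ι)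
    (hrange : Set.range ι = connectedComponentIn (orbitTypeSet M K) m₀) :
    IsSmoothSubbundle 𝓘(ℝ, E) 𝓘(ℝ, F) ι
      fun q => invariantVerticalAnnihilator 𝓘(ℝ, A) G 𝓘(ℝ, E) (ι q) := by
  refine isSmoothSubbundle_invariantVerticalAnnihilator hι
    (r := Module.finrank ℝ (basicCovectors A G E m₀)) fun q => ?_
  have hq : ι q ∈ connectedComponentIn (orbitTypeSet M K) m₀ := hrange ▸ ⟨q, rfl⟩
  exact finrank_basicCovectors_eq_of_mem_component A E hq
    (mem_connectedComponentIn (connectedComponentIn_nonempty_iff.1 ⟨ι q, hq⟩))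

theorem isPullbackBundleIso_invariantVerticalAnnihilator [IsManifold 𝓘(ℝ, F) ∞ N]
    [MulAction G N] [ContMDiffSMul 𝓘(ℝ, A) 𝓘(ℝ, F) ∞ G N]
    {K : Subgroup G} {m₀ : M} (hι : IsSmoothEmbedding 𝓘(ℝ, F) 𝓘(ℝ, E) ∞ ι)
    (hrange : Set.range ι = connectedComponentIn (orbitTypeSet M K) m₀)
    (hG : ∀ (g : G) q, ι (g • q) = g • ι q) :
    IsPullbackBundleIso 𝓘(ℝ, E) 𝓘(ℝ, F) ι
      (fun q => invariantVerticalAnnihilator 𝓘(ℝ, A) G 𝓘(ℝ, E) (ι q))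
      (fun q => smoothAnnihilator 𝓘(ℝ, F)
        (fun x : N => verticalSpace 𝓘(ℝ, A) G 𝓘(ℝ, F) x) q) := by
  have hmap := map_invariantVerticalAnnihilator hι hrange hG (A := A)
  exact isPullbackBundleIso_of_bijOn hι.contMDiff
    (isSmoothSubbundle_invariantVerticalAnnihilator_of_range A hι.contMDiff hrange) fun q =>
      ⟨fun a ha => (hmap q).le ⟨a, ha, rfl⟩, injOn_pullbackCovector A hι hrange q,
        fun _ hb => (hmap q).ge hb⟩

end Stratum

section Metric

theorem exists_mem_forall_eq_of_posDef {E : Type*} [NormedAddCommGroup E] [NormedSpace ℝ E]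
    [FiniteDimensional ℝ E] {B : E →L[ℝ] E →L[ℝ] ℝ} (hB : ∀ v, v ≠ 0 → 0 < B v v)
    (T : Submodule ℝ E) (a : E →L[ℝ] ℝ) : ∃ t ∈ T, ∀ s ∈ T, B t s = a s := by
  let toDual : T →ₗ[ℝ] Module.Dual ℝ T :=
    (Module.Dual.transpose T.subtype).comp
      ((ContinuousLinearMap.coeLM ℝ).comp ((B : E →ₗ[ℝ] E →L[ℝ] ℝ).comp T.subtype))
  have hinj : Function.Injective toDual := by
    rw [injective_iff_map_eq_zero]
    intro t ht
    by_contra hne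
    exact (hB t (Subtype.coe_ne_coe.2 hne)).ne' (DFunLike.congr_fun ht t)
  obtain ⟨t, ht⟩ := (LinearMap.injective_iff_surjective_of_finrank_eq_finrank
    (Subspace.dual_finrank_eq (K := ℝ) (V := T)).symm).1 hinj ((a : E →ₗ[ℝ] ℝ).comp T.subtype)
  exact ⟨t, t.2, fun s hs => DFunLike.congr_fun ht (⟨s, hs⟩ : T)⟩

variable {A : Type*} [NormedAddCommGroup A] [NormedSpace ℝ A]
  {G : Type*} [TopologicalSpace G] [ChartedSpace A G] [Group G]
  {E : Type*} [NormedAddCommGroup E] [NormedSpace ℝ E]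
  {M : Type*} [TopologicalSpace M] [ChartedSpace E M] [MulAction G M]
  [ContMDiffSMul 𝓘(ℝ, A) 𝓘(ℝ, E) ∞ G M]

variable (A) in
theorem inner_smulDeriv_of_mem_stabilizer [IsManifold 𝓘(ℝ, E) ∞ M]
    {ρ : ContMDiffRiemannianMetric 𝓘(ℝ, E) ∞ E (fun m : M => TangentSpace 𝓘(ℝ, E) m)}
    (hρ : IsInvariantMetric G 𝓘(ℝ, E) ρ) {p : M} {h : G}
    (hh : h ∈ MulAction.stabilizer G p) (v w : E) :
    (ρ.inner p : E →L[ℝ] E →L[ℝ] ℝ) (smulDeriv A E h p v) (smulDeriv A E h p w) =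
      ρ.inner p v w := by
  have hcongr : ∀ x, x = p → (ρ.inner x : E →L[ℝ] E →L[ℝ] ℝ) = ρ.inner p := by
    rintro _ rfl
    rfl
  have hinv : (ρ.inner (h • p) : E →L[ℝ] E →L[ℝ] ℝ) (smulDeriv A E h p v) (smulDeriv A E h p w) =
    ρ.inner p v w := hρ h p v w
  rwa [hcongr _ hh] at hinv

variable [FiniteDimensional ℝ E]

-- The vector representing an isotropy-invariant covector is itself fixed by the isotropy group.
theorem apply_eq_zero_of_mem_basicCovectors_of_orthogonal {p : M} {B : E →L[ℝ] E →L[ℝ] ℝ}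
    (hB : ∀ v, v ≠ 0 → 0 < B v v)
    (hinv : ∀ h ∈ MulAction.stabilizer G p, ∀ v w,
      B (smulDeriv A E h p v) (smulDeriv A E h p w) = B v w)
    {a : E →L[ℝ] ℝ} (ha : a ∈ basicCovectors A G E p) {v : E}
    (hv : ∀ t ∈ fixedModVertical A G E p, B t v = 0) : a v = 0 := by
  obtain ⟨w, -, hw⟩ := exists_mem_forall_eq_of_posDef hB ⊤ a
  replace hw : B w = a := ContinuousLinearMap.ext fun s => hw s trivial
  rw [← hw]
  refine hv w fun h hh => ?_
  let R := smulDeriv A E h p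
  have hfixed : B (R w) = B w := by
    ext s
    obtain ⟨s, rfl⟩ := R.surjective s
    rw [hinv h hh, hw, ha.2 h hh]
  have hzero : R w - w = 0 := by
    by_contra hne
    refine (hB _ hne).ne' ?_
    rw [map_sub B, hfixed, sub_self, zero_apply]
  exact hzero ▸ Submodule.zero_mem _

theorem forall_basicCovectors_apply_eq_zero_iff [LieGroup 𝓘(ℝ, A) ∞ G] [IsManifold 𝓘(ℝ, E) ∞ M]
    [ProperSMul G M] {p : M} {B : E →L[ℝ] E →L[ℝ] ℝ} (hB : ∀ v, v ≠ 0 → 0 < B v v)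
    (hinv : ∀ h ∈ MulAction.stabilizer G p, ∀ v w,
      B (smulDeriv A E h p v) (smulDeriv A E h p w) = B v w) {v : E} :
    (∀ a ∈ basicCovectors A G E p, a v = 0) ↔
      ∃ u ∈ (orbitDeriv A G E p).range, ∃ w, (∀ t ∈ fixedModVertical A G E p, B t w = 0) ∧
        u + w = v := by
  constructor
  · intro hv
    obtain ⟨t, ht, htv⟩ := exists_mem_forall_eq_of_posDef (B := B.flip) hB
      (fixedModVertical A G E p) (B.flip v)
    have horth : ∀ s ∈ fixedModVertical A G E p, B s (v - t) = 0 := fun s hs => by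
      rw [map_sub, sub_eq_zero]
      exact (htv s hs).symm
    refine ⟨t, ?_, v - t, horth, add_sub_cancel _ _⟩
    by_contra htV
    obtain ⟨b, hbt, hbV⟩ := Submodule.exists_le_ker_of_notMem htV
    obtain ⟨a, ha, hab⟩ := exists_mem_basicCovectors_eqOn A
      (b := LinearMap.toContinuousLinearMap b) fun w hw => hbV hw
    have hav := apply_eq_zero_of_mem_basicCovectors_of_orthogonal hB hinv ha horth
    rw [map_sub, hv a ha, zero_sub, neg_eq_zero, hab t ht] at hav
    exact hbt hav
  · rintro ⟨u, hu, w, hw, rfl⟩ a ha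
    rw [map_add, ha.1 u hu, zero_add]
    exact apply_eq_zero_of_mem_basicCovectors_of_orthogonal hB hinv ha hw

variable [IsManifold 𝓘(ℝ, E) ∞ M]
  {ρ : ContMDiffRiemannianMetric 𝓘(ℝ, E) ∞ E (fun m : M => TangentSpace 𝓘(ℝ, E) m)}

variable [FiniteDimensional ℝ A] [LieGroup 𝓘(ℝ, A) ∞ G] [ProperSMul G M]
  {F : Type*} [NormedAddCommGroup F] [NormedSpace ℝ F]
  {N : Type*} [TopologicalSpace N] [ChartedSpace F N] {ι : N → M} {K : Subgroup G} {m₀ : M}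

variable (A) in
theorem mem_normalSpace_iff (hι : IsSmoothEmbedding 𝓘(ℝ, F) 𝓘(ℝ, E) ∞ ι)
    (hrange : Set.range ι = connectedComponentIn (orbitTypeSet M K) m₀) {q : N} {v : E} :
    v ∈ normalSpace 𝓘(ℝ, E) 𝓘(ℝ, F) ρ ι q ↔
      ∀ t ∈ fixedModVertical A G E (ι q), (ρ.inner (ι q) : E →L[ℝ] E →L[ℝ] ℝ) t v = 0 := by
  have hd := (hι.contMDiff q).mdifferentiableAt (by simp) |>.hasMFDerivAt
  rw [← range_eq_fixedModVertical_of_hasMFDerivAt A hι hrange hd]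
  refine ⟨fun h => ?_, fun h w => h _ ⟨w, rfl⟩⟩
  rintro _ ⟨w, rfl⟩
  exact h w

variable (A) in
theorem disjoint_verticalSpace_normalSpace (hι : IsSmoothEmbedding 𝓘(ℝ, F) 𝓘(ℝ, E) ∞ ι)
    (hrange : Set.range ι = connectedComponentIn (orbitTypeSet M K) m₀) (q : N) :
    Disjoint (verticalSpace 𝓘(ℝ, A) G 𝓘(ℝ, E) (ι q)) (normalSpace 𝓘(ℝ, E) 𝓘(ℝ, F) ρ ι q) := by
  rw [Submodule.disjoint_def]
  intro v hvertical hnormal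
  by_contra hne
  exact (ρ.pos (ι q) v hne).ne' ((mem_normalSpace_iff A hι hrange).1 hnormal v
    (range_orbitDeriv_le_fixedModVertical _ hvertical))

variable (A) in
theorem smoothCoannihilator_eq_sup (hι : IsSmoothEmbedding 𝓘(ℝ, F) 𝓘(ℝ, E) ∞ ι)
    (hrange : Set.range ι = connectedComponentIn (orbitTypeSet M K) m₀)
    (hρ : IsInvariantMetric G 𝓘(ℝ, E) ρ) (q : N) :
    smoothCoannihilator 𝓘(ℝ, E) 𝓘(ℝ, F) ι
        (fun x => invariantVerticalAnnihilator 𝓘(ℝ, A) G 𝓘(ℝ, E) (ι x)) q =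
      ((verticalSpace 𝓘(ℝ, A) G 𝓘(ℝ, E) (ι q) ⊔ normalSpace 𝓘(ℝ, E) 𝓘(ℝ, F) ρ ι q :
        Submodule ℝ (TangentSpace 𝓘(ℝ, E) (ι q))) : Set (TangentSpace 𝓘(ℝ, E) (ι q))) := by
  have hC := isSmoothSubbundle_invariantVerticalAnnihilator_of_range A hι.contMDiff hrange
  ext v
  calc v ∈ smoothCoannihilator 𝓘(ℝ, E) 𝓘(ℝ, F) ι
          (fun x => invariantVerticalAnnihilator 𝓘(ℝ, A) G 𝓘(ℝ, E) (ι x)) q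
      ↔ ∀ a ∈ basicCovectors A G E (ι q), a v = 0 :=
        (mem_smoothCoannihilator_iff hι.contMDiff hC).trans
          (forall_congr' fun _ => imp_congr_left mem_invariantVerticalAnnihilator_iff)
    _ ↔ ∃ u ∈ (orbitDeriv A G E (ι q)).range, ∃ w : E,
          (∀ t ∈ fixedModVertical A G E (ι q),
            (ρ.inner (ι q) : E →L[ℝ] E →L[ℝ] ℝ) t w = 0) ∧ u + w = v :=
        forall_basicCovectors_apply_eq_zero_iff (E := E) (ρ.pos (ι q)) fun _ hh =>
          inner_smulDeriv_of_mem_stabilizer A hρ hh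
    _ ↔ v ∈ verticalSpace 𝓘(ℝ, A) G 𝓘(ℝ, E) (ι q) ⊔ normalSpace 𝓘(ℝ, E) 𝓘(ℝ, F) ρ ι q := by
        simp only [Submodule.mem_sup, ← mem_normalSpace_iff A hι hrange]
        rfl

end Metric

theorem lemma5p9_general
    (A : Type*) [NormedAddCommGroup A] [NormedSpace ℝ A] [FiniteDimensional ℝ A]
    (E : Type*) [NormedAddCommGroup E] [NormedSpace ℝ E] [FiniteDimensional ℝ E]
    {M : Type*} [TopologicalSpace M] [ChartedSpace E M] [IsManifold 𝓘(ℝ, E) ∞ M]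
    {G : Type*} [TopologicalSpace G] [ChartedSpace A G] [Group G] [LieGroup 𝓘(ℝ, A) ∞ G]
    [MulAction G M] [ContMDiffSMul 𝓘(ℝ, A) 𝓘(ℝ, E) ∞ G M] [ProperSMul G M]
    {K : Subgroup G} {m₀ : M} {P : SubMulAction G M}
    (hP : (P : Set M) = connectedComponentIn (orbitTypeSet M K) m₀) :
    (∃ (k : ℕ) (_ : ChartedSpace (EuclideanSpace ℝ (Fin k)) P),
      IsManifold (𝓡 k) ∞ P ∧ IsSmoothEmbedding (𝓡 k) 𝓘(ℝ, E) ∞ (Subtype.val : P → M)) ∧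
    ∀ {F : Type*} [NormedAddCommGroup F] [NormedSpace ℝ F] [ChartedSpace F P]
      [IsManifold 𝓘(ℝ, F) ∞ P],
      IsSmoothEmbedding 𝓘(ℝ, F) 𝓘(ℝ, E) ∞ (Subtype.val : P → M) →
      (∀ p : P,
        (invariantVerticalAnnihilator 𝓘(ℝ, A) G 𝓘(ℝ, E) (p : M)).map
            (pullbackCovector 𝓘(ℝ, E) 𝓘(ℝ, F) (Subtype.val : P → M) p)
          = smoothAnnihilator 𝓘(ℝ, F) (fun q : P => verticalSpace 𝓘(ℝ, A) G 𝓘(ℝ, F) q) p) ∧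
      IsPullbackBundleIso 𝓘(ℝ, E) 𝓘(ℝ, F) (Subtype.val : P → M)
        (fun p : P => invariantVerticalAnnihilator 𝓘(ℝ, A) G 𝓘(ℝ, E) (p : M))
        (fun p : P => smoothAnnihilator 𝓘(ℝ, F)
          (fun q : P => verticalSpace 𝓘(ℝ, A) G 𝓘(ℝ, F) q) p) ∧
      ∀ ρ : ContMDiffRiemannianMetric 𝓘(ℝ, E) ∞ E (fun m : M => TangentSpace 𝓘(ℝ, E) m),
        IsInvariantMetric G 𝓘(ℝ, E) ρ →
        ∀ p : P,
          Disjoint (verticalSpace 𝓘(ℝ, A) G 𝓘(ℝ, E) (p : M))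
            (normalSpace 𝓘(ℝ, E) 𝓘(ℝ, F) ρ (Subtype.val : P → M) p) ∧
          smoothCoannihilator 𝓘(ℝ, E) 𝓘(ℝ, F) (Subtype.val : P → M)
              (fun q : P => invariantVerticalAnnihilator 𝓘(ℝ, A) G 𝓘(ℝ, E) (q : M)) p
            = ((verticalSpace 𝓘(ℝ, A) G 𝓘(ℝ, E) (p : M) ⊔
                normalSpace 𝓘(ℝ, E) 𝓘(ℝ, F) ρ (Subtype.val : P → M) p :
                Submodule ℝ (TangentSpace 𝓘(ℝ, E) (p : M))) :
              Set (TangentSpace 𝓘(ℝ, E) (p : M))) := by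
  have hrange : Set.range (Subtype.val : P → M) = connectedComponentIn (orbitTypeSet M K) m₀ :=
    Subtype.range_coe.trans hP
  refine ⟨⟨Module.finrank ℝ (fixedModVertical A G E m₀), exists_chartedSpace_of_range_eq_component
    finrank_euclideanSpace_fin IsEmbedding.subtypeVal hrange⟩, fun {F} _ _ _ _ hι => ?_⟩
  have hG : ∀ (g : G) (q : P), ((g • q : P) : M) = g • (q : M) := fun _ _ => rfl
  have : ContMDiffSMul 𝓘(ℝ, A) 𝓘(ℝ, F) ∞ G P := contMDiffSMul_of_isSmoothEmbedding hι hG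
  exact ⟨map_invariantVerticalAnnihilator hι hrange hG,
    isPullbackBundleIso_invariantVerticalAnnihilator hι hrange hG, fun ρ hρ p =>
      ⟨disjoint_verticalSpace_normalSpace A hι hrange p,
        smoothCoannihilator_eq_sup A hι hrange hρ p⟩⟩

theorem lemma5p9 {n d : ℕ}
    {M : Type*} [TopologicalSpace M] [T2Space M] [ParacompactSpace M]
    [ChartedSpace (EuclideanSpace ℝ (Fin n)) M] [IsManifold (𝓡 n) ∞ M]
    {G : Type*} [TopologicalSpace G] [ChartedSpace (EuclideanSpace ℝ (Fin d)) G] [Group G]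
    [LieGroup (𝓡 d) ∞ G] [ConnectedSpace G]
    [MulAction G M] [ContMDiffSMul (𝓡 d) (𝓡 n) ∞ G M] [ProperSMul G M]
    (K : Subgroup G) (m₀ : M) (hm₀ : m₀ ∈ orbitTypeSet M K)
    (P : SubMulAction G M) (hP : P = orbitTypeStratum K m₀) :
    (∃ (k : ℕ) (_ : ChartedSpace (EuclideanSpace ℝ (Fin k)) P),
      IsManifold (𝓡 k) ∞ P ∧ IsSmoothEmbedding (𝓡 k) (𝓡 n) ∞ (Subtype.val : P → M)) ∧
    ∀ (k : ℕ) [ChartedSpace (EuclideanSpace ℝ (Fin k)) P] [IsManifold (𝓡 k) ∞ P],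
      IsSmoothEmbedding (𝓡 k) (𝓡 n) ∞ (Subtype.val : P → M) →
      (∀ p : P,
        (invariantVerticalAnnihilator (𝓡 d) G (𝓡 n) (p : M)).map
            (pullbackCovector (𝓡 n) (𝓡 k) (Subtype.val : P → M) p)
          = smoothAnnihilator (𝓡 k) (fun q : P => verticalSpace (𝓡 d) G (𝓡 k) q) p) ∧
      IsPullbackBundleIso (𝓡 n) (𝓡 k) (Subtype.val : P → M)
        (fun p : P => invariantVerticalAnnihilator (𝓡 d) G (𝓡 n) (p : M))
        (fun p : P => smoothAnnihilator (𝓡 k) (fun q : P => verticalSpace (𝓡 d) G (𝓡 k) q) p) ∧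
      ∀ ρ : ContMDiffRiemannianMetric (𝓡 n) ∞ (EuclideanSpace ℝ (Fin n))
          (fun m : M => TangentSpace (𝓡 n) m),
        IsInvariantMetric G (𝓡 n) ρ →
        ∀ p : P,
          Disjoint (verticalSpace (𝓡 d) G (𝓡 n) (p : M))
            (normalSpace (𝓡 n) (𝓡 k) ρ (Subtype.val : P → M) p) ∧
          smoothCoannihilator (𝓡 n) (𝓡 k) (Subtype.val : P → M)
              (fun q : P => invariantVerticalAnnihilator (𝓡 d) G (𝓡 n) (q : M)) p
            = ((verticalSpace (𝓡 d) G (𝓡 n) (p : M) ⊔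
                normalSpace (𝓡 n) (𝓡 k) ρ (Subtype.val : P → M) p :
                Submodule ℝ (TangentSpace (𝓡 n) (p : M))) : Set (TangentSpace (𝓡 n) (p : M))) := by
  have hgeneral := lemma5p9_general (EuclideanSpace ℝ (Fin d)) (EuclideanSpace ℝ (Fin n))
    (congrArg SetLike.coe hP)
  exact ⟨hgeneral.1, fun _ _ _ hι => hgeneral.2 hι⟩
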